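/- Let $p_1,\dots,p_n\in\mathbb R^2$ ($n\ge 3$) be the vertices of a convex $n$-gon $P_n$, in cyclic order and with no three collinear. For $1\le k\le n-1$ let $\Delta_n^{(k)}=\{x\in[0,1]^n:\sum_i x_i=k\}$ be the hypersimplex, whose vertices are $e_B=\sum_{i\in B}e_i$ for $B\subseteq[n]$, $|B|=k$. Let $\pi:\mathbb R^n\to\mathbb R^2$ be the linear map with $\pi(e_i)=p_i$, and let $P_n^{(k)}$ be the configuration of the points $\pi(e_B)=\sum_{i\in B}p_i$, labelled by the $k$-subsets $B$ of $[n]$ (different labels may give the same point). A face of a set $C$ of labels is the set of all $B \in C$ at which some linear functional on $\mathbb R^2$, evaluated at $\pi(e_B)$, attains its minimum over $C$. A *hypertriangulation* of $P_n^{(k)}$ is a finite set $S$ of cells, each cell being a nonempty set of $k$-subsets of $[n]$, such that 1. every cell is the label set of the vertices of a nonempty face $F$ of $\Delta_n^{(k)}$; 2. every nonempty face of a cell is a cell; 3. the convex hulls $\pi(F)$ of the cells cover $\operatorname{conv}(P_n^{(k)})$; 4. the convex hulls of different cells have disjoint relative interiors; 5. $S$ is fine: $\dim \pi(F)=\dim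 F$ for every cell. The hypertriangulations of $P_n^{(1)}$ are the triangulations of $P_n$. For such a triangulation $T$ let $\deg_T(i)$ be the number of diagonals of $T$ (edges of $T$ that are not sides of $P_n$) incident to the vertex $i$, and let $C_m=\frac1{m+1}\binom{2m}{m}$ be the $m$-th Catalan number. Then the number $C_n^{(2)}$ of hypertriangulations of $P_n^{(2)}$ satisfies $$C_n^{(2)}=\sum_{T}\ \prod_{i=1}^{n} C_{\deg_T(i)},$$ where the sum runs over all triangulations $T$ of $P_n$. -/

import Mathlib

namespace Hypertri

/-- The vertex `∑ i ∈ B, e i` of the unit cube in `ℝⁿ` labelled by a subset `B`. -/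
def cubeVertex {n : ℕ} (B : Finset (Fin n)) : Fin n → ℝ :=
  fun i => if i ∈ B then 1 else 0

/-- The linear projection `π : ℝⁿ → E` that sends the basis vector `e i` to `p i`. -/
noncomputable def proj {n : ℕ} {E : Type*} [AddCommGroup E] [Module ℝ E] (p : Fin n → E) :
    (Fin n → ℝ) →ₗ[ℝ] E :=
  Fintype.linearCombination ℝ p

/-- The point labelled by `B` of the projected configuration, that is `∑ i ∈ B, p i`. -/
noncomputable def point {n : ℕ} {E : Type*} [AddCommGroup E] [Module ℝ E] (p : Fin n → E)
    (B : Finset (Fin n)) : E :=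
  proj p (cubeVertex B)

/-- Labels of the points of the `k`-th deleted sum: the `k`-subsets of `Fin n`. They also label
the vertices of the hypersimplex `Δ_n^{(k)}`. -/
def labels (n k : ℕ) : Finset (Finset (Fin n)) :=
  Finset.powersetCard k Finset.univ

/-- `D` is a (nonempty) face of the labelled point configuration `(v B)`, `B ∈ C`: the set of all
labels in `C` at which some linear functional attains its minimum over `C`.
(The zero functional gives `C` itself.) -/
def IsFace {n : ℕ} {V : Type*} [AddCommGroup V] [Module ℝ V] (v : Finset (Fin n) → V)
    (D C : Finset (Finset (Fin n))) : Prop :=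
  D.Nonempty ∧ ∃ f : V →ₗ[ℝ] ℝ, ∀ B, B ∈ D ↔ B ∈ C ∧ ∀ B' ∈ C, f (v B) ≤ f (v B')

/-- The dimension of the convex hull of the points `v B`, `B ∈ C`. -/
noncomputable def dim {n : ℕ} {V : Type*} [AddCommGroup V] [Module ℝ V]
    (v : Finset (Fin n) → V) (C : Finset (Finset (Fin n))) : ℕ :=
  Module.finrank ℝ (vectorSpan ℝ (v '' (C : Set (Finset (Fin n)))))

/-- The convex hull of the points labelled by `C`. -/
def hull {n : ℕ} {E : Type*} [AddCommGroup E] [Module ℝ E] (p : Fin n → E)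
    (C : Finset (Finset (Fin n))) : Set E :=
  convexHull ℝ (point p '' (C : Set (Finset (Fin n))))

/-- A hypersimplicial subdivision of level `k` of the configuration `p`, given as its set of
(labelled, nonempty) cells of all dimensions: a polyhedral subdivision of the `k`-th deleted sum
all of whose cells are projections of faces of the hypersimplex. -/
structure IsHypersimplicialSubdivision {n : ℕ} {E : Type*} [NormedAddCommGroup E]
    [NormedSpace ℝ E] (p : Fin n → E) (k : ℕ) (S : Finset (Finset (Finset (Fin n)))) : Prop where
  /-- every cell is the projection of a face of the hypersimplex -/
  induced : ∀ C ∈ S, IsFace cubeVertex C (labels n k)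
  /-- every face of a cell is a cell -/
  closed : ∀ C ∈ S, ∀ D, IsFace (point p) D C → D ∈ S
  /-- the cells cover the convex hull of the configuration -/
  covers : ⋃ C ∈ S, hull p C = hull p (labels n k)
  /-- different cells have disjoint relative interiors -/
  disjoint : ∀ C ∈ S, ∀ D ∈ S, C ≠ D →
    Disjoint (intrinsicInterior ℝ (hull p C)) (intrinsicInterior ℝ (hull p D))

/-- A hypertriangulation of level `k` of `p` is a fine hypersimplicial subdivision: no cell loses
dimension under the projection. -/
structure IsHypertriangulation {n : ℕ} {E : Type*} [NormedAddCommGroup E]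
    [NormedSpace ℝ E] (p : Fin n → E) (k : ℕ) (S : Finset (Finset (Finset (Fin n)))) : Prop
    extends IsHypersimplicialSubdivision p k S where
  fine : ∀ C ∈ S, dim cubeVertex C = dim (point p) C

open Classical in
/-- The finite set of all hypertriangulations of level `k` of `p`. For `k = 1` the cells are given
by sets of singletons, and these are the triangulations of `p`. -/
noncomputable def hypertriangulations {n : ℕ} {E : Type*} [NormedAddCommGroup E]
    [NormedSpace ℝ E] (p : Fin n → E) (k : ℕ) : Finset (Finset (Finset (Finset (Fin n)))) :=
  Finset.univ.filter (IsHypertriangulation p k)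

/-- The triangulations of `p`, as sets of cells (a vertex `i` carries the label `{i}`). -/
noncomputable def triangulations {n : ℕ} {E : Type*} [NormedAddCommGroup E]
    [NormedSpace ℝ E] (p : Fin n → E) : Finset (Finset (Finset (Finset (Fin n)))) :=
  hypertriangulations p 1

/-- Twice the signed area of the triangle `a b c`. -/
def cross (a b c : EuclideanSpace ℝ (Fin 2)) : ℝ :=
  (b 0 - a 0) * (c 1 - a 1) - (b 1 - a 1) * (c 0 - a 0)

/-- `p 0, …, p (n - 1)` are the vertices of a (strictly) convex `n`-gon, listed in cyclic order,
either counterclockwise or clockwise. -/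
def IsConvexPolygon {n : ℕ} (p : Fin n → EuclideanSpace ℝ (Fin 2)) : Prop :=
  3 ≤ n ∧
    ((∀ i j k, i < j → j < k → 0 < cross (p i) (p j) (p k)) ∨
      (∀ i j k, i < j → j < k → cross (p i) (p j) (p k) < 0))

/-- `i` and `j` are cyclically consecutive, that is, `i j` is a side of the polygon. -/
def IsSide {n : ℕ} (i j : Fin n) : Prop :=
  (i.val + 1) % n = j.val ∨ (j.val + 1) % n = i.val

open Classical in
/-- The number of diagonals (edges that are not sides of the polygon) at `i` in `T`. -/
noncomputable def degree {n : ℕ} (T : Finset (Finset (Finset (Fin n)))) (i : Fin n) : ℕ :=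
  (Finset.univ.filter fun j : Fin n => j ≠ i ∧ ¬ IsSide i j ∧ {{i}, {j}} ∈ T).card

end Hypertri

/-! The proof replaces the geometry of subdivisions by linear equations between boundary chains.
Orient every triangle counterclockwise and let a family of triangles with labelled vertices have as
its boundary chain the signed sum of its directed edges. For the admissible triangles considered
here, such a family triangulates the convex hull of the configuration exactly when its boundary
chain is the boundary cycle of the hull. One direction (`IsTriComplex.sum_edgeSign`) holds because
an inner edge has one triangle on each side. The other (`isTriComplex_faces`) is ray casting: the
number of triangles above a generic point is a sum over directed edges of chain coefficient times
signed crossing number, so it depends on the chain only, and it equals one. The same count for the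
star of a single cell gives disjointness in lower dimensions.

Fineness bounds the dimension of the cells by two. A face of the second hypersimplex of dimension at
most two lies in a black triangle, the three pairs inside a triple `t`, or in a white triangle, the
pairs `{i, j}` with `j ∈ t` for an apex `i ∉ t` (`subset_black_or_white_of_isFace`). So a
hypertriangulation is given by a set `T` of triples (black) and, for each `i`, a set `W i` of
triples (white with apex `i`).

Every edge of such a triangle joins some `{i, j}` to some `{i, k}`. The triangles on this edge are
white with apex `i`, or the black one over `{i, j, k}`. The latter is a point reflection of the
triangle `i j k`, which makes its coefficient the negative of that of `j k` in the triple. For fixed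
`i` the boundary equation therefore says that the boundary of `W i` is the link of `i` in `T` plus
the segment that cuts off the corner `i` of the polygon.

Summing over `k` eliminates `W i` and leaves the statement that the boundary of `T` is the boundary
of the polygon, so `T` is a triangulation. Then the right-hand side is the boundary of the convex
polygon spanned by the neighbours of `i` in `T` (`IsTriang.bd_nbrs`), and `W i` is an arbitrary
triangulation of that polygon (`IsProper.chain_iff`). It has two more vertices than `i` has
diagonals, so the choices for the different `i` are independent and counted by Catalan numbers
(`card_triangs`). -/

namespace Hypertri

local notation "ℰ" => EuclideanSpace ℝ (Fin 2)

/-! ### Barycentric weights and relative interiors of simplices -/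

section ConvexCombinations

variable {ι E : Type*} [NormedAddCommGroup E] [NormedSpace ℝ E]

/-- The points with strictly positive barycentric weights on the points labelled by `C`. -/
def relInt (v : ι → E) (C : Finset ι) : Set E :=
  {x | ∃ w : ι → ℝ, (∀ a ∈ C, 0 < w a) ∧ ∑ a ∈ C, w a = 1 ∧ ∑ a ∈ C, w a • v a = x}

lemma mem_hull_iff (v : ι → E) (C : Finset ι) (x : E) :
    x ∈ convexHull ℝ (v '' (C : Set ι)) ↔
      ∃ w : ι → ℝ, (∀ a ∈ C, 0 ≤ w a) ∧ ∑ a ∈ C, w a = 1 ∧ ∑ a ∈ C, w a • v a = x := by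
  classical
  constructor
  · intro hx
    have : convexHull ℝ (v '' (C : Set ι)) ⊆
        {x | ∃ w : ι → ℝ, (∀ a ∈ C, 0 ≤ w a) ∧ ∑ a ∈ C, w a = 1 ∧ ∑ a ∈ C, w a • v a = x} := by
      apply convexHull_min
      · rintro _ ⟨a, ha, rfl⟩
        have ha' : a ∈ C := ha
        refine ⟨fun b => if b = a then 1 else 0, fun b _ => by dsimp only; split_ifs <;> norm_num,
          by simp [ha'], by simp [ha']⟩
      · rintro x ⟨w, hw, hw1, rfl⟩ y ⟨u, hu, hu1, rfl⟩ r s hr hs hrs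
        refine ⟨fun a => r * w a + s * u a, fun a ha => ?_, ?_, ?_⟩
        · have := hw a ha
          have := hu a ha
          positivity
        · rw [Finset.sum_add_distrib, ← Finset.mul_sum, ← Finset.mul_sum, hw1, hu1]
          linarith
        · simp only [add_smul, mul_smul, Finset.sum_add_distrib, Finset.smul_sum]
    exact this hx
  · rintro ⟨w, hw, hw1, rfl⟩
    exact (convex_convexHull ℝ _).sum_mem hw hw1
      fun a ha => subset_convexHull ℝ _ ⟨a, ha, rfl⟩

lemma relInt_subset_hull (v : ι → E) (C : Finset ι) :
    relInt v C ⊆ convexHull ℝ (v '' (C : Set ι)) := by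
  rintro x ⟨w, hw, h1, h2⟩
  exact (mem_hull_iff v C x).2 ⟨w, fun a ha => (hw a ha).le, h1, h2⟩

lemma weights_unique {v : ι → E} {C : Finset ι} (h : AffineIndependent ℝ fun a : C => v a)
    {w u : ι → ℝ} (h1 : ∑ a ∈ C, w a = ∑ a ∈ C, u a)
    (h2 : ∑ a ∈ C, w a • v a = ∑ a ∈ C, u a • v a) : ∀ a ∈ C, w a = u a := by
  intro a ha
  rw [affineIndependent_iff] at h
  have := h Finset.univ (fun a => w a - u a)
    (by
      rw [Finset.sum_coe_sort C (fun a => w a - u a), Finset.sum_sub_distrib, h1, sub_self])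
    (by
      rw [Finset.sum_coe_sort C (fun a => (w a - u a) • v a)]
      simp only [sub_smul, Finset.sum_sub_distrib, h2, sub_self])
    ⟨a, ha⟩ (Finset.mem_univ _)
  simpa [sub_eq_zero] using this

lemma relInt_nonempty (v : ι → E) {C : Finset ι} (h : C.Nonempty) : (relInt v C).Nonempty := by
  refine ⟨_, fun _ => (C.card : ℝ)⁻¹, fun a _ => ?_, ?_, rfl⟩
  · have := h.card_pos
    positivity
  · rw [Finset.sum_const, nsmul_eq_mul, mul_inv_cancel₀]
    exact_mod_cast h.card_pos.ne'

/-- For simplices the topological relative interior becomes a condition on weights; this is what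
lets the disjointness axiom of a subdivision be handled by algebra. -/
lemma relInt_eq_intrinsicInterior [FiniteDimensional ℝ E] {v : ι → E} {C : Finset ι}
    (h : AffineIndependent ℝ fun a : C => v a) :
    relInt v C = intrinsicInterior ℝ (convexHull ℝ (v '' (C : Set ι))) := by
  classical
  set K := convexHull ℝ (v '' (C : Set ι)) with hK
  have hKc : Convex ℝ K := convex_convexHull ℝ _
  ext x
  constructor
  · intro hx
    have hxK : x ∈ K := relInt_subset_hull v C hx
    obtain ⟨w, hw, hw1, hwx⟩ := hx
    obtain ⟨z, hz⟩ := Set.Nonempty.intrinsicInterior hKc ⟨x, hxK⟩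
    have hzK : z ∈ K := intrinsicInterior_subset hz
    obtain ⟨u, hu, hu1, huz⟩ := (mem_hull_iff v C z).1 hzK
    -- All weights of `x` are positive, so the segment from `z` to `x` can be prolonged a little
    -- beyond `x` inside `K`.
    obtain ⟨δ, hδ, hδw⟩ : ∃ δ : ℝ, 0 < δ ∧ ∀ a ∈ C, 0 ≤ w a + δ * (w a - u a) := by
      have : ∀ᶠ δ : ℝ in nhdsWithin 0 (Set.Ioi 0), ∀ a ∈ C, 0 ≤ w a + δ * (w a - u a) := by
        rw [Filter.eventually_all_finset]
        intro a ha
        have hc : Continuous fun δ : ℝ => w a + δ * (w a - u a) := by fun_prop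
        have : ∀ᶠ δ : ℝ in nhds 0, 0 < w a + δ * (w a - u a) :=
          hc.continuousAt.eventually (lt_mem_nhds (by simpa using hw a ha))
        exact (this.filter_mono nhdsWithin_le_nhds).mono fun _ h => h.le
      obtain ⟨δ, h1, h2⟩ := (this.and self_mem_nhdsWithin).exists
      exact ⟨δ, h2, h1⟩
    set y := x + δ • (x - z) with hy
    have hyK : y ∈ K := by
      refine (mem_hull_iff v C y).2 ⟨_, hδw, ?_, ?_⟩
      · rw [Finset.sum_add_distrib, ← Finset.mul_sum, Finset.sum_sub_distrib, hw1, hu1]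
        ring
      · simp only [add_smul, mul_smul, sub_smul, Finset.sum_add_distrib, ← Finset.smul_sum,
          Finset.sum_sub_distrib, hwx, huz, hy]
    obtain ⟨z', hz', rfl⟩ := mem_intrinsicInterior.1 hz
    refine mem_intrinsicInterior.2 ⟨⟨x, subset_affineSpan ℝ _ hxK⟩, ?_, rfl⟩
    have hyS : y ∈ affineSpan ℝ K := subset_affineSpan ℝ _ hyK
    -- The homothety with centre `y` that takes `x` to `z`. It pulls a neighbourhood of `z` in `K`
    -- back to one of `x`, since `q` is a convex combination of `y` and `g q`.
    let g : affineSpan ℝ K → affineSpan ℝ K := fun q =>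
      ⟨AffineMap.lineMap y (q : E) ((1 + δ) / δ), AffineMap.lineMap_mem _ hyS q.2⟩
    have hg : Continuous g := by
      refine Continuous.subtype_mk ?_ _
      simp only [AffineMap.lineMap_apply_module]
      fun_prop
    have hgx : g ⟨x, subset_affineSpan ℝ _ hxK⟩ = z' := by
      apply Subtype.ext
      simp only [g, AffineMap.lineMap_apply_module, hy]
      match_scalars <;> field_simp <;> ring
    rw [mem_interior_iff_mem_nhds] at hz' ⊢
    have := hg.continuousAt.preimage_mem_nhds (x := ⟨x, subset_affineSpan ℝ _ hxK⟩)
      (t := ((↑) ⁻¹' K : Set (affineSpan ℝ K))) (by rw [hgx]; exact hz')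
    refine Filter.mem_of_superset this ?_
    intro q hq
    have hq' : (AffineMap.lineMap y (q : E) ((1 + δ) / δ) : E) ∈ K := hq
    have := hKc hyK hq' (a := 1 / (1 + δ)) (b := δ / (1 + δ)) (by positivity) (by positivity)
      (by field_simp)
    change (q : E) ∈ K
    convert this using 1
    simp only [AffineMap.lineMap_apply_module]
    match_scalars <;> field_simp <;> ring
  · intro hx
    have hxK : x ∈ K := intrinsicInterior_subset hx
    obtain ⟨w, hw, hw1, hwx⟩ := (mem_hull_iff v C x).1 hxK
    refine ⟨w, fun a ha => lt_of_le_of_ne (hw a ha) fun h0 => ?_, hw1, hwx⟩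
    obtain ⟨x', hx', rfl⟩ := mem_intrinsicInterior.1 hx
    have haS : v a ∈ affineSpan ℝ K :=
      subset_affineSpan ℝ _ (subset_convexHull ℝ _ ⟨a, ha, rfl⟩)
    -- If the weight at `a` vanishes, a small move away from `v a` stays in the affine span but
    -- makes that weight negative.
    let g : ℝ → affineSpan ℝ K := fun ε =>
      ⟨AffineMap.lineMap (x' : E) (v a) (-ε), AffineMap.lineMap_mem _ x'.2 haS⟩
    have hg : Continuous g := by
      refine Continuous.subtype_mk ?_ _
      simp only [AffineMap.lineMap_apply_module]
      fun_prop
    have hg0 : g 0 = x' := Subtype.ext (by simp [g])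
    rw [mem_interior_iff_mem_nhds] at hx'
    have := hg.continuousAt.preimage_mem_nhds (x := 0)
      (t := ((↑) ⁻¹' K : Set (affineSpan ℝ K))) (by rw [hg0]; exact hx')
    have h3 : ∀ᶠ ε in nhds (0 : ℝ), (AffineMap.lineMap (x' : E) (v a) (-ε) : E) ∈ K := this
    obtain ⟨ε, hε, hε0⟩ :=
      ((h3.filter_mono nhdsWithin_le_nhds).and
        (self_mem_nhdsWithin : Set.Ioi (0 : ℝ) ∈ nhdsWithin 0 (Set.Ioi 0))).exists
    obtain ⟨u, hu, hu1, hux⟩ := (mem_hull_iff v C _).1 hε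
    have := weights_unique h (w := u) (u := fun b => (1 + ε) * w b - ε * if b = a then 1 else 0)
      (by
        rw [Finset.sum_sub_distrib, ← Finset.mul_sum, ← Finset.mul_sum, hw1, hu1]
        simp [ha])
      (by
        rw [hux, AffineMap.lineMap_apply_module]
        simp only [sub_smul, mul_smul, Finset.sum_sub_distrib, ← Finset.smul_sum, hwx]
        simp [ha]
        module) a ha
    have h4 := hu a ha
    rw [this, ← h0] at h4
    simp at h4
    exact absurd hε0 (not_lt.2 h4)

/-- Inside one simplex `t` barycentric coordinates are unique, and the labels with positive weight
can be read off from the point. -/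
lemma relInt_inter_subset {v : ι → E} {t C D : Finset ι}
    (h : AffineIndependent ℝ fun a : t => v a) (hC : C ⊆ t) (hD : D ⊆ t) {x : E}
    (hxC : x ∈ relInt v C) (hxD : x ∈ convexHull ℝ (v '' (D : Set ι))) : C ⊆ D := by
  classical
  obtain ⟨w, hw, hw1, hwx⟩ := hxC
  obtain ⟨u, hu, hu1, hux⟩ := (mem_hull_iff v D x).1 hxD
  have e1 : ∀ (F : Finset ι) (w : ι → ℝ), F ⊆ t →
      ∑ a ∈ t, (if a ∈ F then w a else 0) = ∑ a ∈ F, w a := by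
    intro F w hF
    rw [← Finset.sum_filter, Finset.filter_mem_eq_inter, Finset.inter_eq_right.2 hF]
  have e2 : ∀ (F : Finset ι) (w : ι → ℝ), F ⊆ t →
      ∑ a ∈ t, (if a ∈ F then w a else 0) • v a = ∑ a ∈ F, w a • v a := by
    intro F w hF
    simp only [ite_smul, zero_smul]
    rw [← Finset.sum_filter, Finset.filter_mem_eq_inter, Finset.inter_eq_right.2 hF]
  have key := weights_unique h (w := fun a => if a ∈ C then w a else 0)
    (u := fun a => if a ∈ D then u a else 0)
    (by rw [e1 C w hC, e1 D u hD, hw1, hu1]) (by rw [e2 C w hC, e2 D u hD, hwx, hux])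
  intro a ha
  by_contra hn
  have := key a (hC ha)
  simp only [ha, hn, if_true, if_false] at this
  exact (hw a ha).ne' this

lemma exists_relInt_of_mem_hull {v : ι → E} {C : Finset ι} {x : E}
    (hx : x ∈ convexHull ℝ (v '' (C : Set ι))) :
    ∃ D ⊆ C, D.Nonempty ∧ x ∈ relInt v D := by
  classical
  obtain ⟨w, hw, hw1, hwx⟩ := (mem_hull_iff v C x).1 hx
  have hs : ∑ a ∈ C.filter (fun a => 0 < w a), w a = 1 := by
    rw [← hw1, Finset.sum_filter]
    refine Finset.sum_congr rfl fun a ha => ?_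
    split_ifs with h
    · rfl
    · exact le_antisymm (hw a ha) (not_lt.1 h)
  refine ⟨C.filter (fun a => 0 < w a), Finset.filter_subset _ _, ?_, w, ?_, hs, ?_⟩
  · by_contra hne
    rw [Finset.not_nonempty_iff_eq_empty] at hne
    rw [hne] at hs
    simp at hs
  · intro a ha
    exact (Finset.mem_filter.1 ha).2
  · rw [← hwx, Finset.sum_filter]
    refine Finset.sum_congr rfl fun a ha => ?_
    split_ifs with h
    · rfl
    · rw [le_antisymm (not_lt.1 h) (hw a ha), zero_smul]

lemma isClosed_hull (v : ι → E) (C : Finset ι) : IsClosed (convexHull ℝ (v '' (C : Set ι))) :=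
  (C.finite_toSet.image v).isClosed_convexHull ℝ

lemma hull_mono (v : ι → E) {C D : Finset ι} (h : C ⊆ D) :
    convexHull ℝ (v '' (C : Set ι)) ⊆ convexHull ℝ (v '' (D : Set ι)) :=
  convexHull_mono (Set.image_mono (by exact_mod_cast h))

end ConvexCombinations

/-! ### The orientation determinant and generic points -/

lemma cross_self_left (a c : ℰ) : cross a a c = 0 := by simp [cross]

lemma cross_self_right (a b : ℰ) : cross a b b = 0 := by unfold cross; ring

lemma cross_self_outer (a b : ℰ) : cross a b a = 0 := by simp [cross]

lemma cross_swap (a b c : ℰ) : cross b a c = -cross a b c := by unfold cross; ring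

lemma cross_swap_right (a b c : ℰ) : cross a c b = -cross a b c := by unfold cross; ring

lemma cross_rotate (a b c : ℰ) : cross b c a = cross a b c := by unfold cross; ring

lemma cross_sum {ι : Type*} (a b : ℰ) (s : Finset ι) (w : ι → ℝ) (v : ι → ℰ)
    (h : ∑ i ∈ s, w i = 1) : cross a b (∑ i ∈ s, w i • v i) = ∑ i ∈ s, w i * cross a b (v i) := by
  have e0 : (∑ i ∈ s, w i • v i) 0 = ∑ i ∈ s, w i * v i 0 := by simp
  have e1 : (∑ i ∈ s, w i • v i) 1 = ∑ i ∈ s, w i * v i 1 := by simp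
  unfold cross
  rw [e0, e1]
  have : ∀ i ∈ s, w i * ((b 0 - a 0) * (v i 1 - a 1) - (b 1 - a 1) * (v i 0 - a 0)) =
      (b 0 - a 0) * (w i * v i 1) - (b 1 - a 1) * (w i * v i 0) -
        w i * ((b 0 - a 0) * a 1 - (b 1 - a 1) * a 0) := fun i _ => by ring
  rw [Finset.sum_congr rfl this, Finset.sum_sub_distrib, Finset.sum_sub_distrib, ← Finset.mul_sum,
    ← Finset.mul_sum, ← Finset.sum_mul, h]
  ring

lemma cross_combo (a b x y : ℰ) (r : ℝ) :
    cross a b (x + r • (y - x)) = (1 - r) * cross a b x + r * cross a b y := by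
  simp [cross]; ring

@[fun_prop]
lemma continuous_cross {X : Type*} [TopologicalSpace X] {f g h : X → ℰ} (hf : Continuous f)
    (hg : Continuous g) (hh : Continuous h) : Continuous fun x => cross (f x) (g x) (h x) := by
  unfold cross
  fun_prop

lemma ne_of_cross_ne {a b c : ℰ} (h : cross a b c ≠ 0) : a ≠ b ∧ b ≠ c ∧ a ≠ c := by
  refine ⟨?_, ?_, ?_⟩ <;> rintro rfl <;> apply h
  · exact cross_self_left _ _
  · exact cross_self_right _ _
  · exact cross_self_outer _ _

/-- A line has dense complement. -/
lemma dense_cross_ne {a b : ℰ} (h : a ≠ b) : Dense {y : ℰ | cross a b y ≠ 0} := by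
  rw [dense_iff_inter_open]
  intro U hU ⟨x, hx⟩
  by_cases h0 : cross a b x = 0
  -- A normal vector of the line; moving along it changes `cross a b` at a rate equal to the squared
  -- length of `b - a`.
  · let d : ℰ := !₂[-(b 1 - a 1), b 0 - a 0]
    have hc : Continuous fun ε : ℝ => x + ε • d := by fun_prop
    have h1 : ∀ᶠ ε in nhds (0 : ℝ), x + ε • d ∈ U :=
      hc.continuousAt.eventually (hU.mem_nhds (by simpa using hx))
    obtain ⟨ε, hε, hε0⟩ := ((h1.filter_mono nhdsWithin_le_nhds).and
        (self_mem_nhdsWithin : Set.Ioi (0 : ℝ) ∈ nhdsWithin 0 (Set.Ioi 0))).exists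
    refine ⟨_, hε, ?_⟩
    have e : cross a b (x + ε • d) = cross a b x + ε * ((b 0 - a 0) ^ 2 + (b 1 - a 1) ^ 2) := by
      simp [cross, d]; ring
    change cross a b (x + ε • d) ≠ 0
    rw [e, h0, zero_add]
    have hε' : (0 : ℝ) < ε := hε0
    have : 0 < (b 0 - a 0) ^ 2 + (b 1 - a 1) ^ 2 := by
      by_contra hn
      apply h
      have h2 : b 0 - a 0 = 0 := by nlinarith [sq_nonneg (b 0 - a 0), sq_nonneg (b 1 - a 1)]
      have h3 : b 1 - a 1 = 0 := by nlinarith [sq_nonneg (b 0 - a 0), sq_nonneg (b 1 - a 1)]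
      ext i
      fin_cases i
      · simp; linarith
      · simp; linarith
    positivity
  · exact ⟨x, hx, h0⟩

/-- The complements of finitely many lines are open and dense, so they meet together in every
nonempty open set. -/
lemma exists_generic {κ : Type*} (s : Finset κ) (f g : κ → ℰ) (h : ∀ i ∈ s, f i ≠ g i) {U : Set ℰ}
    (hU : IsOpen U) (hne : U.Nonempty) : ∃ y ∈ U, ∀ i ∈ s, cross (f i) (g i) y ≠ 0 := by
  classical
  induction s using Finset.induction_on generalizing U with
  | empty => exact ⟨hne.some, hne.some_mem, by simp⟩
  | insert i s _ ih =>
    have ho : IsOpen {y : ℰ | cross (f i) (g i) y ≠ 0} :=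
      isOpen_ne_fun (by fun_prop) continuous_const
    obtain ⟨y, hy, hy'⟩ := ih (fun j hj => h j (Finset.mem_insert_of_mem hj)) (hU.inter ho)
      (dense_iff_inter_open.1 (dense_cross_ne (h i (Finset.mem_insert_self _ _))) U hU hne)
    refine ⟨y, hy.1, fun j hj => ?_⟩
    rcases Finset.mem_insert.1 hj with rfl | hj
    · exact hy.2
    · exact hy' j hj

/-! ### Signed crossings and boundary chains -/

/-- The signed crossing number of an edge with a ray. The arguments tell on which side of the edge
the source of the ray lies, and on which sides of the ray the two ends of the edge lie. -/
noncomputable def crossing (γ h₁ h₂ : ℝ) : ℤ :=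
  (if h₁ < 0 ∧ 0 < h₂ ∧ 0 < γ then 1 else 0) - (if 0 < h₁ ∧ h₂ < 0 ∧ γ < 0 then 1 else 0)

lemma crossing_neg_swap (γ h₁ h₂ : ℝ) : crossing (-γ) h₂ h₁ = -crossing γ h₁ h₂ := by
  unfold crossing
  have e1 : (h₂ < 0 ∧ 0 < h₁ ∧ 0 < -γ) ↔ (0 < h₁ ∧ h₂ < 0 ∧ γ < 0) := by
    constructor <;> rintro ⟨a, b, c⟩ <;> refine ⟨b, a, by linarith⟩
  have e2 : (0 < h₂ ∧ h₁ < 0 ∧ -γ < 0) ↔ (h₁ < 0 ∧ 0 < h₂ ∧ 0 < γ) := by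
    constructor <;> rintro ⟨a, b, c⟩ <;> refine ⟨b, a, by linarith⟩
  rw [if_congr e1 rfl rfl, if_congr e2 rfl rfl]
  ring

/-- Along a fixed line the crossing number with an edge can change only when the source passes to
the other side of the edge. -/
lemma crossing_congr {γ γ' : ℝ} (h : 0 < γ * γ') (h₁ h₂ : ℝ) :
    crossing γ h₁ h₂ = crossing γ' h₁ h₂ := by
  unfold crossing
  rcases pos_and_pos_or_neg_and_neg_of_mul_pos h with ⟨h3, h4⟩ | ⟨h3, h4⟩
  · simp [h3, h4, h3.not_gt, h4.not_gt]
  · simp [h3, h4, h3.not_gt, h4.not_gt]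

/-- Here `α`, `β`, `γ` are, up to scale, the barycentric coordinates of the source, and `p`, `q`,
`r` tell on which sides of the line of the ray the vertices lie; `hl` says that the line passes
through the source. A ray from inside leaves the triangle once. A ray from outside misses it or
enters and leaves, with opposite signs. The proof checks all sign patterns; `H1` and `H2` exclude
those in which the three products in `hl` have one common sign. -/
lemma sum_crossing {α β γ p q r : ℝ} (hα : α ≠ 0) (hβ : β ≠ 0) (hγ : γ ≠ 0) (hp : p ≠ 0)
    (hq : q ≠ 0) (hr : r ≠ 0) (hs : 0 < α + β + γ) (hl : α * p + β * q + γ * r = 0) :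
    crossing γ p q + crossing α q r + crossing β r p =
      if 0 < α ∧ 0 < β ∧ 0 < γ then 1 else 0 := by
  have H1 : ¬ ((0 < α ∧ 0 < p ∨ α < 0 ∧ p < 0) ∧ (0 < β ∧ 0 < q ∨ β < 0 ∧ q < 0) ∧
      (0 < γ ∧ 0 < r ∨ γ < 0 ∧ r < 0)) := by
    rw [← mul_pos_iff, ← mul_pos_iff, ← mul_pos_iff]
    rintro ⟨h1, h2, h3⟩
    linarith
  have H2 : ¬ ((0 < α ∧ p < 0 ∨ α < 0 ∧ 0 < p) ∧ (0 < β ∧ q < 0 ∨ β < 0 ∧ 0 < q) ∧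
      (0 < γ ∧ r < 0 ∨ γ < 0 ∧ 0 < r)) := by
    rw [← mul_neg_iff, ← mul_neg_iff, ← mul_neg_iff]
    rintro ⟨h1, h2, h3⟩
    linarith
  unfold crossing
  rcases lt_or_gt_of_ne hα with a | a <;> rcases lt_or_gt_of_ne hβ with b | b <;>
  rcases lt_or_gt_of_ne hγ with c | c <;> rcases lt_or_gt_of_ne hp with d | d <;>
  rcases lt_or_gt_of_ne hq with e | e <;> rcases lt_or_gt_of_ne hr with f | f <;>
  simp only [a, b, c, d, e, f, a.not_gt, b.not_gt, c.not_gt, d.not_gt, e.not_gt, f.not_gt,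
    if_true, if_false, and_true, and_false] <;> norm_num <;>
  solve
  | linarith
  | (apply H1; simp [a, b, c, d, e, f])
  | (apply H2; simp [a, b, c, d, e, f])

open Classical in
/-- The coefficient of the directed edge from `a` to `b` in the boundary of the triangle `t`. -/
noncomputable def edgeSign {ι : Type*} (v : ι → ℰ) (t : Finset ι) (a b : ι) : ℤ :=
  if a ∈ t ∧ b ∈ t then ∑ c ∈ t, ((SignType.sign (cross (v a) (v b) (v c)) : SignType) : ℤ) else 0

/-- The labels `a`, `b` span an edge of the convex hull, with all other labels strictly to the left
of it. -/
def IsHullEdge {ι : Type*} (v : ι → ℰ) (V : Finset ι) (a b : ι) : Prop :=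
  a ∈ V ∧ b ∈ V ∧ a ≠ b ∧ ∀ c ∈ V, c ≠ a → c ≠ b → 0 < cross (v a) (v b) (v c)

open Classical in
/-- The coefficient of the directed edge from `a` to `b` in the boundary of the convex hull. -/
noncomputable def hullSign {ι : Type*} (v : ι → ℰ) (V : Finset ι) (a b : ι) : ℤ :=
  (if IsHullEdge v V a b then 1 else 0) - (if IsHullEdge v V b a then 1 else 0)

/-- The labels in `t` are those of the vertices of a nondegenerate triangle. -/
def IsTriangle {ι : Type*} [DecidableEq ι] (v : ι → ℰ) (t : Finset ι) : Prop :=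
  ∃ a b c, t = {a, b, c} ∧ 0 < cross (v a) (v b) (v c)

/-- No line through two different labelled points contains `y`. -/
def Generic {ι : Type*} (v : ι → ℰ) (V : Finset ι) (y : ℰ) : Prop :=
  ∀ a ∈ V, ∀ b ∈ V, v a ≠ v b → cross (v a) (v b) y ≠ 0

section

lemma ne_of_cross_pos {ι : Type*} {v : ι → ℰ} {a b c : ι} (h : 0 < cross (v a) (v b) (v c)) : a ≠ b ∧ b ≠ c ∧ a ≠ c := by
  obtain ⟨h1, h2, h3⟩ := ne_of_cross_ne h.ne'
  exact ⟨fun h => h1 (by rw [h]), fun h => h2 (by rw [h]), fun h => h3 (by rw [h])⟩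

variable {ι : Type*} [DecidableEq ι] {v : ι → ℰ} {V t : Finset ι}

lemma sum_triple {M : Type*} [AddCommMonoid M] {a b c : ι} (h : a ≠ b ∧ b ≠ c ∧ a ≠ c)
    (f : ι → M) : ∑ x ∈ ({a, b, c} : Finset ι), f x = f a + (f b + f c) := by
  rw [Finset.sum_insert (by simp [h.1, h.2.2]), Finset.sum_pair h.2.1]

lemma IsTriangle.card (h : IsTriangle v t) : t.card = 3 := by
  obtain ⟨a, b, c, rfl, h⟩ := h
  obtain ⟨h1, h2, h3⟩ := ne_of_cross_pos h
  rw [Finset.card_eq_three]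
  exact ⟨a, b, c, h1, h3, h2, rfl⟩

/-- The three determinants on the right, divided by the determinant of the triangle, are the
barycentric coordinates of `y`. -/
lemma mem_relInt_triangle {a b c : ι} (h : 0 < cross (v a) (v b) (v c)) (y : ℰ) :
    y ∈ relInt v {a, b, c} ↔ 0 < cross (v b) (v c) y ∧ 0 < cross (v c) (v a) y ∧
      0 < cross (v a) (v b) y := by
  have hne := ne_of_cross_pos h
  constructor
  · rintro ⟨w, hw, hw1, rfl⟩
    rw [cross_sum _ _ _ _ _ hw1, cross_sum _ _ _ _ _ hw1, cross_sum _ _ _ _ _ hw1]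
    have ha := hw a (by simp)
    have hb := hw b (by simp)
    have hc := hw c (by simp)
    have h2 : 0 < cross (v b) (v c) (v a) := by rwa [cross_rotate]
    have h3 : 0 < cross (v c) (v a) (v b) := by rwa [cross_rotate]
    simp only [sum_triple hne, cross_self_outer, cross_self_right, mul_zero, zero_add, add_zero]
    refine ⟨by positivity, by positivity, by positivity⟩
  · rintro ⟨h1, h2, h3⟩
    set D := cross (v a) (v b) (v c) with hD
    have hsum : cross (v b) (v c) y + cross (v c) (v a) y + cross (v a) (v b) y = D := by
      simp only [hD, cross]; ring
    refine ⟨fun x => if x = a then cross (v b) (v c) y / D else if x = b then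
      cross (v c) (v a) y / D else cross (v a) (v b) y / D, ?_, ?_, ?_⟩
    · intro x _
      dsimp only
      split_ifs <;> positivity
    · rw [sum_triple hne]
      simp only [if_true, hne.1.symm, hne.2.1.symm, hne.2.2.symm, if_false]
      field_simp
      linarith
    · rw [sum_triple hne]
      simp only [if_true, hne.1.symm, hne.2.1.symm, hne.2.2.symm, if_false]
      have hD0 : D ≠ 0 := h.ne'
      ext i
      fin_cases i
      · simp
        field_simp
        simp only [hD, cross]; ring
      · simp
        field_simp
        simp only [hD, cross]; ring

lemma edgeSign_swap (v : ι → ℰ) (t : Finset ι) (a b : ι) : edgeSign v t b a = -edgeSign v t a b := by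
  unfold edgeSign
  by_cases h : a ∈ t ∧ b ∈ t
  · rw [if_pos h, if_pos h.symm, ← Finset.sum_neg_distrib]
    refine Finset.sum_congr rfl fun c _ => ?_
    rw [cross_swap, Left.sign_neg]
    simp
  · rw [if_neg h, if_neg (fun h' => h h'.symm), neg_zero]

lemma edgeSign_self (v : ι → ℰ) (t : Finset ι) (a : ι) : edgeSign v t a a = 0 := by
  have := edgeSign_swap v t a a
  lia

lemma edgeSign_triangle {a b c : ι} (h : 0 < cross (v a) (v b) (v c)) :
    edgeSign v {a, b, c} a b = 1 ∧ edgeSign v {a, b, c} b c = 1 ∧ edgeSign v {a, b, c} c a = 1 := by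
  have hne := ne_of_cross_pos h
  have h2 : 0 < cross (v b) (v c) (v a) := by rwa [cross_rotate]
  have h3 : 0 < cross (v c) (v a) (v b) := by rwa [cross_rotate]
  unfold edgeSign
  simp only [sum_triple hne, cross_self_outer, cross_self_right]
  simp [h, h2, h3]

lemma sum_edgeSign_mul (a b c : ι) (h : 0 < cross (v a) (v b) (v c)) (f : ι → ι → ℤ) :
    ∑ x ∈ ({a, b, c} : Finset ι), ∑ y ∈ ({a, b, c} : Finset ι), edgeSign v {a, b, c} x y * f x y =
      (f a b - f b a) + (f b c - f c b) + (f c a - f a c) := by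
  have hne := ne_of_cross_pos h
  obtain ⟨e1, e2, e3⟩ := edgeSign_triangle h
  simp only [sum_triple hne, edgeSign_self, edgeSign_swap v _ a b, edgeSign_swap v _ b c,
    edgeSign_swap v _ c a, e1, e2, e3]
  ring

-- The value is two rather than one because the sum runs over ordered pairs, and an edge and its
-- reverse contribute equally: both the sign and the crossing number change sign.
open Classical in
lemma sum_edgeSign_crossing (ht : IsTriangle v t) {x y y' : ℰ}
    (hx : ∀ a ∈ t, ∀ b ∈ t, v a ≠ v b → cross (v a) (v b) x ≠ 0)
    (hh : ∀ a ∈ t, cross y y' (v a) ≠ 0) (hl : cross y y' x = 0) :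
    ∑ a ∈ t, ∑ b ∈ t, edgeSign v t a b *
        crossing (cross (v a) (v b) x) (cross y y' (v a)) (cross y y' (v b)) =
      if x ∈ relInt v t then 2 else 0 := by
  obtain ⟨a, b, c, rfl, h⟩ := ht
  obtain ⟨n1, n2, n3⟩ := ne_of_cross_ne h.ne'
  rw [sum_edgeSign_mul a b c h, if_congr (mem_relInt_triangle h x) rfl rfl]
  have key := sum_crossing (α := cross (v b) (v c) x) (β := cross (v c) (v a) x)
    (γ := cross (v a) (v b) x) (p := cross y y' (v a)) (q := cross y y' (v b))
    (r := cross y y' (v c)) (hx b (by simp) c (by simp) n2) (hx c (by simp) a (by simp) n3.symm)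
    (hx a (by simp) b (by simp) n1) (hh a (by simp)) (hh b (by simp)) (hh c (by simp))
    (by
      have : cross (v b) (v c) x + cross (v c) (v a) x + cross (v a) (v b) x =
        cross (v a) (v b) (v c) := by simp only [cross]; ring
      rw [this]; exact h)
    (by
      have : cross (v b) (v c) x * cross y y' (v a) + cross (v c) (v a) x * cross y y' (v b) +
        cross (v a) (v b) x * cross y y' (v c) = cross (v a) (v b) (v c) * cross y y' x := by
        simp only [cross]; ring
      rw [this, hl, mul_zero])
  have sw : ∀ a b : ι, crossing (cross (v b) (v a) x) (cross y y' (v b)) (cross y y' (v a)) =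
      -crossing (cross (v a) (v b) x) (cross y y' (v a)) (cross y y' (v b)) := by
    intro a b
    rw [cross_swap, crossing_neg_swap]
  rw [sw a b, sw b c, sw c a]
  split_ifs at key ⊢ <;> lia

open Classical in
/-- Ray casting: the number of triangles that contain `x` is determined by their boundary chain. -/
lemma two_mul_card_filter_relInt {X : Finset (Finset ι)} (hX : ∀ t ∈ X, IsTriangle v t)
    (hV : ∀ t ∈ X, t ⊆ V) {x y y' : ℰ} (hx : Generic v V x)
    (hh : ∀ a ∈ V, cross y y' (v a) ≠ 0) (hl : cross y y' x = 0) :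
    (2 * (X.filter fun t => x ∈ relInt v t).card : ℤ) =
      ∑ a ∈ V, ∑ b ∈ V, (∑ t ∈ X, edgeSign v t a b) *
        crossing (cross (v a) (v b) x) (cross y y' (v a)) (cross y y' (v b)) := by
  have h1 : ∀ t ∈ X, ∑ a ∈ V, ∑ b ∈ V, edgeSign v t a b *
        crossing (cross (v a) (v b) x) (cross y y' (v a)) (cross y y' (v b)) =
      if x ∈ relInt v t then 2 else 0 := by
    intro t ht
    rw [← sum_edgeSign_crossing (hX t ht)
      (fun a ha b hb => hx a (hV t ht ha) b (hV t ht hb)) (fun a ha => hh a (hV t ht ha)) hl]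
    symm
    refine Finset.sum_subset_zero_on_sdiff (hV t ht) ?_ ?_
    · intro a ha
      refine Finset.sum_eq_zero fun b _ => ?_
      rw [edgeSign, if_neg (fun h => (Finset.mem_sdiff.1 ha).2 h.1), zero_mul]
    · intro a _
      refine Finset.sum_subset_zero_on_sdiff (hV t ht) ?_ fun _ _ => rfl
      intro b hb
      rw [edgeSign, if_neg (fun h => (Finset.mem_sdiff.1 hb).2 h.2), zero_mul]
  rw [Finset.card_filter, Nat.cast_sum, Finset.mul_sum]
  have h2 : ∀ t ∈ X, (2 * ((if x ∈ relInt v t then 1 else 0 : ℕ) : ℤ)) =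
      ∑ a ∈ V, ∑ b ∈ V, edgeSign v t a b *
        crossing (cross (v a) (v b) x) (cross y y' (v a)) (cross y y' (v b)) := by
    intro t ht
    rw [h1 t ht]
    split_ifs <;> simp
  rw [Finset.sum_congr rfl h2, Finset.sum_comm]
  refine Finset.sum_congr rfl fun a _ => ?_
  rw [Finset.sum_comm]
  refine Finset.sum_congr rfl fun b _ => ?_
  rw [Finset.sum_mul]

end

/-! ### From boundary chains to triangulations -/

/-- `S` is the set of (labelled, nonempty) cells of a triangulation of the convex hull of the
points labelled by `V`. -/
structure IsTriComplex {ι : Type*} (v : ι → ℰ) (V : Finset ι) (S : Finset (Finset ι)) : Prop where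
  subset : ∀ C ∈ S, C ⊆ V
  nonempty : ∀ C ∈ S, C.Nonempty
  indep : ∀ C ∈ S, AffineIndependent ℝ fun a : C => v a
  down : ∀ C ∈ S, ∀ D ⊆ C, D.Nonempty → D ∈ S
  covers : ⋃ C ∈ S, convexHull ℝ (v '' (C : Set ι)) = convexHull ℝ (v '' (V : Set ι))
  disjoint : ∀ C ∈ S, ∀ D ∈ S, C ≠ D → Disjoint (relInt v C) (relInt v D)

section

variable {ι : Type*} [DecidableEq ι] {v : ι → ℰ} {V t : Finset ι}

/-- All nonempty faces of the simplices in `X`. -/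
def faces (X : Finset (Finset ι)) : Finset (Finset ι) :=
  X.biUnion fun t => t.powerset.filter fun C => C.Nonempty

lemma mem_faces {X : Finset (Finset ι)} {C : Finset ι} :
    C ∈ faces X ↔ C.Nonempty ∧ ∃ t ∈ X, C ⊆ t := by
  simp only [faces, Finset.mem_biUnion, Finset.mem_filter, Finset.mem_powerset]
  tauto

lemma IsTriangle.affineIndependent (h : IsTriangle v t) :
    AffineIndependent ℝ fun a : t => v a := by
  classical
  obtain ⟨a, b, c, ht, h⟩ := h
  have hne := ne_of_cross_pos h
  rw [affineIndependent_iff]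
  intro s w hw hwv e he
  let u : ι → ℝ := fun i => if h : i ∈ t then (if (⟨i, h⟩ : t) ∈ s then w ⟨i, h⟩ else 0) else 0
  have hu : ∀ e : t, u e = if e ∈ s then w e else 0 := fun e => by simp [u]
  have h1 : ∑ i ∈ t, u i = 0 := by
    rw [← Finset.sum_coe_sort t u, ← hw]
    simp only [hu, Finset.sum_ite_mem, Finset.univ_inter]
  have h2 : ∑ i ∈ t, u i • v i = 0 := by
    rw [← Finset.sum_coe_sort t fun i => u i • v i, ← hwv]
    simp only [hu, ite_smul, zero_smul, Finset.sum_ite_mem, Finset.univ_inter]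
  rw [ht, sum_triple hne] at h1 h2
  have h20 : u a * v a 0 + (u b * v b 0 + u c * v c 0) = 0 := by
    simpa using congrArg (fun z : ℰ => z 0) h2
  have h21 : u a * v a 1 + (u b * v b 1 + u c * v c 1) = 0 := by
    simpa using congrArg (fun z : ℰ => z 1) h2
  have k1 : u c * cross (v a) (v b) (v c) = 0 := by
    have : u a = -u b - u c := by linarith
    rw [this] at h20 h21
    unfold cross
    linear_combination (v b 0 - v a 0) * h21 - (v b 1 - v a 1) * h20
  have k2 : u b * cross (v a) (v b) (v c) = 0 := by
    have : u a = -u b - u c := by linarith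
    rw [this] at h20 h21
    unfold cross
    linear_combination (v c 1 - v a 1) * h20 - (v c 0 - v a 0) * h21
  have hc : u c = 0 := (mul_eq_zero.1 k1).resolve_right h.ne'
  have hb : u b = 0 := (mul_eq_zero.1 k2).resolve_right h.ne'
  have ha : u a = 0 := by linarith
  have hez : u e = 0 := by
    have := e.2
    simp only [ht, Finset.mem_insert, Finset.mem_singleton] at this
    rcases this with h | h | h <;> rw [h] <;> assumption
  rw [hu, if_pos he] at hez
  exact hez

omit [DecidableEq ι] in
lemma AffineIndependent.of_subset {C D : Finset ι} (h : AffineIndependent ℝ fun a : C => v a)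
    (hD : D ⊆ C) : AffineIndependent ℝ fun a : D => v a :=
  h.comp_embedding ⟨fun a : D => (⟨a, hD a.2⟩ : C), fun a b h => Subtype.ext (by simpa using h)⟩

lemma isOpen_relInt (h : IsTriangle v t) : IsOpen (relInt v t) := by
  obtain ⟨a, b, c, rfl, h⟩ := h
  have : relInt v {a, b, c} = {y | 0 < cross (v b) (v c) y} ∩
      ({y | 0 < cross (v c) (v a) y} ∩ {y | 0 < cross (v a) (v b) y}) := by
    ext y
    exact mem_relInt_triangle h y
  rw [this]
  refine (isOpen_lt continuous_const (by fun_prop)).inter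
    ((isOpen_lt continuous_const (by fun_prop)).inter (isOpen_lt continuous_const (by fun_prop)))

lemma IsTriangle.nonempty (h : IsTriangle v t) : t.Nonempty := by
  rw [← Finset.card_pos, h.card]
  norm_num

omit [DecidableEq ι] in
/-- Every point of a simplex is a limit of relatively interior points. -/
lemma relInt_inter_nonempty {C : Finset ι} (hC : C.Nonempty) {x : ℰ}
    (hx : x ∈ convexHull ℝ (v '' (C : Set ι))) {U : Set ℰ} (hU : IsOpen U) (hxU : x ∈ U) :
    (U ∩ relInt v C).Nonempty := by
  obtain ⟨w, hw, hw1, hwx⟩ := (mem_hull_iff v C x).1 hx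
  obtain ⟨g, u, hu, hu1, hug⟩ := relInt_nonempty v hC
  have hc : Continuous fun ε : ℝ => x + ε • (g - x) := by fun_prop
  have h1 : ∀ᶠ ε in nhds (0 : ℝ), x + ε • (g - x) ∈ U :=
    hc.continuousAt.eventually (hU.mem_nhds (by simpa using hxU))
  obtain ⟨ε, hε, hε0⟩ := ((h1.filter_mono nhdsWithin_le_nhds).and
      (Ioo_mem_nhdsGT (zero_lt_one' ℝ))).exists
  refine ⟨_, hε, fun a => (1 - ε) * w a + ε * u a, fun a ha => ?_, ?_, ?_⟩
  · have := mul_pos hε0.1 (hu a ha)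
    have := mul_nonneg (sub_nonneg.2 hε0.2.le) (hw a ha)
    linarith
  · rw [Finset.sum_add_distrib, ← Finset.mul_sum, ← Finset.mul_sum, hw1, hu1]
    ring
  · simp only [add_smul, mul_smul, Finset.sum_add_distrib, ← Finset.smul_sum, hwx, hug]
    module

omit [DecidableEq ι] in
lemma Generic.ne {y : ℰ} (h : Generic v V y) (hV : ∃ a ∈ V, ∃ b ∈ V, v a ≠ v b) {a : ι}
    (ha : a ∈ V) : y ≠ v a := by
  rintro rfl
  obtain ⟨b, hb, hne⟩ : ∃ b ∈ V, v a ≠ v b := by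
    obtain ⟨b, hb, c, hc, hbc⟩ := hV
    by_cases hab : v a = v b
    · exact ⟨c, hc, by rwa [hab]⟩
    · exact ⟨b, hb, hab⟩
  exact h a ha b hb hne (cross_self_outer _ _)

-- The line through `y` and `y'` has to miss all labelled points. This only asks `y'` to avoid the
-- finitely many lines through `y` and a labelled point.
omit [DecidableEq ι] in
lemma exists_generic_pair (v : ι → ℰ) (V : Finset ι) {U : Set ℰ} (hU : IsOpen U) (hne : U.Nonempty)
    {y : ℰ} (hy : ∀ a ∈ V, y ≠ v a) :
    ∃ y' ∈ U, Generic v V y' ∧ ∀ a ∈ V, cross y y' (v a) ≠ 0 := by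
  classical
  obtain ⟨y', hy', h⟩ := exists_generic
    (((V ×ˢ V).image fun q => (v q.1, v q.2)).filter (fun q => q.1 ≠ q.2) ∪
      V.image fun a => (y, v a)) Prod.fst Prod.snd (by
        intro q hq
        rcases Finset.mem_union.1 hq with hq | hq
        · exact (Finset.mem_filter.1 hq).2
        · obtain ⟨a, ha, rfl⟩ := Finset.mem_image.1 hq
          exact hy a ha) hU hne
  refine ⟨y', hy', fun a ha b hb hab => ?_, fun a ha h0 => ?_⟩
  · exact h (v a, v b) (Finset.mem_union_left _ (Finset.mem_filter.2
      ⟨Finset.mem_image.2 ⟨(a, b), by simp [ha, hb], rfl⟩, hab⟩))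
  · refine h (y, v a) (Finset.mem_union_right _ (Finset.mem_image_of_mem _ ha)) ?_
    rw [cross_swap_right, h0, neg_zero]

omit [DecidableEq ι] in
lemma exists_generic_mem (v : ι → ℰ) (V : Finset ι) {U : Set ℰ} (hU : IsOpen U)
    (hne : U.Nonempty) : ∃ y ∈ U, Generic v V y := by
  classical
  obtain ⟨y, hy, h⟩ := exists_generic
    (((V ×ˢ V).image fun q => (v q.1, v q.2)).filter (fun q => q.1 ≠ q.2)) Prod.fst Prod.snd
      (fun q hq => (Finset.mem_filter.1 hq).2) hU hne
  exact ⟨y, hy, fun a ha b hb hab => h (v a, v b) (Finset.mem_filter.2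
      ⟨Finset.mem_image.2 ⟨(a, b), by simp [ha, hb], rfl⟩, hab⟩)⟩

omit [DecidableEq ι] in
lemma IsHullEdge.nonneg {a b : ι} (h : IsHullEdge v V a b) {x : ℰ}
    (hx : x ∈ convexHull ℝ (v '' (V : Set ι))) : 0 ≤ cross (v a) (v b) x := by
  obtain ⟨w, hw, hw1, rfl⟩ := (mem_hull_iff v V x).1 hx
  rw [cross_sum _ _ _ _ _ hw1]
  refine Finset.sum_nonneg fun c hc => mul_nonneg (hw c hc) ?_
  by_cases hca : c = a
  · rw [hca, cross_self_outer]
  by_cases hcb : c = b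
  · rw [hcb, cross_self_right]
  exact (h.2.2.2 c hc hca hcb).le

omit [DecidableEq ι] in
lemma IsHullEdge.ne (hb : ∀ a b : ι, ∃ c ∈ V, c ≠ a ∧ c ≠ b) {a b : ι} (h : IsHullEdge v V a b) :
    v a ≠ v b := by
  obtain ⟨c, hc, h1, h2⟩ := hb a b
  exact (ne_of_cross_ne (h.2.2.2 c hc h1 h2).ne').1

omit [DecidableEq ι] in
lemma IsHullEdge.pos (hb : ∀ a b : ι, ∃ c ∈ V, c ≠ a ∧ c ≠ b) {a b : ι} (h : IsHullEdge v V a b)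
    {x : ℰ} (hx : x ∈ convexHull ℝ (v '' (V : Set ι))) (hg : Generic v V x) :
    0 < cross (v a) (v b) x :=
  lt_of_le_of_ne (h.nonneg hx) (hg a h.1 b h.2.1 (h.ne hb)).symm

omit [DecidableEq ι] in
lemma IsHullEdge.not_swap (hb : ∀ a b : ι, ∃ c ∈ V, c ≠ a ∧ c ≠ b) {a b : ι}
    (h : IsHullEdge v V a b) : ¬ IsHullEdge v V b a := by
  intro h'
  obtain ⟨c, hc, h1, h2⟩ := hb a b
  have := h.2.2.2 c hc h1 h2
  have h3 := h'.2.2.2 c hc h2 h1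
  rw [cross_swap] at h3
  linarith

open Classical in
/-- A generic point of the convex hull lies in exactly one triangle if the boundary chain of the
triangles is the boundary of the hull. -/
lemma card_filter_relInt_eq_one {X : Finset (Finset ι)} (hX : ∀ t ∈ X, IsTriangle v t)
    (hV : ∀ t ∈ X, t ⊆ V) (hchain : ∀ a b, ∑ t ∈ X, edgeSign v t a b = hullSign v V a b)
    (hb : ∀ a b : ι, ∃ c ∈ V, c ≠ a ∧ c ≠ b) (he : ∃ a b, IsHullEdge v V a b)
    {y : ℰ} (hy : y ∈ convexHull ℝ (v '' (V : Set ι))) (hg : Generic v V y) :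
    (X.filter fun t => y ∈ relInt v t).card = 1 := by
  obtain ⟨a, b, hab⟩ := he
  have hpos := hab.pos hb hy hg
  have hVne : ∃ a ∈ V, ∃ b ∈ V, v a ≠ v b := ⟨a, hab.1, b, hab.2.1, hab.ne hb⟩
  -- The ray from `y` through the midpoint of the hull edge `a b`, prolonged by `δ` beyond that
  -- midpoint. A nearby generic `y'` is outside the hull, and the way to it crosses no hull edge but
  -- `a b`.
  let z : ℝ → ℰ := fun δ => midpoint ℝ (v a) (v b) + δ • (midpoint ℝ (v a) (v b) - y)
  have hz : Continuous z := by fun_prop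
  let P : Finset (ι × ι) := (V ×ˢ V).filter fun q => IsHullEdge v V q.1 q.2 ∧ q ≠ (a, b)
  let U : Set ℰ := {y' | cross (v a) (v b) y' < 0} ∩ ({y' | cross y y' (v a) < 0} ∩
    ({y' | 0 < cross y y' (v b)} ∩ ⋂ q ∈ P, {y' | 0 < cross (v q.1) (v q.2) y'}))
  have hU : IsOpen U := by
    refine (isOpen_lt (by fun_prop) continuous_const).inter
      ((isOpen_lt (by fun_prop) continuous_const).inter
      ((isOpen_lt continuous_const (by fun_prop)).inter ?_))
    exact isOpen_biInter_finset fun q _ => isOpen_lt continuous_const (by fun_prop)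
  have hne : U.Nonempty := by
    -- The midpoint of `a b` lies strictly inside every other hull edge, because such an edge misses
    -- `a` or `b`; this persists for small `δ`.
    have h1 : ∀ᶠ δ in nhds (0 : ℝ), ∀ q ∈ P, 0 < cross (v q.1) (v q.2) (z δ) := by
      rw [Filter.eventually_all_finset]
      rintro ⟨a', b'⟩ hq
      have hq' := (Finset.mem_filter.1 hq).2
      have hc : Continuous fun δ => cross (v a') (v b') (z δ) := by fun_prop
      refine hc.continuousAt.eventually (lt_mem_nhds ?_)
      have e : cross (v a') (v b') (z 0) =
          (cross (v a') (v b') (v a) + cross (v a') (v b') (v b)) / 2 := by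
        simp [z, cross, midpoint_eq_smul_add]
        ring
      change 0 < cross (v a') (v b') (z 0)
      rw [e]
      have hE : IsHullEdge v V a' b' := hq'.1
      have hn : ∀ c ∈ V, 0 ≤ cross (v a') (v b') (v c) := fun c hc =>
        hE.nonneg (subset_convexHull ℝ _ ⟨c, hc, rfl⟩)
      by_cases ha : a ≠ a' ∧ a ≠ b'
      · have := hE.2.2.2 a hab.1 ha.1 ha.2
        have := hn b hab.2.1
        linarith
      · by_cases hb' : b ≠ a' ∧ b ≠ b'
        · have := hE.2.2.2 b hab.2.1 hb'.1 hb'.2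
          have := hn a hab.1
          linarith
        · exfalso
          have hne := hab.2.2.1
          have hne' := hE.2.2.1
          have h3 : a = b' ∧ b = a' := by
            have := hq'.2
            rw [ne_eq, Prod.mk.injEq] at this
            grind
          rw [← h3.1, ← h3.2] at hE
          exact hab.not_swap hb hE
    obtain ⟨δ, hδ, hδ0⟩ := ((h1.filter_mono nhdsWithin_le_nhds).and
      (self_mem_nhdsWithin : Set.Ioi (0 : ℝ) ∈ nhdsWithin 0 (Set.Ioi 0))).exists
    have hδ0' : 0 < δ := hδ0
    have e1 : cross (v a) (v b) (z δ) = -(δ * cross (v a) (v b) y) := by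
      simp [z, cross, midpoint_eq_smul_add]
      ring
    have e2 : cross y (z δ) (v a) = -((1 + δ) / 2 * cross (v a) (v b) y) := by
      simp [z, cross, midpoint_eq_smul_add]
      ring
    have e3 : cross y (z δ) (v b) = (1 + δ) / 2 * cross (v a) (v b) y := by
      simp [z, cross, midpoint_eq_smul_add]
      ring
    refine ⟨z δ, ?_, ?_, ?_, ?_⟩
    · change cross (v a) (v b) (z δ) < 0
      rw [e1, neg_lt_zero]; positivity
    · change cross y (z δ) (v a) < 0
      rw [e2, neg_lt_zero]; positivity
    · change 0 < cross y (z δ) (v b)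
      rw [e3]; positivity
    · simp only [Set.mem_iInter]
      exact hδ
  obtain ⟨y', hyU, hg', hh⟩ := exists_generic_pair v V hU hne (fun a ha => hg.ne hVne ha)
  obtain ⟨u1, u2, u3, u4⟩ := hyU
  simp only [Set.mem_iInter] at u4
  have u1' : cross (v a) (v b) y' < 0 := u1
  have u2' : cross y y' (v a) < 0 := u2
  have u3' : 0 < cross y y' (v b) := u3
  have k1 := two_mul_card_filter_relInt hX hV hg hh (cross_self_outer y y')
  have k2 := two_mul_card_filter_relInt hX hV hg' hh (cross_self_right y y')
  have k3 : X.filter (fun t => y' ∈ relInt v t) = ∅ := by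
    rw [Finset.filter_eq_empty_iff]
    intro t ht hyt
    have := hab.nonneg (hull_mono v (hV t ht) (relInt_subset_hull v t hyt))
    linarith
  rw [k3, Finset.card_empty] at k2
  -- No triangle contains `y'`, so the count at `y` is the difference of the two ray sums. In it
  -- only hull edges matter, and among these only `a b` and its reverse separate `y` from `y'`.
  set J : ι → ι → ℤ := fun a b =>
    crossing (cross (v a) (v b) y) (cross y y' (v a)) (cross y y' (v b)) -
      crossing (cross (v a) (v b) y') (cross y y' (v a)) (cross y y' (v b)) with hJ
  have hJs : ∀ a b, J b a = -J a b := by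
    intro a b
    simp only [hJ]
    rw [cross_swap (v a), cross_swap (v a), crossing_neg_swap, crossing_neg_swap]
    ring
  have hJab : J a b = 1 := by
    simp [hJ, crossing, hpos, u1', u2', u3', u2'.not_gt, u1'.not_gt]
  have hJba : J b a = -1 := by rw [hJs, hJab]
  have hJ0 : ∀ a' b', IsHullEdge v V a' b' → (a', b') ≠ (a, b) → J a' b' = 0 := by
    intro a' b' h1 h2
    have h3 : 0 < cross (v a') (v b') y' := u4 (a', b') (Finset.mem_filter.2
      ⟨by simp [h1.1, h1.2.1], h1, h2⟩)
    simp only [hJ]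
    rw [crossing_congr (mul_pos (h1.pos hb hy hg) h3), sub_self]
  have hterm : ∀ a' b', hullSign v V a' b' * J a' b' =
      (if a' = a ∧ b' = b then 1 else 0) + (if a' = b ∧ b' = a then 1 else 0) := by
    intro a' b'
    have hn := hab.not_swap hb
    have hne := hab.2.2.1
    by_cases h1 : a' = a ∧ b' = b
    · obtain ⟨rfl, rfl⟩ := h1
      simp [hullSign, hab, hn, hJab, hne]
    · by_cases h2 : a' = b ∧ b' = a
      · obtain ⟨rfl, rfl⟩ := h2
        simp [hullSign, hab, hn, hJba, hne.symm]
      · rw [if_neg h1, if_neg h2]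
        by_cases h3 : IsHullEdge v V a' b'
        · rw [hJ0 a' b' h3 (by simpa using h1), mul_zero, add_zero]
        · by_cases h4 : IsHullEdge v V b' a'
          · rw [← neg_neg (J a' b'), ← hJs, hJ0 b' a' h4 (by
              rw [ne_eq, Prod.mk.injEq]; tauto)]
            simp
          · simp [hullSign, h3, h4]
  have k5 : (2 * (X.filter fun t => y ∈ relInt v t).card : ℤ) =
      ∑ a' ∈ V, ∑ b' ∈ V, hullSign v V a' b' * J a' b' := by
    have : (2 * (X.filter fun t => y ∈ relInt v t).card : ℤ) =
      2 * (X.filter fun t => y ∈ relInt v t).card - 2 * ((0 : ℕ) : ℤ) := by simp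
    rw [this, k1, k2, ← Finset.sum_sub_distrib]
    refine Finset.sum_congr rfl fun a' _ => ?_
    rw [← Finset.sum_sub_distrib]
    refine Finset.sum_congr rfl fun b' _ => ?_
    rw [hchain, ← mul_sub]
  have k6 : ∑ a' ∈ V, ∑ b' ∈ V, hullSign v V a' b' * J a' b' = 2 := by
    simp only [hterm, Finset.sum_add_distrib, ite_and]
    simp [hab.1, hab.2.1]
  rw [k6] at k5
  refine Nat.eq_of_mul_eq_mul_left two_pos ?_
  exact_mod_cast k5

end

/-! ### Stars of cells, and triangles with the right boundary -/

section

variable {ι : Type*} [DecidableEq ι] {v : ι → ℰ} {V t : Finset ι}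

lemma IsTriangle.exists_third (h : IsTriangle v t) {a b : ι} (ha : a ∈ t) (hb : b ∈ t)
    (hab : a ≠ b) : ∃ c, t = {a, b, c} ∧ cross (v a) (v b) (v c) ≠ 0 := by
  obtain ⟨x, y, z, rfl, h⟩ := h
  have h2 : cross (v y) (v z) (v x) ≠ 0 := by rw [cross_rotate]; exact h.ne'
  have h3 : cross (v z) (v x) (v y) ≠ 0 := by rw [cross_rotate]; exact h2
  simp only [Finset.mem_insert, Finset.mem_singleton] at ha hb
  rcases ha with rfl | rfl | rfl <;> rcases hb with rfl | rfl | rfl <;>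
    first
    | exact absurd rfl hab
    | exact ⟨_, rfl, h.ne'⟩
    | exact ⟨z, by ext; simp; tauto, by rw [cross_swap]; exact neg_ne_zero.2 h.ne'⟩
    | exact ⟨x, by ext; simp; tauto, h2⟩
    | exact ⟨y, by ext; simp; tauto, h3⟩
    | exact ⟨x, by ext; simp; tauto, by rw [cross_swap]; exact neg_ne_zero.2 h2⟩
    | exact ⟨y, by ext; simp; tauto, by rw [cross_swap]; exact neg_ne_zero.2 h3⟩

/-- The hull contains a triangle, so it has interior points, and a convex set with interior points
lies in the closure of its interior. -/
lemma exists_generic_near (ht : IsTriangle v t) (htV : t ⊆ V) {x : ℰ}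
    (hx : x ∈ convexHull ℝ (v '' (V : Set ι))) {U : Set ℰ} (hU : IsOpen U) (hxU : x ∈ U) :
    ∃ y ∈ U, y ∈ convexHull ℝ (v '' (V : Set ι)) ∧ Generic v V y := by
  have hne : (interior (convexHull ℝ (v '' (V : Set ι)))).Nonempty := by
    obtain ⟨y, hy⟩ := relInt_nonempty v ht.nonempty
    exact ⟨y, mem_interior.2 ⟨_, (relInt_subset_hull v t).trans (hull_mono v htV),
      isOpen_relInt ht, hy⟩⟩
  have hcl : x ∈ closure (interior (convexHull ℝ (v '' (V : Set ι)))) := by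
    rw [(convex_convexHull ℝ _).closure_interior_eq_closure_of_nonempty_interior hne]
    exact subset_closure hx
  obtain ⟨z, hz⟩ := mem_closure_iff.1 hcl U hU hxU
  obtain ⟨y, hy, hg⟩ := exists_generic_mem v V (hU.inter isOpen_interior) ⟨z, hz⟩
  exact ⟨y, hy.1, interior_subset hy.2, hg⟩

/-- Only the vertex of `t` opposite to `a b` is off the line `a b`, and `C` contains it, so its
positive weight decides. -/
lemma cross_ne_zero_of_mem_relInt (ht : IsTriangle v t) {C : Finset ι} (hC : C ⊆ t) {x : ℰ}
    (hx : x ∈ relInt v C) {a b : ι} (ha : a ∈ t) (hb : b ∈ t) (hab : a ≠ b)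
    (hn : ¬ C ⊆ {a, b}) : cross (v a) (v b) x ≠ 0 := by
  obtain ⟨c, rfl, hc⟩ := ht.exists_third ha hb hab
  obtain ⟨w, hw, hw1, rfl⟩ := hx
  have hcC : c ∈ C := by
    by_contra hcC
    apply hn
    intro d hd
    have := hC hd
    simp only [Finset.mem_insert, Finset.mem_singleton] at this ⊢
    rcases this with h | h | h
    · exact Or.inl h
    · exact Or.inr h
    · exact absurd (h ▸ hd) hcC
  rw [cross_sum _ _ _ _ _ hw1, Finset.sum_eq_single_of_mem c hcC]
  · exact mul_ne_zero (hw c hcC).ne' hc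
  · intro d hd hdc
    have := hC hd
    simp only [Finset.mem_insert, Finset.mem_singleton] at this
    rcases this with h | h | h
    · rw [h, cross_self_outer, mul_zero]
    · rw [h, cross_self_right, mul_zero]
    · exact absurd h hdc

/-- Near a relatively interior point of a cell, the hull is covered by the star of the cell. -/
lemma exists_star_nhds {X : Finset (Finset ι)} (hX : ∀ t ∈ X, IsTriangle v t)
    (hV : ∀ t ∈ X, t ⊆ V) (hchain : ∀ a b, ∑ t ∈ X, edgeSign v t a b = hullSign v V a b)
    (hb : ∀ a b : ι, ∃ c ∈ V, c ≠ a ∧ c ≠ b) {C t₀ : Finset ι} (ht₀ : t₀ ∈ X) (hCt : C ⊆ t₀)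
    {x : ℰ} (hx : x ∈ relInt v C) :
    ∃ U : Set ℰ, IsOpen U ∧ x ∈ U ∧ ∀ y ∈ U, y ∈ convexHull ℝ (v '' (V : Set ι)) →
      Generic v V y → ∃ t ∈ X, C ⊆ t ∧ y ∈ relInt v t := by
  classical
  -- The neighbourhood consists of the points on the same side as `x` of every line through two
  -- labels that misses `x`. Within it the number of star triangles over a generic hull point is
  -- constant, and it is positive at a point `y'` of `t₀`.
  let P : Finset (ι × ι) := (V ×ˢ V).filter fun q => cross (v q.1) (v q.2) x ≠ 0
  refine ⟨⋂ q ∈ P, {y | 0 < cross (v q.1) (v q.2) x * cross (v q.1) (v q.2) y}, ?_, ?_, ?_⟩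
  · exact isOpen_biInter_finset fun q _ => isOpen_lt continuous_const (by fun_prop)
  · simp only [Set.mem_iInter]
    intro q hq
    exact mul_self_pos.2 (Finset.mem_filter.1 hq).2
  have hUo : IsOpen (⋂ q ∈ P, {y | 0 < cross (v q.1) (v q.2) x * cross (v q.1) (v q.2) y}) :=
    isOpen_biInter_finset fun q _ => isOpen_lt continuous_const (by fun_prop)
  have hxU : x ∈ ⋂ q ∈ P, {y | 0 < cross (v q.1) (v q.2) x * cross (v q.1) (v q.2) y} := by
    simp only [Set.mem_iInter]
    intro q hq
    exact mul_self_pos.2 (Finset.mem_filter.1 hq).2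
  intro y hyU hy hg
  have hVne : ∃ a ∈ V, ∃ b ∈ V, v a ≠ v b := by
    obtain ⟨a, b, c, ht, h⟩ := hX t₀ ht₀
    exact ⟨a, hV t₀ ht₀ (by simp [ht]), b, hV t₀ ht₀ (by simp [ht]), (ne_of_cross_ne h.ne').1⟩
  have hx0 : x ∈ convexHull ℝ (v '' (t₀ : Set ι)) := hull_mono v hCt (relInt_subset_hull v C hx)
  obtain ⟨y', ⟨hyU', hyt'⟩, hg', hh⟩ := exists_generic_pair v V
    (hUo.inter (isOpen_relInt (hX t₀ ht₀)))
    (relInt_inter_nonempty (hX t₀ ht₀).nonempty hx0 hUo hxU) (fun a ha => hg.ne hVne ha)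
  have hy' : y' ∈ convexHull ℝ (v '' (V : Set ι)) :=
    hull_mono v (hV t₀ ht₀) (relInt_subset_hull v t₀ hyt')
  simp only [Set.mem_iInter] at hyU hyU'
  set XC := X.filter fun t => C ⊆ t with hXC
  have hXCX : ∀ t ∈ XC, t ∈ X := fun t ht => (Finset.mem_filter.1 ht).1
  have k1 := two_mul_card_filter_relInt (X := XC) (fun t ht => hX t (hXCX t ht))
    (fun t ht => hV t (hXCX t ht)) hg hh (cross_self_outer y y')
  have k2 := two_mul_card_filter_relInt (X := XC) (fun t ht => hX t (hXCX t ht))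
    (fun t ht => hV t (hXCX t ht)) hg' hh (cross_self_right y y')
  have k3 : ∀ a ∈ V, ∀ b ∈ V, (∑ t ∈ XC, edgeSign v t a b) *
        crossing (cross (v a) (v b) y) (cross y y' (v a)) (cross y y' (v b)) =
      (∑ t ∈ XC, edgeSign v t a b) *
        crossing (cross (v a) (v b) y') (cross y y' (v a)) (cross y y' (v b)) := by
    intro a ha b hbV
    by_cases h0 : ∑ t ∈ XC, edgeSign v t a b = 0
    · rw [h0, zero_mul, zero_mul]
    congr 1
    -- For an edge that contains `C`, all triangles on it belong to the star, so its coefficient is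
    -- that of the hull, and `y` and `y'` are both on the inner side.
    by_cases hC : C ⊆ {a, b}
    · have hs : ∑ t ∈ XC, edgeSign v t a b = hullSign v V a b := by
        rw [← hchain, hXC, Finset.sum_filter]
        refine Finset.sum_congr rfl fun t _ => ?_
        split_ifs with h
        · rfl
        · rw [edgeSign, if_neg]
          rintro ⟨h1, h2⟩
          exact h (hC.trans (by simp [Finset.insert_subset_iff, h1, h2]))
      rw [hs] at h0
      by_cases h1 : IsHullEdge v V a b
      · exact crossing_congr (mul_pos (h1.pos hb hy hg) (h1.pos hb hy' hg')) _ _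
      · by_cases h2 : IsHullEdge v V b a
        · refine crossing_congr ?_ _ _
          have := mul_pos (h2.pos hb hy hg) (h2.pos hb hy' hg')
          rw [cross_swap (v a), cross_swap (v a)] at this
          linarith
        · simp [hullSign, h1, h2] at h0
    -- The other edges of star triangles span lines that miss `x`, so `y` and `y'` are on the same
    -- side of them by the choice of `P`.
    · obtain ⟨t, ht, hne⟩ := Finset.exists_ne_zero_of_sum_ne_zero h0
      obtain ⟨htX, hCt⟩ := Finset.mem_filter.1 ht
      have hab : a ≠ b := by
        rintro rfl
        exact hne (edgeSign_self v t a)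
      have hat : a ∈ t ∧ b ∈ t := by
        by_contra hn
        exact hne (by rw [edgeSign, if_neg hn])
      have hx' := cross_ne_zero_of_mem_relInt (hX t htX) hCt hx hat.1 hat.2 hab hC
      have hP : (a, b) ∈ P := Finset.mem_filter.2 ⟨by simp [ha, hbV], hx'⟩
      have u1 : 0 < cross (v a) (v b) x * cross (v a) (v b) y := hyU _ hP
      have u2 : 0 < cross (v a) (v b) x * cross (v a) (v b) y' := hyU' _ hP
      refine crossing_congr ?_ _ _
      have := mul_pos u1 u2
      have e : cross (v a) (v b) x * cross (v a) (v b) y * (cross (v a) (v b) x *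
        cross (v a) (v b) y') = (cross (v a) (v b) x) ^ 2 *
          (cross (v a) (v b) y * cross (v a) (v b) y') := by ring
      rw [e] at this
      exact pos_of_mul_pos_right this (sq_nonneg _)
  have k4 : (XC.filter fun t => y ∈ relInt v t).card = (XC.filter fun t => y' ∈ relInt v t).card := by
    refine Nat.eq_of_mul_eq_mul_left two_pos ?_
    have : (2 * (XC.filter fun t => y ∈ relInt v t).card : ℤ) =
        2 * (XC.filter fun t => y' ∈ relInt v t).card := by
      rw [k1, k2]
      exact Finset.sum_congr rfl fun a ha => Finset.sum_congr rfl fun b hb => k3 a ha b hb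
    exact_mod_cast this
  have k5 : 0 < (XC.filter fun t => y' ∈ relInt v t).card :=
    Finset.card_pos.2 ⟨t₀, Finset.mem_filter.2 ⟨Finset.mem_filter.2 ⟨ht₀, hCt⟩, hyt'⟩⟩
  rw [← k4] at k5
  obtain ⟨t, ht⟩ := Finset.card_pos.1 k5
  obtain ⟨h1, h2⟩ := Finset.mem_filter.1 ht
  obtain ⟨h3, h4⟩ := Finset.mem_filter.1 h1
  exact ⟨t, h3, h4, h2⟩

/-- Triangles whose boundary chain is the boundary of the convex hull form a triangulation. -/
theorem isTriComplex_faces {X : Finset (Finset ι)} (hX : ∀ t ∈ X, IsTriangle v t)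
    (hV : ∀ t ∈ X, t ⊆ V) (hchain : ∀ a b, ∑ t ∈ X, edgeSign v t a b = hullSign v V a b)
    (hb : ∀ a b : ι, ∃ c ∈ V, c ≠ a ∧ c ≠ b) (he : ∃ a b, IsHullEdge v V a b) :
    IsTriComplex v V (faces X) where
  subset := by
    intro C hC
    obtain ⟨-, t, ht, hCt⟩ := mem_faces.1 hC
    exact hCt.trans (hV t ht)
  nonempty := fun C hC => (mem_faces.1 hC).1
  indep := by
    intro C hC
    obtain ⟨-, t, ht, hCt⟩ := mem_faces.1 hC
    exact AffineIndependent.of_subset (hX t ht).affineIndependent hCt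
  down := by
    intro C hC D hD hne
    obtain ⟨-, t, ht, hCt⟩ := mem_faces.1 hC
    exact mem_faces.2 ⟨hne, t, ht, hD.trans hCt⟩
  covers := by
    classical
    apply Set.Subset.antisymm
    · refine Set.iUnion₂_subset fun C hC => hull_mono v ?_
      obtain ⟨-, t, ht, hCt⟩ := mem_faces.1 hC
      exact hCt.trans (hV t ht)
    · intro x hx
      by_contra hn
      have hcl : IsClosed (⋃ C ∈ faces X, convexHull ℝ (v '' (C : Set ι))) :=
        isClosed_biUnion_finset fun C _ => isClosed_hull v C
      obtain ⟨t₀, ht₀⟩ : X.Nonempty := by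
        by_contra hne
        rw [Finset.not_nonempty_iff_eq_empty] at hne
        obtain ⟨a, b, hab⟩ := he
        have := hchain a b
        rw [hne] at this
        simp [hullSign, hab, hab.not_swap hb] at this
      obtain ⟨y, hyU, hy, hg⟩ := exists_generic_near (hX t₀ ht₀) (hV t₀ ht₀) hx
        hcl.isOpen_compl hn
      have hc := card_filter_relInt_eq_one hX hV hchain hb he hy hg
      obtain ⟨t, ht⟩ := Finset.card_pos.1 (by rw [hc]; norm_num)
      obtain ⟨h1, h2⟩ := Finset.mem_filter.1 ht
      apply hyU
      simp only [Set.mem_iUnion]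
      exact ⟨t, mem_faces.2 ⟨(hX t h1).nonempty, t, h1, subset_rfl⟩, relInt_subset_hull v t h2⟩
  disjoint := by
    classical
    intro C hC D hD hne
    rw [Set.disjoint_left]
    intro x hxC hxD
    obtain ⟨-, t₀, ht₀, hCt⟩ := mem_faces.1 hC
    obtain ⟨-, t₁, ht₁, hDt⟩ := mem_faces.1 hD
    obtain ⟨U, hU, hxU, hstar⟩ := exists_star_nhds hX hV hchain hb ht₀ hCt hxC
    -- A generic point near `x` inside a triangle over `D` also lies in a triangle over `C`. Generic
    -- points lie in one triangle only, so `C` and `D` are faces of the same simplex.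
    obtain ⟨y, ⟨hyU, hyt⟩, hg⟩ := exists_generic_mem v V (hU.inter (isOpen_relInt (hX t₁ ht₁)))
      (relInt_inter_nonempty (hX t₁ ht₁).nonempty
        (hull_mono v hDt (relInt_subset_hull v D hxD)) hU hxU)
    have hy := hull_mono v (hV t₁ ht₁) (relInt_subset_hull v t₁ hyt)
    obtain ⟨t, ht, hCt', hyt'⟩ := hstar y hyU hy hg
    have hc := card_filter_relInt_eq_one hX hV hchain hb he hy hg
    have : t = t₁ := Finset.card_le_one.1 hc.le t (Finset.mem_filter.2 ⟨ht, hyt'⟩) t₁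
      (Finset.mem_filter.2 ⟨ht₁, hyt⟩)
    subst this
    have hi := (hX t ht).affineIndependent
    exact hne ((relInt_inter_subset hi hCt' hDt hxC (relInt_subset_hull v D hxD)).antisymm
      (relInt_inter_subset hi hDt hCt' hxD (relInt_subset_hull v C hxC)))

end

/-! ### From triangulations to boundary chains -/

section

variable {ι : Type*} [DecidableEq ι] {v : ι → ℰ} {V t : Finset ι} {S : Finset (Finset ι)}

omit [DecidableEq ι] in
lemma card_le_three_of_affineIndependent {C : Finset ι} (h : AffineIndependent ℝ fun a : C => v a) :
    C.card ≤ 3 := by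
  have h1 := h.card_le_finrank_succ
  have h2 : Module.finrank ℝ (vectorSpan ℝ (Set.range fun a : C => v a)) ≤ 2 := by
    have := Submodule.finrank_le (vectorSpan ℝ (Set.range fun a : C => v a))
    simpa using this
  rw [Fintype.card_coe] at h1
  lia

lemma IsTriangle.of_affineIndependent {C : Finset ι} (h : AffineIndependent ℝ fun a : C => v a)
    (hc : C.card = 3) : IsTriangle v C := by
  obtain ⟨a, b, c, hab, hac, hbc, rfl⟩ := Finset.card_eq_three.1 hc
  have hne : cross (v a) (v b) (v c) ≠ 0 := by
    intro h0
    have hvab : v a ≠ v b := by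
      intro he
      have := h.injective (a₁ := ⟨a, by simp⟩) (a₂ := ⟨b, by simp⟩) he
      exact hab (congrArg Subtype.val this)
    obtain ⟨q, -, hq⟩ := dense_iff_inter_open.1 (dense_cross_ne hvab) Set.univ isOpen_univ
      ⟨0, trivial⟩
    -- The areas spanned by `q` and the sides are barycentric weights of `q` scaled by `cross (v a)
    -- (v b) (v c)`. If this is zero they form an affine dependence, nontrivial because `q` is off
    -- the line `a b`.
    have := weights_unique h (u := fun _ => 0) (w := fun x => if x = a then cross (v b) (v c) q
      else if x = b then cross (v c) (v a) q else cross (v a) (v b) q)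
      (by
        rw [sum_triple ⟨hab, hbc, hac⟩, sum_triple ⟨hab, hbc, hac⟩]
        simp only [if_true, hab.symm, hac.symm, hbc.symm, if_false, add_zero]
        rw [← h0]
        simp only [cross]; ring)
      (by
        rw [sum_triple ⟨hab, hbc, hac⟩, sum_triple ⟨hab, hbc, hac⟩]
        simp only [if_true, hab.symm, hac.symm, hbc.symm, if_false, zero_smul, add_zero]
        have e : ∀ i : Fin 2, cross (v b) (v c) q * v a i + (cross (v c) (v a) q * v b i +
            cross (v a) (v b) q * v c i) = cross (v a) (v b) (v c) * q i := by
          intro i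
          fin_cases i <;> simp only [cross, Fin.zero_eta, Fin.mk_one] <;> ring
        ext i
        simpa [h0] using e i) c (by simp)
    simp only [hac.symm, hbc.symm, if_false] at this
    exact hq this
  rcases lt_or_gt_of_ne hne with h1 | h1
  · refine ⟨b, a, c, by ext; simp; tauto, ?_⟩
    rw [cross_swap]
    linarith
  · exact ⟨a, b, c, rfl, h1⟩

namespace IsTriComplex

omit [DecidableEq ι] in
lemma exists_cell (h : IsTriComplex v V S) {x : ℰ} (hx : x ∈ convexHull ℝ (v '' (V : Set ι))) :
    ∃ C ∈ S, x ∈ relInt v C := by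
  rw [← h.covers] at hx
  simp only [Set.mem_iUnion] at hx
  obtain ⟨D, hD, hx⟩ := hx
  obtain ⟨C, hCD, hne, hxC⟩ := exists_relInt_of_mem_hull hx
  exact ⟨C, h.down D hD C hCD hne, hxC⟩

omit [DecidableEq ι] in
lemma eq_of_mem_relInt (h : IsTriComplex v V S) {C D : Finset ι} (hC : C ∈ S) (hD : D ∈ S) {x : ℰ}
    (hxC : x ∈ relInt v C) (hxD : x ∈ relInt v D) : C = D := by
  by_contra hne
  exact Set.disjoint_left.1 (h.disjoint C hC D hD hne) hxC hxD

omit [DecidableEq ι] in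
lemma subset_of_mem_hull (h : IsTriComplex v V S) {C D : Finset ι} (hC : C ∈ S) (hD : D ∈ S) {x : ℰ}
    (hxC : x ∈ relInt v C) (hxD : x ∈ convexHull ℝ (v '' (D : Set ι))) : C ⊆ D := by
  obtain ⟨C', hCD, hne, hxC'⟩ := exists_relInt_of_mem_hull hxD
  rw [h.eq_of_mem_relInt hC (h.down D hD C' hCD hne) hxC hxC']
  exact hCD

-- A generic point lies on no vertex and on no edge, so the cell containing it is a triangle. The
-- finite union of triangles is closed and generic points are dense in the hull.
open Classical in
lemma hull_eq_biUnion_triangles (h : IsTriComplex v V S) (ht : ∃ t ⊆ V, IsTriangle v t) :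
    convexHull ℝ (v '' (V : Set ι)) =
      ⋃ C ∈ S.filter (IsTriangle v), convexHull ℝ (v '' (C : Set ι)) := by
  obtain ⟨t, htV, ht⟩ := ht
  apply Set.Subset.antisymm
  · intro x hx
    by_contra hn
    have hcl : IsClosed (⋃ C ∈ S.filter (IsTriangle v), convexHull ℝ (v '' (C : Set ι))) :=
      isClosed_biUnion_finset fun C _ => isClosed_hull v C
    obtain ⟨y, hyU, hy, hg⟩ := exists_generic_near ht htV hx hcl.isOpen_compl hn
    obtain ⟨C, hC, hyC⟩ := h.exists_cell hy
    have hVne : ∃ a ∈ V, ∃ b ∈ V, v a ≠ v b := by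
      obtain ⟨a, b, c, rfl, h⟩ := ht
      exact ⟨a, htV (by simp), b, htV (by simp), (ne_of_cross_ne h.ne').1⟩
    have h3 : C.card = 3 := by
      have h1 := card_le_three_of_affineIndependent (h.indep C hC)
      have h0 := (h.nonempty C hC).card_pos
      have hCV := h.subset C hC
      by_contra h3
      have : C.card = 1 ∨ C.card = 2 := by lia
      obtain ⟨w, hw, hw1, hwx⟩ := hyC
      rcases this with h4 | h4
      · obtain ⟨a, rfl⟩ := Finset.card_eq_one.1 h4
        simp only [Finset.sum_singleton] at hw1 hwx
        rw [hw1, one_smul] at hwx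
        exact hg.ne hVne (hCV (by simp)) hwx.symm
      · obtain ⟨a, b, hab, rfl⟩ := Finset.card_eq_two.1 h4
        have hvab : v a ≠ v b := by
          intro he
          have := (h.indep _ hC).injective (a₁ := ⟨a, by simp⟩) (a₂ := ⟨b, by simp⟩) he
          exact hab (congrArg Subtype.val this)
        apply hg a (hCV (by simp)) b (hCV (by simp)) hvab
        rw [← hwx, cross_sum _ _ _ _ _ hw1, Finset.sum_pair hab, cross_self_outer,
          cross_self_right]
        ring
    apply hyU
    simp only [Set.mem_iUnion]
    exact ⟨C, Finset.mem_filter.2 ⟨hC, IsTriangle.of_affineIndependent (h.indep C hC) h3⟩,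
      relInt_subset_hull v C hyC⟩
  · refine Set.iUnion₂_subset fun C hC => hull_mono v (h.subset C (Finset.mem_filter.1 hC).1)

open Classical in
/-- Every cell is a face of a triangle. -/
lemma eq_faces (h : IsTriComplex v V S) (ht : ∃ t ⊆ V, IsTriangle v t) :
    S = faces (S.filter (IsTriangle v)) := by
  ext C
  rw [mem_faces]
  constructor
  · intro hC
    refine ⟨h.nonempty C hC, ?_⟩
    obtain ⟨x, hx⟩ := relInt_nonempty v (h.nonempty C hC)
    have hxV := hull_mono v (h.subset C hC) (relInt_subset_hull v C hx)
    rw [h.hull_eq_biUnion_triangles ht] at hxV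
    simp only [Set.mem_iUnion] at hxV
    obtain ⟨D, hD, hxD⟩ := hxV
    exact ⟨D, hD, h.subset_of_mem_hull hC (Finset.mem_filter.1 hD).1 hx hxD⟩
  · rintro ⟨hne, D, hD, hCD⟩
    exact h.down D (Finset.mem_filter.1 hD).1 C hCD hne

omit [DecidableEq ι] in
lemma midpoint_mem_relInt [DecidableEq ι] {a b : ι} (hab : a ≠ b) :
    midpoint ℝ (v a) (v b) ∈ relInt v {a, b} := by
  refine ⟨fun _ => 1 / 2, fun _ _ => by norm_num, ?_, ?_⟩
  · rw [Finset.sum_pair hab]; norm_num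
  · rw [Finset.sum_pair hab, midpoint_eq_smul_add, smul_add]
    norm_num

/-- Hull points strictly to the left of `a b` accumulate at the midpoint of the edge. Finitely many
closed triangles cover the hull, so within one of them such points accumulate there; that triangle
has `a b` as an edge and its third vertex on the left. -/
lemma exists_left (h : IsTriComplex v V S) (ht : ∃ t ⊆ V, IsTriangle v t) {a b : ι} (hab : a ≠ b)
    (hS : {a, b} ∈ S) {z : ι} (hz : z ∈ V) (hl : 0 < cross (v a) (v b) (v z)) :
    ∃ c, {a, b, c} ∈ S ∧ 0 < cross (v a) (v b) (v c) := by
  classical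
  set x := midpoint ℝ (v a) (v b) with hx
  have hxr : x ∈ relInt v {a, b} := midpoint_mem_relInt hab
  have hxV := hull_mono v (h.subset _ hS) (relInt_subset_hull v _ hxr)
  have hx0 : cross (v a) (v b) x = 0 := by
    simp [hx, cross, midpoint_eq_smul_add]
    ring
  have hcl : x ∈ closure ({y | 0 < cross (v a) (v b) y} ∩ convexHull ℝ (v '' (V : Set ι))) := by
    rw [mem_closure_iff]
    intro U hU hxU
    have hc : Continuous fun ε : ℝ => x + ε • (v z - x) := by fun_prop
    have h1 : ∀ᶠ ε in nhds (0 : ℝ), x + ε • (v z - x) ∈ U :=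
      hc.continuousAt.eventually (hU.mem_nhds (by simpa using hxU))
    obtain ⟨ε, hε, hε0⟩ := ((h1.filter_mono nhdsWithin_le_nhds).and
        (Ioo_mem_nhdsGT (zero_lt_one' ℝ))).exists
    refine ⟨_, hε, ?_, ?_⟩
    · change 0 < cross (v a) (v b) (x + ε • (v z - x))
      rw [cross_combo, hx0, mul_zero, zero_add]
      exact mul_pos hε0.1 hl
    · exact (convex_convexHull ℝ _).add_smul_sub_mem hxV (subset_convexHull ℝ _ ⟨z, hz, rfl⟩)
        ⟨hε0.1.le, hε0.2.le⟩
  rw [h.hull_eq_biUnion_triangles ht, Set.inter_iUnion₂, Finset.closure_biUnion] at hcl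
  simp only [Set.mem_iUnion] at hcl
  obtain ⟨t, htS, hxt⟩ := hcl
  obtain ⟨htS, htt⟩ := Finset.mem_filter.1 htS
  have hxt' : x ∈ convexHull ℝ (v '' (t : Set ι)) := by
    have := closure_mono Set.inter_subset_right hxt
    rwa [(isClosed_hull v t).closure_eq] at this
  have hsub := h.subset_of_mem_hull hS htS hxr hxt'
  obtain ⟨c, rfl, hc⟩ := htt.exists_third (hsub (by simp : a ∈ ({a, b} : Finset ι)))
    (hsub (by simp : b ∈ ({a, b} : Finset ι))) hab
  refine ⟨c, htS, ?_⟩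
  obtain ⟨y, hy, hyt⟩ : ({y | 0 < cross (v a) (v b) y} ∩
      convexHull ℝ (v '' (({a, b, c} : Finset ι) : Set ι))).Nonempty :=
    closure_nonempty_iff.1 ⟨x, hxt⟩
  obtain ⟨w, hw, hw1, rfl⟩ := (mem_hull_iff v _ y).1 hyt
  have hy' : 0 < cross (v a) (v b) (∑ i ∈ {a, b, c}, w i • v i) := hy
  obtain ⟨h1, h2, h3⟩ := ne_of_cross_ne hc
  rw [cross_sum _ _ _ _ _ hw1, sum_triple ⟨hab, fun h => h2 (by rw [h]), fun h => h3 (by rw [h])⟩,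
    cross_self_outer, cross_self_right, mul_zero, mul_zero, zero_add, zero_add] at hy'
  exact pos_of_mul_pos_right hy' (hw c (by simp))

/-- Both triangles contain the points just to the left of the midpoint of `a b`, so by disjointness
they coincide. -/
lemma left_unique (h : IsTriComplex v V S) {a b c d : ι} (hc : {a, b, c} ∈ S) (hd : {a, b, d} ∈ S)
    (hlc : 0 < cross (v a) (v b) (v c)) (hld : 0 < cross (v a) (v b) (v d)) :
    c = d := by
  set x := midpoint ℝ (v a) (v b) with hx
  have key : ∀ c, 0 < cross (v a) (v b) (v c) →
      0 < cross (v b) (v c) x ∧ 0 < cross (v c) (v a) x := by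
    intro c hc
    have e1 : cross (v b) (v c) x = cross (v a) (v b) (v c) / 2 := by
      simp [hx, cross, midpoint_eq_smul_add]; ring
    have e2 : cross (v c) (v a) x = cross (v a) (v b) (v c) / 2 := by
      simp [hx, cross, midpoint_eq_smul_add]; ring
    rw [e1, e2]
    constructor <;> positivity
  let z : ℝ → ℰ := fun ε => x + ε • (v c - x)
  have hz : Continuous z := by fun_prop
  have ev : ∀ p q : ℰ, 0 < cross p q x → ∀ᶠ ε in nhds (0 : ℝ), 0 < cross p q (z ε) := by
    intro p q hpq
    have hcont : Continuous fun ε => cross p q (z ε) := by fun_prop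
    exact hcont.continuousAt.eventually (lt_mem_nhds (by simpa [z] using hpq))
  have hev := (((ev _ _ (key c hlc).1).and (ev _ _ (key c hlc).2)).and
    ((ev _ _ (key d hld).1).and (ev _ _ (key d hld).2)))
  obtain ⟨ε, ⟨⟨h1, h2⟩, h3, h4⟩, hε⟩ := ((hev.filter_mono nhdsWithin_le_nhds).and
    (self_mem_nhdsWithin : Set.Ioi (0 : ℝ) ∈ nhdsWithin 0 (Set.Ioi 0))).exists
  have hε' : (0 : ℝ) < ε := hε
  have h5 : 0 < cross (v a) (v b) (z ε) := by
    simp only [z]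
    rw [cross_combo]
    have : cross (v a) (v b) x = 0 := by simp [hx, cross, midpoint_eq_smul_add]; ring
    rw [this, mul_zero, zero_add]
    positivity
  have := h.eq_of_mem_relInt hc hd ((mem_relInt_triangle hlc (z ε)).2 ⟨h1, h2, h5⟩)
    ((mem_relInt_triangle hld (z ε)).2 ⟨h3, h4, h5⟩)
  have hcd : c ∈ ({a, b, d} : Finset ι) := by rw [← this]; simp
  obtain ⟨n1, n2, n3⟩ := ne_of_cross_pos hlc
  simp only [Finset.mem_insert, Finset.mem_singleton] at hcd
  rcases hcd with h | h | h
  · exact absurd h.symm n3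
  · exact absurd h.symm n2
  · exact h

/-- The functional `cross (v a) (v b)` vanishes at the midpoint and is positive at every other
label, so the cell around the midpoint uses only `a` and `b`; neither alone gives the midpoint. -/
lemma hullEdge_mem (h : IsTriComplex v V S) (hb : ∀ a b : ι, ∃ c ∈ V, c ≠ a ∧ c ≠ b) {a b : ι}
    (hab : IsHullEdge v V a b) : {a, b} ∈ S := by
  set x := midpoint ℝ (v a) (v b) with hx
  have hne := hab.2.2.1
  have hxr : x ∈ relInt v {a, b} := midpoint_mem_relInt hne
  have hsub : {a, b} ⊆ V := by simp [Finset.insert_subset_iff, hab.1, hab.2.1]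
  obtain ⟨C, hC, hxC⟩ := h.exists_cell (hull_mono v hsub (relInt_subset_hull v _ hxr))
  have hx0 : cross (v a) (v b) x = 0 := by
    simp [hx, cross, midpoint_eq_smul_add]
    ring
  obtain ⟨w, hw, hw1, hwx⟩ := hxC
  have hCab : C ⊆ {a, b} := by
    intro c hc
    by_contra hn
    simp only [Finset.mem_insert, Finset.mem_singleton, not_or] at hn
    have hpos := hab.2.2.2 c (h.subset C hC hc) hn.1 hn.2
    rw [← hwx, cross_sum _ _ _ _ _ hw1] at hx0
    have := (Finset.sum_eq_zero_iff_of_nonneg (fun d hd => mul_nonneg (hw d hd).le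
      (hab.nonneg (subset_convexHull ℝ _ ⟨d, h.subset C hC hd, rfl⟩)))).1 hx0 c hc
    exact (mul_pos (hw c hc) hpos).ne' this
  have hvab := hab.ne hb
  have hcases : C = ∅ ∨ C = {a} ∨ C = {b} ∨ C = {a, b} := by
    have := Set.subset_pair_iff_eq.1 (show (C : Set ι) ⊆ {a, b} by
      rw [← Finset.coe_pair]; exact_mod_cast hCab)
    rw [← Finset.coe_pair] at this
    exact_mod_cast this
  rcases hcases with rfl | rfl | rfl | rfl
  · simp at hw1
  · simp only [Finset.sum_singleton] at hw1 hwx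
    rw [hw1, one_smul] at hwx
    exact absurd ((midpoint_eq_left_iff ℝ).1 hwx.symm) hvab
  · simp only [Finset.sum_singleton] at hw1 hwx
    rw [hw1, one_smul] at hwx
    exact absurd ((midpoint_eq_right_iff ℝ).1 hwx.symm) hvab
  · exact hC

open Classical in
/-- The boundary chain of the triangles of a triangulation is the boundary of the hull. -/
theorem sum_edgeSign (h : IsTriComplex v V S) (ht : ∃ t ⊆ V, IsTriangle v t)
    (hb : ∀ a b : ι, ∃ c ∈ V, c ≠ a ∧ c ≠ b)
    (hedge : ∀ a b, a ≠ b → {a, b} ∈ S → (∀ c ∈ V, 0 ≤ cross (v a) (v b) (v c)) →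
      IsHullEdge v V a b) (a b : ι) :
    ∑ t ∈ S.filter (IsTriangle v), edgeSign v t a b = hullSign v V a b := by
  set X := S.filter (IsTriangle v) with hX
  have hXS : ∀ t ∈ X, t ∈ S ∧ IsTriangle v t := fun t ht => Finset.mem_filter.1 ht
  by_cases hab : a = b
  · subst hab
    simp [edgeSign_self, hullSign]
  by_cases hS : {a, b} ∈ S
  · have hXl : ∀ a b : ι, (∃ c, {a, b, c} ∈ S ∧ 0 < cross (v a) (v b) (v c)) →
        ∃ c, ({a, b, c} ∈ X) ∧ 0 < cross (v a) (v b) (v c) := by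
      rintro a b ⟨c, hc, hl⟩
      exact ⟨c, Finset.mem_filter.2 ⟨hc, a, b, c, rfl, hl⟩, hl⟩
    -- Coefficient one means that the third vertex is on the left of `a b`. There is exactly one
    -- such triangle if some label lies on that side, and none otherwise.
    have hstep : ∀ a b : ι, a ≠ b → {a, b} ∈ S →
        (∑ t ∈ X, if edgeSign v t a b = 1 then (1 : ℤ) else 0) =
          if ∃ z ∈ V, 0 < cross (v a) (v b) (v z) then 1 else 0 := by
      intro a b hab hS
      have hone : ∀ t ∈ X, edgeSign v t a b = 1 → ∃ c, t = {a, b, c} ∧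
          0 < cross (v a) (v b) (v c) := by
        intro t htX h1
        have hmem : a ∈ t ∧ b ∈ t := by
          by_contra hn
          rw [edgeSign, if_neg hn] at h1
          norm_num at h1
        obtain ⟨c, rfl, hc⟩ := (hXS t htX).2.exists_third hmem.1 hmem.2 hab
        refine ⟨c, rfl, ?_⟩
        by_contra hn
        have hlt : 0 < cross (v b) (v a) (v c) := by
          rw [cross_swap]
          have := lt_of_le_of_ne (not_lt.1 hn) hc
          linarith
        have := (edgeSign_triangle hlt).1
        rw [edgeSign_swap, Finset.insert_comm] at this
        lia
      split_ifs with hz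
      · obtain ⟨z, hz, hlz⟩ := hz
        obtain ⟨c, hcX, hc⟩ := hXl a b (h.exists_left ht hab hS hz hlz)
        rw [Finset.sum_eq_single_of_mem _ hcX, if_pos (edgeSign_triangle hc).1]
        intro t htX hne
        rw [if_neg]
        intro h1
        obtain ⟨d, rfl, hd⟩ := hone t htX h1
        exact hne (by rw [h.left_unique (hXS _ htX).1 (hXS _ hcX).1 hd hc])
      · refine Finset.sum_eq_zero fun t htX => ?_
        rw [if_neg]
        intro h1
        obtain ⟨d, rfl, hd⟩ := hone t htX h1
        exact hz ⟨d, h.subset _ (hXS _ htX).1 (by simp), hd⟩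
    have hsplit : ∀ t ∈ X, edgeSign v t a b = (if edgeSign v t a b = 1 then 1 else 0) -
        (if edgeSign v t b a = 1 then 1 else 0) := by
      intro t htX
      by_cases hmem : a ∈ t ∧ b ∈ t
      · obtain ⟨c, rfl, hc⟩ := (hXS t htX).2.exists_third hmem.1 hmem.2 hab
        rw [edgeSign_swap v _ a b]
        rcases lt_or_gt_of_ne hc with h1 | h1
        · have hlt : 0 < cross (v b) (v a) (v c) := by rw [cross_swap]; linarith
          have := (edgeSign_triangle hlt).1
          rw [edgeSign_swap, Finset.insert_comm] at this
          have h2 : edgeSign v {a, b, c} a b = -1 := by lia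
          rw [h2]; norm_num
        · rw [(edgeSign_triangle h1).1]; norm_num
      · have e1 : edgeSign v t a b = 0 := by rw [edgeSign, if_neg hmem]
        rw [edgeSign_swap v t a b, e1]
        norm_num
    have hba : {b, a} ∈ S := by rwa [Finset.pair_comm]
    rw [Finset.sum_congr rfl hsplit, Finset.sum_sub_distrib, hstep a b hab hS,
      hstep b a (Ne.symm hab) hba, hullSign]
    -- Here `hedge` enters: an edge with nothing on its right is a hull edge in the strict sense,
    -- with no further label on its line.
    have hiff : ∀ a b : ι, a ≠ b → {a, b} ∈ S →
        (IsHullEdge v V a b ↔ ¬ ∃ z ∈ V, 0 < cross (v b) (v a) (v z)) := by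
      intro a b hab hS
      constructor
      · rintro hE ⟨z, hz, hlt⟩
        have := hE.nonneg (subset_convexHull ℝ _ ⟨z, hz, rfl⟩)
        rw [cross_swap] at hlt
        linarith
      · intro hn
        refine hedge a b hab hS fun c hc => ?_
        by_contra hlt
        refine hn ⟨c, hc, ?_⟩
        rw [cross_swap]
        linarith
    rw [if_congr (hiff a b hab hS) rfl rfl, if_congr (hiff b a (Ne.symm hab) hba) rfl rfl]
    split_ifs <;> norm_num
  · rw [hullSign, if_neg (fun hE => hS (h.hullEdge_mem hb hE)),
      if_neg (fun hE => hS (by rw [Finset.pair_comm]; exact h.hullEdge_mem hb hE)), sub_zero]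
    refine Finset.sum_eq_zero fun t htX => ?_
    rw [edgeSign, if_neg]
    rintro ⟨h1, h2⟩
    exact hS (h.down t (hXS t htX).1 _ (by simp [Finset.insert_subset_iff, h1, h2]) (by simp))

end IsTriComplex

end

/-! ### Cyclic order and triangulations of polygons as chains -/

section

variable {n : ℕ}

/-- `a`, `b`, `c` are different and in cyclic order. -/
def CyclicLT (a b c : Fin n) : Prop := a < b ∧ b < c ∨ b < c ∧ c < a ∨ c < a ∧ a < b

lemma CyclicLT.rotate {a b c : Fin n} (h : CyclicLT a b c) : CyclicLT b c a := by
  unfold CyclicLT at *; tauto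

lemma CyclicLT.asymm {a b c : Fin n} (h : CyclicLT a b c) : ¬ CyclicLT a c b := by
  unfold CyclicLT at *; lia

lemma CyclicLT.ne {a b c : Fin n} (h : CyclicLT a b c) : a ≠ b ∧ b ≠ c ∧ a ≠ c := by
  unfold CyclicLT at *; lia

lemma CyclicLT.total {a b c : Fin n} (h1 : a ≠ b) (h2 : b ≠ c) (h3 : a ≠ c) :
    CyclicLT a b c ∨ CyclicLT a c b := by
  unfold CyclicLT at *; lia

lemma CyclicLT.trans {a b c d : Fin n} (h1 : CyclicLT a b c) (h2 : CyclicLT a c d) :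
    CyclicLT a b d := by
  unfold CyclicLT at *; lia

/-- `b` is the cyclic successor of `a` in `N`. -/
def IsSucc (N : Finset (Fin n)) (a b : Fin n) : Prop :=
  a ∈ N ∧ b ∈ N ∧ a ≠ b ∧ ∀ c ∈ N, ¬ CyclicLT a c b

open Classical in
/-- The coefficient of the directed edge from `a` to `b` in the boundary of the polygon with vertex
set `N`. -/
noncomputable def bd (N : Finset (Fin n)) (a b : Fin n) : ℤ :=
  (if IsSucc N a b then 1 else 0) - (if IsSucc N b a then 1 else 0)

/-- The triangles `X` triangulate the polygon with vertex set `N`: their boundary chain is the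
boundary of the polygon. -/
def IsTriang (N : Finset (Fin n)) (X : Finset (Finset (Fin n))) : Prop :=
  (∀ t ∈ X, t.card = 3) ∧ ∀ a b, ∑ t ∈ X, bd t a b = bd N a b

lemma bd_swap (N : Finset (Fin n)) (a b : Fin n) : bd N b a = -bd N a b := by
  unfold bd; ring

lemma bd_self (N : Finset (Fin n)) (a : Fin n) : bd N a a = 0 := by
  unfold bd; ring

lemma bd_of_notMem_left {N : Finset (Fin n)} {a : Fin n} (h : a ∉ N) (b : Fin n) :
    bd N a b = 0 := by
  simp [bd, IsSucc, h]

lemma bd_of_notMem_right {N : Finset (Fin n)} {b : Fin n} (h : b ∉ N) (a : Fin n) :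
    bd N a b = 0 := by
  simp [bd, IsSucc, h]

lemma IsSucc.unique {N : Finset (Fin n)} {a b c : Fin n} (hb : IsSucc N a b) (hc : IsSucc N a c) :
    b = c := by
  by_contra hne
  rcases CyclicLT.total hb.2.2.1 hne hc.2.2.1 with h | h
  · exact hc.2.2.2 b hb.2.1 h
  · exact hb.2.2.2 c hc.2.1 h

lemma IsSucc.unique_left {N : Finset (Fin n)} {a b c : Fin n} (hb : IsSucc N b a)
    (hc : IsSucc N c a) : b = c := by
  by_contra hne
  rcases CyclicLT.total hb.2.2.1 hc.2.2.1.symm hne with h | h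
  · exact hc.2.2.2 b hb.1 h.rotate.rotate
  · exact hb.2.2.2 c hc.1 h

lemma exists_isSucc {N : Finset (Fin n)} {a : Fin n} (ha : a ∈ N) (h : ∃ b ∈ N, b ≠ a) :
    ∃ b, IsSucc N a b := by
  obtain ⟨b, hb, hba⟩ := h
  by_cases h1 : (N.filter fun x => a < x).Nonempty
  · have hm := Finset.min'_mem _ h1
    have hle := fun x hx => Finset.min'_le (N.filter fun x => a < x) x hx
    set m := Finset.min' _ h1
    rw [Finset.mem_filter] at hm
    refine ⟨m, ha, hm.1, hm.2.ne, fun c hc hcyc => ?_⟩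
    by_cases hac : a < c
    · have := hle c (Finset.mem_filter.2 ⟨hc, hac⟩)
      unfold CyclicLT at hcyc; lia
    · unfold CyclicLT at hcyc; lia
  · obtain ⟨m, hm, hle⟩ := N.exists_min_image id ⟨a, ha⟩
    simp only [id] at hle
    rw [Finset.not_nonempty_iff_eq_empty, Finset.filter_eq_empty_iff] at h1
    refine ⟨m, ha, hm, ?_, fun c hc hcyc => ?_⟩
    · rintro rfl
      have := hle b hb
      have := h1 hb
      lia
    · have := hle c hc
      have := h1 hc
      unfold CyclicLT at hcyc; lia

lemma exists_isSucc_left {N : Finset (Fin n)} {a : Fin n} (ha : a ∈ N) (h : ∃ b ∈ N, b ≠ a) :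
    ∃ b, IsSucc N b a := by
  obtain ⟨b, hb, hba⟩ := h
  by_cases h1 : (N.filter fun x => x < a).Nonempty
  · have hm := Finset.max'_mem _ h1
    have hle := fun x hx => Finset.le_max' (N.filter fun x => x < a) x hx
    set m := Finset.max' _ h1
    rw [Finset.mem_filter] at hm
    refine ⟨m, hm.1, ha, hm.2.ne, fun c hc hcyc => ?_⟩
    by_cases hac : c < a
    · have := hle c (Finset.mem_filter.2 ⟨hc, hac⟩)
      unfold CyclicLT at hcyc; lia
    · unfold CyclicLT at hcyc; lia
  · obtain ⟨m, hm, hle⟩ := N.exists_max_image id ⟨a, ha⟩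
    simp only [id] at hle
    rw [Finset.not_nonempty_iff_eq_empty, Finset.filter_eq_empty_iff] at h1
    refine ⟨m, hm, ha, ?_, fun c hc hcyc => ?_⟩
    · rintro rfl
      have := hle b hb
      have := h1 hb
      lia
    · have := hle c hc
      have := h1 hc
      unfold CyclicLT at hcyc; lia

/-- The boundary is a cycle: every vertex has one successor and one predecessor, with opposite
signs. This holds for a polygon with two vertices as well, where all coefficients vanish. -/
lemma sum_bd (N : Finset (Fin n)) (a : Fin n) : ∑ b, bd N a b = 0 := by
  classical
  unfold bd
  rw [Finset.sum_sub_distrib]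
  by_cases h : a ∈ N ∧ ∃ b ∈ N, b ≠ a
  · obtain ⟨s, hs⟩ := exists_isSucc h.1 h.2
    obtain ⟨r, hr⟩ := exists_isSucc_left h.1 h.2
    rw [Finset.sum_eq_single_of_mem s (Finset.mem_univ _)
      (fun b _ hb => if_neg fun hb' => hb (hb'.unique hs)),
      Finset.sum_eq_single_of_mem r (Finset.mem_univ _)
      (fun b _ hb => if_neg fun hb' => hb (hb'.unique_left hr)), if_pos hs, if_pos hr, sub_self]
  · rw [Finset.sum_eq_zero, Finset.sum_eq_zero, sub_self]
    · intro b _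
      exact if_neg fun hb => h ⟨hb.2.1, b, hb.1, hb.2.2.1⟩
    · intro b _
      exact if_neg fun hb => h ⟨hb.1, b, hb.2.1, hb.2.2.1.symm⟩

lemma isSucc_triple {a b c : Fin n} (h : CyclicLT a b c) : IsSucc {a, b, c} a b := by
  refine ⟨by simp, by simp, h.ne.1, fun d hd => ?_⟩
  simp only [Finset.mem_insert, Finset.mem_singleton] at hd
  rcases hd with rfl | rfl | rfl
  · exact fun h => h.ne.1 rfl
  · exact fun h => h.ne.2.1 rfl
  · exact h.asymm

lemma bd_triple {a b c : Fin n} (h : CyclicLT a b c) : bd {a, b, c} a b = 1 := by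
  rw [bd, if_pos (isSucc_triple h), if_neg fun h' => h'.2.2.2 c (by simp) h.rotate, sub_zero]

lemma bd_triple_neg {a b c : Fin n} (h : CyclicLT a c b) : bd {a, b, c} a b = -1 := by
  rw [bd_swap, Finset.insert_comm, bd_triple h.rotate.rotate]

lemma exists_third {t : Finset (Fin n)} (ht : t.card = 3) {a b : Fin n} (ha : a ∈ t) (hb : b ∈ t)
    (hab : a ≠ b) : ∃ c, c ≠ a ∧ c ≠ b ∧ t = {a, b, c} := by
  have h1 : ((t.erase a).erase b).card = 1 := by
    rw [Finset.card_erase_of_mem (by simp [hab.symm, hb]), Finset.card_erase_of_mem ha, ht]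
  obtain ⟨c, hc⟩ := Finset.card_eq_one.1 h1
  have hc' : c ∈ (t.erase a).erase b := by rw [hc]; simp
  simp only [Finset.mem_erase] at hc'
  refine ⟨c, hc'.2.1, hc'.1, ?_⟩
  rw [← hc, Finset.insert_erase (by simp [hab.symm, hb]), Finset.insert_erase ha]

/-- If a vertex `m` of a triangle were not in `N`, consider the triangles at `m` and the first of
their vertices after `m` in cyclic order. All triangles on this extreme edge lie on the same side of
it, so their signs cannot cancel. -/
lemma IsTriang.subset {N : Finset (Fin n)} {X : Finset (Finset (Fin n))} (h : IsTriang N X)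
    {t : Finset (Fin n)} (ht : t ∈ X) : t ⊆ N := by
  classical
  intro m hm
  by_contra hmN
  let A : Finset (Fin n) := Finset.univ.filter fun x => ∃ t ∈ X, m ∈ t ∧ x ∈ t
  have hmA : m ∈ A := by simpa [A] using ⟨t, ht, hm⟩
  have hne : ∃ b ∈ A, b ≠ m := by
    obtain ⟨b, hb, hbm⟩ := Finset.exists_mem_ne (by rw [h.1 t ht]; norm_num) m
    exact ⟨b, by simpa [A] using ⟨t, ht, hm, hb⟩, hbm⟩
  obtain ⟨x, hx⟩ := exists_isSucc hmA hne
  have hpos : ∀ s ∈ X, m ∈ s → x ∈ s → bd s m x = 1 := by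
    intro s hs hms hxs
    obtain ⟨z, hz1, hz2, rfl⟩ := exists_third (h.1 s hs) hms hxs hx.2.2.1
    refine bd_triple ((CyclicLT.total hx.2.2.1 hz2.symm hz1.symm).resolve_right ?_)
    exact hx.2.2.2 z (by simpa [A] using ⟨_, hs, hms, by simp⟩)
  have h0 := h.2 m x
  rw [bd_of_notMem_left hmN] at h0
  obtain ⟨s, hs, hms, hxs⟩ : ∃ s ∈ X, m ∈ s ∧ x ∈ s := by simpa [A] using hx.2.1
  have := (Finset.sum_eq_zero_iff_of_nonneg (fun s hs => by
    by_cases h1 : m ∈ s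
    · by_cases h2 : x ∈ s
      · rw [hpos s hs h1 h2]; norm_num
      · rw [bd_of_notMem_right h2]
    · rw [bd_of_notMem_left h1])).1 h0 s hs
  rw [hpos s hs hms hxs] at this
  norm_num at this

/-- The points `p i` are the vertices of a strictly convex polygon in counterclockwise order. -/
def IsCcw (p : Fin n → ℰ) : Prop := ∀ i j k, i < j → j < k → 0 < cross (p i) (p j) (p k)

variable {p : Fin n → ℰ}

lemma IsCcw.cross_pos (hp : IsCcw p) {a b c : Fin n} (h : CyclicLT a b c) :
    0 < cross (p a) (p b) (p c) := by
  rcases h with h | h | h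
  · exact hp a b c h.1 h.2
  · rw [← cross_rotate]; exact hp b c a h.1 h.2
  · rw [← cross_rotate, ← cross_rotate]; exact hp c a b h.1 h.2

lemma IsCcw.cross_pos_iff (hp : IsCcw p) {a b c : Fin n} :
    0 < cross (p a) (p b) (p c) ↔ CyclicLT a b c := by
  refine ⟨fun h => ?_, hp.cross_pos⟩
  obtain ⟨h1, h2, h3⟩ := ne_of_cross_pos h
  refine (CyclicLT.total h1 h2 h3).resolve_right fun h' => ?_
  have := hp.cross_pos h'
  rw [cross_swap_right] at this
  linarith

lemma IsCcw.isTriangle (hp : IsCcw p) {t : Finset (Fin n)} (ht : t.card = 3) : IsTriangle p t := by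
  obtain ⟨a, b, c, h1, h2, h3, rfl⟩ := Finset.card_eq_three.1 ht
  rcases CyclicLT.total h1 h3 h2 with h | h
  · exact ⟨a, b, c, rfl, hp.cross_pos h⟩
  · exact ⟨a, c, b, by rw [Finset.pair_comm], hp.cross_pos h⟩

lemma IsCcw.edgeSign_eq (hp : IsCcw p) {t : Finset (Fin n)} (ht : t.card = 3) (a b : Fin n) :
    edgeSign p t a b = bd t a b := by
  by_cases hab : a = b
  · rw [hab, edgeSign_self, bd_self]
  by_cases ha : a ∈ t
  · by_cases hb : b ∈ t
    · obtain ⟨c, hca, hcb, rfl⟩ := exists_third ht ha hb hab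
      rcases CyclicLT.total hab hcb.symm hca.symm with h | h
      · rw [(edgeSign_triangle (hp.cross_pos h)).1, bd_triple h]
      · rw [bd_swap, edgeSign_swap, Finset.insert_comm, bd_triple h.rotate.rotate,
          (edgeSign_triangle (hp.cross_pos h.rotate.rotate)).1]
    · rw [bd_of_notMem_right hb, edgeSign, if_neg fun h => hb h.2]
  · rw [bd_of_notMem_left ha, edgeSign, if_neg fun h => ha h.1]

lemma IsCcw.isHullEdge_iff (hp : IsCcw p) {N : Finset (Fin n)} {a b : Fin n} :
    IsHullEdge p N a b ↔ IsSucc N a b := by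
  unfold IsHullEdge IsSucc
  refine and_congr_right fun _ => and_congr_right fun _ => and_congr_right fun hab => ?_
  constructor
  · intro h c hc hcyc
    exact (hp.cross_pos_iff.1 (h c hc hcyc.ne.1.symm hcyc.ne.2.1)).asymm hcyc
  · intro h c hc hca hcb
    exact hp.cross_pos ((CyclicLT.total hab hcb.symm hca.symm).resolve_right (h c hc))

lemma IsCcw.hullSign_eq (hp : IsCcw p) (N : Finset (Fin n)) (a b : Fin n) :
    hullSign p N a b = bd N a b := by
  have h : ∀ a b, IsHullEdge p N a b ↔ IsSucc N a b := fun a b => hp.isHullEdge_iff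
  unfold hullSign bd
  congr 1
  · by_cases h1 : IsSucc N a b
    · rw [if_pos h1, if_pos ((h a b).2 h1)]
    · rw [if_neg h1, if_neg fun h2 => h1 ((h a b).1 h2)]
  · by_cases h1 : IsSucc N b a
    · rw [if_pos h1, if_pos ((h b a).2 h1)]
    · rw [if_neg h1, if_neg fun h2 => h1 ((h b a).1 h2)]

lemma exists_mem_ne_ne {α : Type*} [DecidableEq α] {N : Finset α} (hN : 3 ≤ N.card) (a b : α) :
    ∃ c ∈ N, c ≠ a ∧ c ≠ b := by
  have : 0 < ((N.erase a).erase b).card := by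
    have h1 := Finset.pred_card_le_card_erase (s := N) (a := a)
    have h2 := Finset.pred_card_le_card_erase (s := N.erase a) (a := b)
    lia
  obtain ⟨c, hc⟩ := Finset.card_pos.1 this
  simp only [Finset.mem_erase] at hc
  exact ⟨c, hc.2.2, hc.2.1, hc.1⟩

lemma IsTriang.isTriComplex (hp : IsCcw p) {N : Finset (Fin n)} {X : Finset (Finset (Fin n))}
    (h : IsTriang N X) (hN : 3 ≤ N.card) : IsTriComplex p N (faces X) := by
  refine isTriComplex_faces (fun t ht => hp.isTriangle (h.1 t ht)) (fun t ht => h.subset ht) ?_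
    (exists_mem_ne_ne hN) ?_
  · intro a b
    rw [hp.hullSign_eq, ← h.2]
    exact Finset.sum_congr rfl fun t ht => hp.edgeSign_eq (h.1 t ht) a b
  · obtain ⟨a, ha⟩ := Finset.card_pos.1 (show 0 < N.card by lia)
    obtain ⟨b, hb⟩ := exists_isSucc ha (Finset.exists_mem_ne (by lia) a)
    exact ⟨a, b, hp.isHullEdge_iff.2 hb⟩

/-- The edges of a triangulation do not cross. -/
lemma IsTriang.noncrossing (hp : IsCcw p) {N : Finset (Fin n)} {X : Finset (Finset (Fin n))}
    (h : IsTriang N X) {a x c y : Fin n} (h1 : CyclicLT a x c) (h2 : CyclicLT a c y)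
    {t : Finset (Fin n)} (ht : t ∈ X) (hat : a ∈ t) (hct : c ∈ t)
    {t' : Finset (Fin n)} (ht' : t' ∈ X) (hxt : x ∈ t') (hyt : y ∈ t') : False := by
  have hN : 3 ≤ N.card := by
    rw [← h.1 t ht]
    exact Finset.card_le_card (h.subset ht)
  have hC := h.isTriComplex hp hN
  have h3 : CyclicLT a x y := h1.trans h2
  have h4 : CyclicLT c y x := by unfold CyclicLT at *; lia
  have e1 := hp.cross_pos h1
  have e2 := hp.cross_pos h2
  have e3 := hp.cross_pos h3
  have e4 := hp.cross_pos h4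
  have hac : a ≠ c := h1.ne.2.2
  have hxy : x ≠ y := h3.ne.2.1
  -- Twice the area of the quadrilateral `a x c y`, split along either diagonal. The weights below
  -- are those of the intersection point of the diagonals, which would then lie in two different
  -- cells.
  set D := cross (p a) (p c) (p y) + cross (p a) (p x) (p c) with hD
  have hD' : D = cross (p c) (p y) (p x) + cross (p a) (p x) (p y) := by
    simp only [hD, cross]; ring
  have hDpos : 0 < D := by positivity
  have k1 : (cross (p c) (p y) (p x) / D) • p a + (cross (p a) (p x) (p y) / D) • p c ∈
      relInt p {a, c} := by
    refine ⟨fun i => if i = a then cross (p c) (p y) (p x) / D else cross (p a) (p x) (p y) / D,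
      fun i _ => by dsimp only; split_ifs <;> positivity, ?_, ?_⟩
    · rw [Finset.sum_pair hac, if_pos rfl, if_neg hac.symm, ← add_div, ← hD', div_self hDpos.ne']
    · rw [Finset.sum_pair hac]
      simp only [if_true, hac.symm, if_false]
  have k2 : (cross (p c) (p y) (p x) / D) • p a + (cross (p a) (p x) (p y) / D) • p c ∈
      relInt p {x, y} := by
    refine ⟨fun i => if i = x then cross (p a) (p c) (p y) / D else cross (p a) (p x) (p c) / D,
      fun i _ => by dsimp only; split_ifs <;> positivity, ?_, ?_⟩
    · rw [Finset.sum_pair hxy, if_pos rfl, if_neg hxy.symm, ← add_div, ← hD, div_self hDpos.ne']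
    · rw [Finset.sum_pair hxy]
      simp only [if_true, hxy.symm, if_false]
      ext i
      fin_cases i
      · simp
        field_simp
        simp only [cross]; ring
      · simp
        field_simp
        simp only [cross]; ring
  have hS : ∀ {u w : Fin n} {t : Finset (Fin n)}, t ∈ X → u ∈ t → w ∈ t → {u, w} ∈ faces X :=
    fun ht hu hw => mem_faces.2 ⟨by simp, _, ht, by simp [Finset.insert_subset_iff, hu, hw]⟩
  have := hC.eq_of_mem_relInt (hS ht hat hct) (hS ht' hxt hyt) k1 k2
  have hx : x ∈ ({a, c} : Finset (Fin n)) := by rw [this]; simp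
  simp only [Finset.mem_insert, Finset.mem_singleton] at hx
  rcases hx with hx | hx
  · exact h1.ne.1 hx.symm
  · exact h1.ne.2.1 hx

end

/-! ### The Catalan count -/

section

variable {n : ℕ}

lemma isSucc_iff_of_lt {N : Finset (Fin n)} {u w : Fin n} (h : u < w) :
    IsSucc N u w ↔ u ∈ N ∧ w ∈ N ∧ ∀ x ∈ N, ¬ (u < x ∧ x < w) := by
  refine and_congr_right fun _ => and_congr_right fun _ => ⟨fun h1 x hx h2 => ?_, fun h1 => ?_⟩
  · exact h1.2 x hx (Or.inl h2)
  · refine ⟨h.ne, fun x hx h2 => h1 x hx ?_⟩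
    unfold CyclicLT at h2; lia

lemma isSucc_iff_of_gt {N : Finset (Fin n)} {u w : Fin n} (h : u < w) :
    IsSucc N w u ↔ u ∈ N ∧ w ∈ N ∧ ∀ x ∈ N, u ≤ x ∧ x ≤ w := by
  unfold IsSucc
  constructor
  · rintro ⟨h1, h2, -, h3⟩
    refine ⟨h2, h1, fun x hx => ?_⟩
    have := h3 x hx
    unfold CyclicLT at this; lia
  · rintro ⟨h1, h2, h3⟩
    refine ⟨h2, h1, h.ne', fun x hx h4 => ?_⟩
    have := h3 x hx
    unfold CyclicLT at h4; lia

lemma ite_or_eq_add {P Q : Prop} [Decidable P] [Decidable Q] [Decidable (P ∨ Q)]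
    (h : ¬ (P ∧ Q)) : (if P ∨ Q then (1 : ℤ) else 0) =
      (if P then 1 else 0) + (if Q then 1 else 0) := by
  by_cases hP : P <;> by_cases hQ : Q <;> simp_all

/-- Cutting a polygon along a triangle over the edge from its first to its last vertex. -/
lemma bd_split {N : Finset (Fin n)} {a b c : Fin n} (ha : a ∈ N) (hb : b ∈ N) (hc : c ∈ N)
    (hac : a < c) (hcb : c < b) (hmin : ∀ x ∈ N, a ≤ x) (hmax : ∀ x ∈ N, x ≤ b) (u w : Fin n) :
    bd N u w = bd (N.filter (· ≤ c)) u w + bd (N.filter (c ≤ ·)) u w + bd {a, c, b} u w := by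
  wlog h : u < w generalizing u w
  · rcases lt_trichotomy u w with h1 | rfl | h1
    · exact absurd h1 h
    · simp [bd_self]
    · have := this w u h1
      rw [bd_swap N u w, bd_swap _ u w, bd_swap (N.filter (c ≤ ·)) u w,
        bd_swap {a, c, b} u w] at this
      lia
  have s1 : IsSucc N u w ↔ IsSucc (N.filter (· ≤ c)) u w ∨ IsSucc (N.filter (c ≤ ·)) u w := by
    simp only [isSucc_iff_of_lt h, Finset.mem_filter]
    constructor
    · rintro ⟨h1, h2, h3⟩
      by_cases h4 : w ≤ c
      · exact Or.inl ⟨⟨h1, by lia⟩, ⟨h2, h4⟩, fun x hx => h3 x hx.1⟩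
      · have := h3 c hc
        exact Or.inr ⟨⟨h1, by lia⟩, ⟨h2, by lia⟩, fun x hx => h3 x hx.1⟩
    · rintro (⟨h1, h2, h3⟩ | ⟨h1, h2, h3⟩)
      · exact ⟨h1.1, h2.1, fun x hx h4 => h3 x ⟨hx, by lia⟩ h4⟩
      · exact ⟨h1.1, h2.1, fun x hx h4 => h3 x ⟨hx, by lia⟩ h4⟩
  have s1' : ¬ (IsSucc (N.filter (· ≤ c)) u w ∧ IsSucc (N.filter (c ≤ ·)) u w) := by
    simp only [isSucc_iff_of_lt h, Finset.mem_filter]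
    lia
  have s2 : IsSucc N w u ↔ u = a ∧ w = b := by
    rw [isSucc_iff_of_gt h]
    constructor
    · rintro ⟨h1, h2, h3⟩
      exact ⟨le_antisymm (h3 a ha).1 (hmin u h1), le_antisymm (hmax w h2) (h3 b hb).2⟩
    · rintro ⟨rfl, rfl⟩
      exact ⟨ha, hb, fun x hx => ⟨hmin x hx, hmax x hx⟩⟩
  have s3 : IsSucc (N.filter (· ≤ c)) w u ↔ u = a ∧ w = c := by
    rw [isSucc_iff_of_gt h]
    simp only [Finset.mem_filter]
    constructor
    · rintro ⟨h1, h2, h3⟩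
      exact ⟨le_antisymm (h3 a ⟨ha, hac.le⟩).1 (hmin u h1.1),
        le_antisymm h2.2 (h3 c ⟨hc, le_rfl⟩).2⟩
    · rintro ⟨rfl, rfl⟩
      exact ⟨⟨ha, hac.le⟩, ⟨hc, le_rfl⟩, fun x hx => ⟨hmin x hx.1, hx.2⟩⟩
  have s4 : IsSucc (N.filter (c ≤ ·)) w u ↔ u = c ∧ w = b := by
    rw [isSucc_iff_of_gt h]
    simp only [Finset.mem_filter]
    constructor
    · rintro ⟨h1, h2, h3⟩
      exact ⟨le_antisymm (h3 c ⟨hc, le_rfl⟩).1 h1.2,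
        le_antisymm (hmax w h2.1) (h3 b ⟨hb, hcb.le⟩).2⟩
    · rintro ⟨rfl, rfl⟩
      exact ⟨⟨hc, le_rfl⟩, ⟨hb, hcb.le⟩, fun x hx => ⟨hx.2, hmax x hx.1⟩⟩
  have s5 : IsSucc {a, c, b} u w ↔ u = a ∧ w = c ∨ u = c ∧ w = b := by
    rw [isSucc_iff_of_lt h]
    simp only [Finset.mem_insert, Finset.mem_singleton, forall_eq_or_imp, forall_eq]
    lia
  have s6 : IsSucc {a, c, b} w u ↔ u = a ∧ w = b := by
    rw [isSucc_iff_of_gt h]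
    simp only [Finset.mem_insert, Finset.mem_singleton, forall_eq_or_imp, forall_eq]
    lia
  classical
  unfold bd
  rw [if_congr s1 rfl rfl, if_congr s2 rfl rfl, if_congr s3 rfl rfl, if_congr s4 rfl rfl,
    if_congr s5 rfl rfl, if_congr s6 rfl rfl]
  have s7 : ¬ ((u = a ∧ w = c) ∧ (u = c ∧ w = b)) := by lia
  rw [ite_or_eq_add s1', ite_or_eq_add s7]
  ring

open Classical in
/-- The set of triangulations of the polygon with vertex set `N`. -/
noncomputable def triangs (N : Finset (Fin n)) : Finset (Finset (Finset (Fin n))) :=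
  Finset.univ.filter (IsTriang N)

lemma mem_triangs {N : Finset (Fin n)} {X : Finset (Finset (Fin n))} :
    X ∈ triangs N ↔ IsTriang N X := by simp [triangs]

lemma triangs_pair {N : Finset (Fin n)} (hN : N.card = 2) : triangs N = {∅} := by
  ext X
  rw [mem_triangs, Finset.mem_singleton]
  constructor
  · intro h
    by_contra hne
    obtain ⟨t, ht⟩ := Finset.nonempty_iff_ne_empty.2 hne
    have := Finset.card_le_card (h.subset ht)
    rw [h.1 t ht] at this
    lia
  · rintro rfl
    refine ⟨by simp, fun u w => ?_⟩
    obtain ⟨a, b, hab, rfl⟩ := Finset.card_eq_two.1 hN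
    -- In a polygon with two vertices each one is the successor of the other, so the boundary
    -- vanishes and the empty set is its only triangulation.
    have : IsSucc {a, b} u w ↔ IsSucc {a, b} w u := by
      unfold IsSucc
      simp only [Finset.mem_insert, Finset.mem_singleton, forall_eq_or_imp, forall_eq, CyclicLT]
      lia
    classical
    rw [bd, if_congr this rfl rfl, sub_self, Finset.sum_empty]

/-- The rank of an element is a bijection from `I` onto an initial segment of the naturals; it puts
the sum over apexes into the form of the Catalan recursion. -/
lemma sum_card_filter_lt (I : Finset (Fin n)) (f : ℕ → ℕ) :
    ∑ c ∈ I, f (I.filter (· < c)).card = ∑ i ∈ Finset.range I.card, f i := by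
  have hmaps : Set.MapsTo (fun c => (I.filter (· < c)).card) I (Finset.range I.card) := by
    intro c hc
    rw [Finset.coe_range, Set.mem_Iio]
    refine Finset.card_lt_card (Finset.filter_ssubset.2 ⟨c, hc, lt_irrefl c⟩)
  have hmono : ∀ c ∈ I, ∀ d ∈ I, c < d → (I.filter (· < c)).card < (I.filter (· < d)).card := by
    intro c hc d _ hcd
    refine Finset.card_lt_card (Finset.ssubset_iff_of_subset ?_ |>.2 ⟨c, ?_, ?_⟩)
    · intro x hx
      rw [Finset.mem_filter] at hx ⊢
      exact ⟨hx.1, hx.2.trans hcd⟩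
    · exact Finset.mem_filter.2 ⟨hc, hcd⟩
    · simp
  have hinj : Set.InjOn (fun c => (I.filter (· < c)).card) I := by
    intro c hc d hd h
    rcases lt_trichotomy c d with h1 | h1 | h1
    · exact absurd h (hmono c hc d hd h1).ne
    · exact h1
    · exact absurd h (hmono d hd c hc h1).ne'
  exact Finset.sum_nbij _ hmaps hinj
    (Finset.surjOn_of_injOn_of_card_le _ hmaps hinj (by simp)) (fun _ _ => rfl)

variable {p : Fin n → ℰ}

/-- The triangulations that contain a given triangle over the edge from the first to the last
vertex. -/
lemma card_triangs_filter_mem (hp : IsCcw p) {N : Finset (Fin n)} {a b c : Fin n} (ha : a ∈ N)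
    (hb : b ∈ N) (hc : c ∈ N) (hac : a < c) (hcb : c < b) (hmin : ∀ x ∈ N, a ≤ x)
    (hmax : ∀ x ∈ N, x ≤ b) :
    ((triangs N).filter fun X => {a, c, b} ∈ X).card =
      (triangs (N.filter (· ≤ c))).card * (triangs (N.filter (c ≤ ·))).card := by
  classical
  rw [← Finset.card_product]
  set N₁ := N.filter (· ≤ c) with hN₁
  set N₂ := N.filter (c ≤ ·) with hN₂
  have hcard : ({a, c, b} : Finset (Fin n)).card = 3 :=
    Finset.card_eq_three.2 ⟨a, c, b, hac.ne, (hac.trans hcb).ne, hcb.ne, rfl⟩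
  have hnot1 : ¬ ({a, c, b} : Finset (Fin n)) ⊆ N₁ := fun h => by
    have := h (by simp : b ∈ ({a, c, b} : Finset (Fin n)))
    simp only [hN₁, Finset.mem_filter] at this
    lia
  have hnot2 : ¬ ({a, c, b} : Finset (Fin n)) ⊆ N₂ := fun h => by
    have := h (by simp : a ∈ ({a, c, b} : Finset (Fin n)))
    simp only [hN₂, Finset.mem_filter] at this
    lia
  have hboth : ∀ t : Finset (Fin n), t.card = 3 → t ⊆ N₁ → ¬ t ⊆ N₂ := by
    intro t ht h1 h2
    have : t ⊆ {c} := fun x hx => by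
      have h3 := (Finset.mem_filter.1 (h1 hx)).2
      have h4 := (Finset.mem_filter.1 (h2 hx)).2
      exact Finset.mem_singleton.2 (le_antisymm h3 h4)
    have := Finset.card_le_card this
    simp [ht] at this
  have hsum : ∀ X₁ X₂ : Finset (Finset (Fin n)), (∀ t ∈ X₁, t.card = 3 ∧ t ⊆ N₁) →
      (∀ t ∈ X₂, t.card = 3 ∧ t ⊆ N₂) → ∀ u w, ∑ t ∈ insert {a, c, b} (X₁ ∪ X₂), bd t u w =
        bd {a, c, b} u w + (∑ t ∈ X₁, bd t u w + ∑ t ∈ X₂, bd t u w) := by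
    intro X₁ X₂ h1 h2 u w
    rw [Finset.sum_insert, Finset.sum_union]
    · rw [Finset.disjoint_left]
      exact fun t ht1 ht2 => hboth t (h1 t ht1).1 (h1 t ht1).2 (h2 t ht2).2
    · rw [Finset.mem_union]
      rintro (h | h)
      · exact hnot1 (h1 _ h).2
      · exact hnot2 (h2 _ h).2
  have hXeq : ∀ X, IsTriang N X → {a, c, b} ∈ X →
      X = insert {a, c, b} (X.filter (· ⊆ N₁) ∪ X.filter (· ⊆ N₂)) := by
    intro X hX hX0
    -- A triangle with vertices on both sides of `c`, other than `a c b` itself, would have an edge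
    -- that crosses `a c` or `c b`, or be crossed by one of these.
    have hdec : ∀ t ∈ X, t = {a, c, b} ∨ t ⊆ N₁ ∨ t ⊆ N₂ := by
      intro t ht
      by_contra hn
      push Not at hn
      obtain ⟨hn0, hn1, hn2⟩ := hn
      obtain ⟨z, hz, hz1⟩ := Finset.not_subset.1 hn1
      obtain ⟨x, hx, hx1⟩ := Finset.not_subset.1 hn2
      have hzN := hX.subset ht hz
      have hxN := hX.subset ht hx
      have hcz : c < z := by simpa [hN₁, hzN] using hz1
      have hxc : x < c := by simpa [hN₂, hxN] using hx1
      have hax := hmin x hxN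
      have hzb := hmax z hzN
      by_cases hxa : x = a
      · by_cases hzb' : z = b
        · subst hxa hzb'
          obtain ⟨y, hyx, hyz, rfl⟩ := exists_third (hX.1 t ht) hx hz (hac.trans hcb).ne
          have hyN := hX.subset ht (by simp : y ∈ ({x, z, y} : Finset (Fin n)))
          have h1 := hmin y hyN
          have h2 := hmax y hyN
          have hyc : y ≠ c := by
            rintro rfl
            exact hn0 (by rw [Finset.pair_comm])
          rcases lt_or_gt_of_ne hyc with h3 | h3
          · exact hX.noncrossing hp (a := x) (x := y) (c := c) (y := z) (Or.inl ⟨by lia, h3⟩)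
              (Or.inl ⟨hac, hcb⟩) hX0 (by simp) (by simp) ht (by simp) (by simp)
          · exact hX.noncrossing hp (a := x) (x := c) (c := y) (y := z) (Or.inl ⟨hac, h3⟩)
              (Or.inl ⟨by lia, by lia⟩) ht (by simp) (by simp) hX0 (by simp) (by simp)
        · subst hxa
          exact hX.noncrossing hp (a := x) (x := c) (c := z) (y := b) (Or.inl ⟨hac, hcz⟩)
            (Or.inl ⟨by lia, by lia⟩) ht hx hz hX0 (by simp) (by simp)
      · exact hX.noncrossing hp (a := a) (x := x) (c := c) (y := z) (Or.inl ⟨by lia, hxc⟩)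
            (Or.inl ⟨hac, hcz⟩) hX0 (by simp) (by simp) ht hx hz
    ext t
    simp only [Finset.mem_insert, Finset.mem_union, Finset.mem_filter]
    constructor
    · intro ht
      rcases hdec t ht with h | h | h
      · exact Or.inl h
      · exact Or.inr (Or.inl ⟨ht, h⟩)
      · exact Or.inr (Or.inr ⟨ht, h⟩)
    · rintro (rfl | h | h)
      · exact hX0
      · exact h.1
      · exact h.1
  symm
  refine Finset.card_nbij' (fun q => insert {a, c, b} (q.1 ∪ q.2))
    (fun X => (X.filter (· ⊆ N₁), X.filter (· ⊆ N₂))) ?_ ?_ ?_ ?_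
  · rintro ⟨X₁, X₂⟩ hq
    rw [Finset.mem_coe, Finset.mem_product, mem_triangs, mem_triangs] at hq
    obtain ⟨h1, h2⟩ := hq
    rw [Finset.mem_coe, Finset.mem_filter, mem_triangs]
    refine ⟨⟨fun t ht => ?_, fun u w => ?_⟩, Finset.mem_insert_self _ _⟩
    · rcases Finset.mem_insert.1 ht with rfl | ht
      · exact hcard
      · rcases Finset.mem_union.1 ht with ht | ht
        · exact h1.1 t ht
        · exact h2.1 t ht
    · dsimp only
      rw [hsum X₁ X₂ (fun t ht => ⟨h1.1 t ht, h1.subset ht⟩)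
        (fun t ht => ⟨h2.1 t ht, h2.subset ht⟩), h1.2, h2.2,
        bd_split ha hb hc hac hcb hmin hmax u w]
      ring
  · intro X hX
    rw [Finset.mem_coe, Finset.mem_filter, mem_triangs] at hX
    obtain ⟨hX, hX0⟩ := hX
    -- The equation for the whole polygon gives only the sum of the equations for its two parts.
    -- They separate because the parts share only the vertex `c`, so no edge with different ends
    -- belongs to both.
    have key : ∀ u w, ∑ t ∈ X.filter (· ⊆ N₁), bd t u w + ∑ t ∈ X.filter (· ⊆ N₂), bd t u w =
        bd N₁ u w + bd N₂ u w := by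
      intro u w
      have h1 := hX.2 u w
      rw [hXeq X hX hX0, hsum (X.filter (· ⊆ N₁)) (X.filter (· ⊆ N₂))
        (fun t ht => ⟨hX.1 t (Finset.mem_filter.1 ht).1, (Finset.mem_filter.1 ht).2⟩)
        (fun t ht => ⟨hX.1 t (Finset.mem_filter.1 ht).1, (Finset.mem_filter.1 ht).2⟩),
        bd_split ha hb hc hac hcb hmin hmax u w] at h1
      lia
    have hz : ∀ (M t : Finset (Fin n)) (u w : Fin n), t ⊆ M → ¬ (u ∈ M ∧ w ∈ M) →
        bd t u w = 0 := by
      intro M t u w ht hn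
      by_cases hu : u ∈ t
      · exact bd_of_notMem_right (fun hw => hn ⟨ht hu, ht hw⟩) u
      · exact bd_of_notMem_left hu w
    have hz' : ∀ (M : Finset (Fin n)) (u w : Fin n), ¬ (u ∈ M ∧ w ∈ M) →
        ∑ t ∈ X.filter (· ⊆ M), bd t u w = 0 := fun M u w hn =>
      Finset.sum_eq_zero fun t ht => hz M t u w (Finset.mem_filter.1 ht).2 hn
    have h12 : ∀ u w, u ∈ N₁ ∧ w ∈ N₁ → u ∈ N₂ ∧ w ∈ N₂ → u = w := by
      intro u w h1 h2
      simp only [hN₁, hN₂, Finset.mem_filter] at h1 h2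
      lia
    rw [Finset.mem_coe, Finset.mem_product, mem_triangs, mem_triangs]
    refine ⟨⟨fun t ht => hX.1 t (Finset.mem_filter.1 ht).1, fun u w => ?_⟩,
      ⟨fun t ht => hX.1 t (Finset.mem_filter.1 ht).1, fun u w => ?_⟩⟩
    · have := key u w
      by_cases huw : u = w
      · subst huw
        simp [bd_self]
      by_cases h1 : u ∈ N₁ ∧ w ∈ N₁
      · have h2 : ¬ (u ∈ N₂ ∧ w ∈ N₂) := fun h2 => huw (h12 u w h1 h2)
        rw [hz' N₂ u w h2, hz N₂ N₂ u w subset_rfl h2] at this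
        simpa using this
      · rw [hz N₁ N₁ u w subset_rfl h1]
        exact hz' N₁ u w h1
    · have := key u w
      by_cases huw : u = w
      · subst huw
        simp [bd_self]
      by_cases h1 : u ∈ N₂ ∧ w ∈ N₂
      · have h2 : ¬ (u ∈ N₁ ∧ w ∈ N₁) := fun h2 => huw (h12 u w h2 h1)
        rw [hz' N₁ u w h2, hz N₁ N₁ u w subset_rfl h2] at this
        simpa using this
      · rw [hz N₂ N₂ u w subset_rfl h1]
        exact hz' N₂ u w h1
  · rintro ⟨X₁, X₂⟩ hq
    rw [Finset.mem_coe, Finset.mem_product, mem_triangs, mem_triangs] at hq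
    obtain ⟨h1, h2⟩ := hq
    dsimp only at h1 h2 ⊢
    rw [Prod.mk.injEq]
    constructor
    · ext t
      simp only [Finset.mem_filter, Finset.mem_insert, Finset.mem_union]
      constructor
      · rintro ⟨rfl | h | h, ht⟩
        · exact absurd ht hnot1
        · exact h
        · exact absurd (h2.subset h) (hboth t (h2.1 t h) ht)
      · intro h
        exact ⟨Or.inr (Or.inl h), h1.subset h⟩
    · ext t
      simp only [Finset.mem_filter, Finset.mem_insert, Finset.mem_union]
      constructor
      · rintro ⟨rfl | h | h, ht⟩
        · exact absurd ht hnot2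
        · exact absurd ht (hboth t (h1.1 t h) (h1.subset h))
        · exact h
      · intro h
        exact ⟨Or.inr (Or.inr h), h2.subset h⟩
  · intro X hX
    rw [Finset.mem_coe, Finset.mem_filter, mem_triangs] at hX
    exact (hXeq X hX.1 hX.2).symm

/-- A convex polygon with `m + 2` vertices has `catalan m` triangulations. -/
theorem card_triangs (hp : IsCcw p) (m : ℕ) : ∀ N : Finset (Fin n), N.card = m + 2 →
    (triangs N).card = catalan m := by
  classical
  induction m using Nat.strong_induction_on with
  | _ m ih =>
  intro N hN
  rcases m with _ | m
  · rw [triangs_pair hN]; simp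
  have hne : N.Nonempty := Finset.card_pos.1 (by lia)
  obtain ⟨a, ha, hmin⟩ := N.exists_min_image id hne
  obtain ⟨b, hb, hmax⟩ := N.exists_max_image id hne
  simp only [id] at hmin hmax
  have hab : a < b := by
    obtain ⟨x, hx, hxa⟩ := Finset.exists_mem_ne (by lia : 1 < N.card) a
    have := hmin x hx
    have := hmax x hx
    lia
  set I := N.filter fun x => a < x ∧ x < b with hI
  have hIN : ∀ c ∈ I, c ∈ N ∧ a < c ∧ c < b := fun c hc => by simpa [hI] using hc
  have hNI : N = insert a (insert b I) := by
    ext x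
    simp only [Finset.mem_insert, hI, Finset.mem_filter]
    constructor
    · intro hx
      have := hmin x hx
      have := hmax x hx
      by_cases h1 : x = a
      · exact Or.inl h1
      by_cases h2 : x = b
      · exact Or.inr (Or.inl h2)
      exact Or.inr (Or.inr ⟨hx, by lia, by lia⟩)
    · rintro (rfl | rfl | h)
      · exact ha
      · exact hb
      · exact h.1
  have hIcard : I.card = m + 1 := by
    rw [hNI, Finset.card_insert_of_notMem (by simp [hI, hab.ne]),
      Finset.card_insert_of_notMem (by simp [hI])] at hN
    lia
  -- The edge from the last vertex `b` back to the first vertex `a` has coefficient one in the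
  -- boundary, and every triangle on it contributes one, so there is exactly one such triangle.
  have hapex : ∀ X ∈ triangs N, ∃ c ∈ I, {a, c, b} ∈ X ∧ ∀ d ∈ I, {a, d, b} ∈ X → d = c := by
    intro X hX
    rw [mem_triangs] at hX
    have h1 := hX.2 b a
    have hbd : bd N b a = 1 := by
      obtain ⟨c, hc⟩ := Finset.card_pos.1 (by rw [hIcard]; lia : 0 < I.card)
      rw [bd, if_pos, if_neg, sub_zero]
      · intro h
        exact h.2.2.2 c (hIN c hc).1 (Or.inl (hIN c hc).2)
      · rw [isSucc_iff_of_gt hab]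
        exact ⟨ha, hb, fun x hx => ⟨hmin x hx, hmax x hx⟩⟩
    have hthird : ∀ t ∈ X, a ∈ t → b ∈ t → ∃ c ∈ I, t = {a, c, b} := by
      intro t ht hat hbt
      obtain ⟨c, hca, hcb, rfl⟩ := exists_third (hX.1 t ht) hat hbt hab.ne
      have hcN := hX.subset ht (by simp : c ∈ ({a, b, c} : Finset (Fin n)))
      have := hmin c hcN
      have := hmax c hcN
      exact ⟨c, by simp only [hI, Finset.mem_filter]; exact ⟨hcN, by lia, by lia⟩,
        by rw [Finset.pair_comm]⟩
    have hone : ∀ c ∈ I, bd {a, c, b} b a = 1 := by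
      intro c hc
      have : ({a, c, b} : Finset (Fin n)) = {b, a, c} := by ext; simp; tauto
      rw [this]
      exact bd_triple (Or.inr (Or.inl (hIN c hc).2))
    rw [hbd] at h1
    obtain ⟨t, ht, hne⟩ := Finset.exists_ne_zero_of_sum_ne_zero (by rw [h1]; norm_num)
    have hat : a ∈ t := by
      by_contra h
      exact hne (bd_of_notMem_right h b)
    have hbt : b ∈ t := by
      by_contra h
      exact hne (bd_of_notMem_left h a)
    obtain ⟨c, hc, rfl⟩ := hthird t ht hat hbt
    refine ⟨c, hc, ht, fun d hd hdX => ?_⟩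
    by_contra hdc
    have hne' : ({a, d, b} : Finset (Fin n)) ≠ {a, c, b} := by
      intro h
      have : d ∈ ({a, c, b} : Finset (Fin n)) := by rw [← h]; simp
      simp only [Finset.mem_insert, Finset.mem_singleton] at this
      have := hIN d hd
      lia
    have h2 : ∑ t ∈ {({a, d, b} : Finset (Fin n)), {a, c, b}}, bd t b a ≤ ∑ t ∈ X, bd t b a := by
      refine Finset.sum_le_sum_of_subset_of_nonneg
        (by simp [Finset.insert_subset_iff, ht, hdX]) fun s hs _ => ?_
      by_cases h3 : a ∈ s
      · by_cases h4 : b ∈ s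
        · obtain ⟨e, he, rfl⟩ := hthird s hs h3 h4
          rw [hone e he]; norm_num
        · rw [bd_of_notMem_left h4]
      · rw [bd_of_notMem_right h3]
    rw [Finset.sum_pair hne', hone d hd, hone c hc, h1] at h2
    norm_num at h2
  have hunion : triangs N = I.biUnion fun c => (triangs N).filter fun X => {a, c, b} ∈ X := by
    ext X
    simp only [Finset.mem_biUnion, Finset.mem_filter]
    constructor
    · intro hX
      obtain ⟨c, hc, hcX, -⟩ := hapex X hX
      exact ⟨c, hc, hX, hcX⟩
    · rintro ⟨c, -, hX, -⟩
      exact hX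
  rw [hunion, Finset.card_biUnion]
  · have hterm : ∀ c ∈ I, ((triangs N).filter fun X => {a, c, b} ∈ X).card =
        catalan (I.filter (· < c)).card * catalan (m - (I.filter (· < c)).card) := by
      intro c hc
      obtain ⟨hcN, hac, hcb⟩ := hIN c hc
      rw [card_triangs_filter_mem hp ha hb hcN hac hcb hmin hmax]
      have hI1 : (N.filter (· ≤ c)) = insert a (insert c (I.filter (· < c))) := by
        ext x
        simp only [Finset.mem_filter, Finset.mem_insert, hI]
        constructor
        · rintro ⟨hx, hxc⟩
          have := hmin x hx
          by_cases h1 : x = a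
          · exact Or.inl h1
          by_cases h2 : x = c
          · exact Or.inr (Or.inl h2)
          exact Or.inr (Or.inr ⟨⟨hx, by lia, by lia⟩, by lia⟩)
        · rintro (rfl | rfl | h)
          · exact ⟨ha, hac.le⟩
          · exact ⟨hcN, le_rfl⟩
          · exact ⟨h.1.1, h.2.le⟩
      have hI2 : (N.filter (c ≤ ·)) = insert b (insert c (I.filter (c < ·))) := by
        ext x
        simp only [Finset.mem_filter, Finset.mem_insert, hI]
        constructor
        · rintro ⟨hx, hxc⟩
          have := hmax x hx
          by_cases h1 : x = b
          · exact Or.inl h1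
          by_cases h2 : x = c
          · exact Or.inr (Or.inl h2)
          exact Or.inr (Or.inr ⟨⟨hx, by lia, by lia⟩, by lia⟩)
        · rintro (rfl | rfl | h)
          · exact ⟨hb, hcb.le⟩
          · exact ⟨hcN, le_rfl⟩
          · exact ⟨h.1.1, h.2.le⟩
      have hI3 : I = insert c (I.filter (· < c) ∪ I.filter (c < ·)) := by
        ext x
        simp only [Finset.mem_insert, Finset.mem_union, Finset.mem_filter]
        constructor
        · intro hx
          rcases lt_trichotomy x c with h | h | h
          · exact Or.inr (Or.inl ⟨hx, h⟩)
          · exact Or.inl h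
          · exact Or.inr (Or.inr ⟨hx, h⟩)
        · rintro (rfl | h | h)
          · exact hc
          · exact h.1
          · exact h.1
      have hI4 : (I.filter (· < c)).card + (I.filter (c < ·)).card = m := by
        have h1 : I.card = (insert c (I.filter (· < c) ∪ I.filter (c < ·))).card :=
          congrArg _ hI3
        rw [Finset.card_insert_of_notMem (by simp), Finset.card_union_of_disjoint, hIcard] at h1
        · lia
        · rw [Finset.disjoint_left]
          intro x hx hx'
          exact lt_asymm (Finset.mem_filter.1 hx).2 (Finset.mem_filter.1 hx').2
      -- Each part has as vertices its interior points together with `c` and one end of the base,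
      -- hence two more than the index of its Catalan number.
      rw [ih (I.filter (· < c)).card (by lia) _ (by
          rw [hI1, Finset.card_insert_of_notMem (by simp [hI, hac.ne]),
            Finset.card_insert_of_notMem (by simp)]),
        ih (I.filter (c < ·)).card (by lia) _ (by
          rw [hI2, Finset.card_insert_of_notMem (by simp [hI, hcb.ne']),
            Finset.card_insert_of_notMem (by simp)])]
      congr 2
      lia
    rw [Finset.sum_congr rfl hterm, sum_card_filter_lt I fun i => catalan i * catalan (m - i),
      hIcard, catalan_succ, Finset.sum_range]
  · intro c hc d hd hcd
    rw [Function.onFun, Finset.disjoint_left]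
    intro X hX hX'
    obtain ⟨hX, hcX⟩ := Finset.mem_filter.1 hX
    obtain ⟨-, hdX⟩ := Finset.mem_filter.1 hX'
    obtain ⟨e, -, -, he⟩ := hapex X hX
    exact hcd ((he c hc hcX).trans (he d hd hdX).symm)

end

/-! ### The neighbours of a vertex of a triangulation -/

section

variable {n : ℕ}

open Classical in
/-- The vertices that are joined to `i` by an edge of `T`. -/
noncomputable def nbrs (T : Finset (Finset (Fin n))) (i : Fin n) : Finset (Fin n) :=
  Finset.univ.filter fun j => j ≠ i ∧ ∃ t ∈ T, i ∈ t ∧ j ∈ t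

lemma mem_nbrs {T : Finset (Finset (Fin n))} {i j : Fin n} :
    j ∈ nbrs T i ↔ j ≠ i ∧ ∃ t ∈ T, i ∈ t ∧ j ∈ t := by simp [nbrs]

/-- Without a triangle on the left of `i j`, all contributions to the coefficient of `i j` would be
nonpositive, and negative for an edge of `T`. In the boundary the coefficient is one on a side and
not negative here. -/
lemma IsTriang.exists_left {N : Finset (Fin n)} {T : Finset (Finset (Fin n))} (h : IsTriang N T)
    {i j : Fin n} (hj : j ∈ nbrs T i ∨ IsSucc N i j) (hs : ¬ IsSucc N j i) :
    ∃ m, CyclicLT i j m ∧ {i, j, m} ∈ T := by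
  by_contra hn
  push Not at hn
  have hsum := h.2 i j
  have hji : j ≠ i := hj.elim (fun h => (mem_nbrs.1 h).1) fun h => h.2.2.1.symm
  have hneg : ∀ t ∈ T, i ∈ t → j ∈ t → bd t i j = -1 := by
    intro t ht hi hj
    obtain ⟨m, hmi, hmj, rfl⟩ := exists_third (h.1 t ht) hi hj hji.symm
    refine bd_triple_neg ((CyclicLT.total hji.symm hmj.symm hmi.symm).resolve_left fun h => ?_)
    exact hn m h ht
  have hle : ∀ t ∈ T, bd t i j ≤ 0 := by
    intro t ht
    by_cases hi : i ∈ t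
    · by_cases hj : j ∈ t
      · rw [hneg t ht hi hj]; norm_num
      · rw [bd_of_notMem_right hj]
    · rw [bd_of_notMem_left hi]
  rw [bd, if_neg hs, sub_zero] at hsum
  rcases hj with hj | hj
  · obtain ⟨-, t, ht, hit, hjt⟩ := mem_nbrs.1 hj
    have := Finset.sum_lt_sum hle ⟨t, ht, by rw [hneg t ht hit hjt]; norm_num⟩
    rw [hsum, Finset.sum_const_zero] at this
    split_ifs at this <;> lia
  · have := Finset.sum_nonpos hle
    rw [hsum, if_pos hj] at this
    norm_num at this

lemma IsTriang.exists_right {N : Finset (Fin n)} {T : Finset (Finset (Fin n))} (h : IsTriang N T)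
    {i j : Fin n} (hj : j ∈ nbrs T i ∨ IsSucc N j i) (hs : ¬ IsSucc N i j) :
    ∃ m, CyclicLT i m j ∧ {i, j, m} ∈ T := by
  have hj' : i ∈ nbrs T j ∨ IsSucc N j i := by
    refine hj.imp_left fun hj => ?_
    obtain ⟨h1, t, ht, h2, h3⟩ := mem_nbrs.1 hj
    exact mem_nbrs.2 ⟨h1.symm, t, ht, h3, h2⟩
  obtain ⟨m, hm, ht⟩ := h.exists_left hj' hs
  exact ⟨m, hm.rotate, by rwa [Finset.insert_comm]⟩

lemma IsTriang.succ_mem_nbrs {N : Finset (Fin n)} {T : Finset (Finset (Fin n))} (h : IsTriang N T)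
    {i j : Fin n} (hj : IsSucc N i j) (hs : ¬ IsSucc N j i) : j ∈ nbrs T i := by
  obtain ⟨m, -, ht⟩ := h.exists_left (Or.inr hj) hs
  exact mem_nbrs.2 ⟨hj.2.2.1.symm, _, ht, by simp, by simp⟩

lemma IsTriang.pred_mem_nbrs {N : Finset (Fin n)} {T : Finset (Finset (Fin n))} (h : IsTriang N T)
    {i j : Fin n} (hj : IsSucc N j i) (hs : ¬ IsSucc N i j) : j ∈ nbrs T i := by
  obtain ⟨m, -, ht⟩ := h.exists_right (Or.inr hj) hs
  exact mem_nbrs.2 ⟨hj.2.2.1, _, ht, by simp, by simp⟩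

lemma IsSucc.not_swap {N : Finset (Fin n)} (hN : 3 ≤ N.card) {i j : Fin n} (h : IsSucc N i j) :
    ¬ IsSucc N j i := by
  intro h'
  obtain ⟨c, hc, h1, h2⟩ := exists_mem_ne_ne hN i j
  rcases CyclicLT.total h.2.2.1 h2.symm h1.symm with h3 | h3
  · exact h'.2.2.2 c hc h3.rotate
  · exact h.2.2.2 c hc h3

variable {p : Fin n → ℰ}

/-- Consecutive neighbours of `i` either span a triangle with `i`, or `i` lies between them and they
are its neighbours on the polygon. For the first, the apex of the triangle to the left of `i j`
cannot come before `k`, as it is a neighbour of `i`, nor after `k`, as its edge to `j` would cross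
`i k`. -/
lemma IsTriang.isSucc_nbrs_iff (hp : IsCcw p) (hn : 3 ≤ n) {T : Finset (Finset (Fin n))}
    (h : IsTriang Finset.univ T) {i j k : Fin n} (hj : j ≠ i) (hk : k ≠ i) (hjk : j ≠ k) :
    IsSucc (nbrs T i) j k ↔ ({i, j, k} ∈ T ∧ CyclicLT i j k) ∨
      (IsSucc Finset.univ j i ∧ IsSucc Finset.univ i k) := by
  have hU : 3 ≤ (Finset.univ : Finset (Fin n)).card := by simpa using hn
  rcases CyclicLT.total hj.symm hjk hk.symm with hc | hc
  · constructor
    · intro hs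
      left
      obtain ⟨m, hm, hmT⟩ := h.exists_left (Or.inl hs.1)
        (fun h' => h'.2.2.2 k (Finset.mem_univ _) hc.rotate)
      have hmN : m ∈ nbrs T i := mem_nbrs.2 ⟨hm.ne.2.2.symm, _, hmT, by simp, by simp⟩
      by_cases hmk : m = k
      · subst hmk
        exact ⟨hmT, hm⟩
      · exfalso
        have h1 := hs.2.2.2 m hmN
        obtain ⟨-, t, ht, hit, hkt⟩ := mem_nbrs.1 hs.2.1
        have h2 : CyclicLT i k m := by unfold CyclicLT at *; lia
        exact h.noncrossing hp hc h2 ht hit hkt hmT (by simp) (by simp)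
    · rintro (⟨hT, -⟩ | ⟨h1, -⟩)
      · refine ⟨mem_nbrs.2 ⟨hj, _, hT, by simp, by simp⟩,
          mem_nbrs.2 ⟨hk, _, hT, by simp, by simp⟩, hjk, fun m hm hcyc => ?_⟩
        obtain ⟨-, t, ht, hit, hmt⟩ := mem_nbrs.1 hm
        exact h.noncrossing hp (a := i) (x := j) (c := m) (y := k)
          (by unfold CyclicLT at *; lia) (by unfold CyclicLT at *; lia) ht hit hmt hT
          (by simp) (by simp)
      · exact absurd hc.rotate (h1.2.2.2 k (Finset.mem_univ _))
  · constructor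
    · intro hs
      right
      constructor
      · by_contra h'
        obtain ⟨m, hm, hmT⟩ := h.exists_left (Or.inl hs.1) h'
        have hmN : m ∈ nbrs T i := mem_nbrs.2 ⟨hm.ne.2.2.symm, _, hmT, by simp, by simp⟩
        exact hs.2.2.2 m hmN (by unfold CyclicLT at *; lia)
      · by_contra h'
        obtain ⟨m, hm, hmT⟩ := h.exists_right (Or.inl hs.2.1) h'
        have hmN : m ∈ nbrs T i := mem_nbrs.2 ⟨hm.ne.1.symm, _, hmT, by simp, by simp⟩
        exact hs.2.2.2 m hmN (by unfold CyclicLT at *; lia)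
    · rintro (⟨-, h1⟩ | ⟨h1, h2⟩)
      · exact absurd hc h1.asymm
      · refine ⟨h.pred_mem_nbrs h1 (h1.not_swap hU), h.succ_mem_nbrs h2 (h2.not_swap hU), hjk,
          fun m hm hcyc => ?_⟩
        have hmi := (mem_nbrs.1 hm).1
        have h3 := h1.2.2.2 m (Finset.mem_univ _)
        have h4 := h2.2.2.2 m (Finset.mem_univ _)
        unfold CyclicLT at *
        lia

/-- Deleting a vertex of the polygon creates only one new side, the one that joins its two
neighbours. -/
lemma isSucc_erase_iff {i j k : Fin n} (hj : j ≠ i) (hk : k ≠ i) (hjk : j ≠ k) :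
    IsSucc (Finset.univ.erase i) j k ↔ IsSucc Finset.univ j k ∨
      (IsSucc Finset.univ j i ∧ IsSucc Finset.univ i k) := by
  simp only [IsSucc, Finset.mem_erase, Finset.mem_univ, and_true, true_and, forall_const]
  constructor
  · rintro ⟨-, -, -, h⟩
    by_cases hc : CyclicLT j i k
    · right
      refine ⟨⟨hj, fun c h1 => ?_⟩, hk.symm, fun c h1 => ?_⟩
      · exact h c (by unfold CyclicLT at *; lia) (by unfold CyclicLT at *; lia)
      · exact h c (by unfold CyclicLT at *; lia) (by unfold CyclicLT at *; lia)
    · left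
      refine ⟨hjk, fun c h1 => ?_⟩
      by_cases hci : c = i
      · exact hc (hci ▸ h1)
      · exact h c hci h1
  · rintro (⟨-, h⟩ | ⟨⟨-, h1⟩, -, h2⟩)
    · exact ⟨hj, hk, hjk, fun c _ => h c⟩
    · refine ⟨hj, hk, hjk, fun c hci h3 => ?_⟩
      have h4 := h1 c
      have h5 := h2 c
      unfold CyclicLT at *
      lia

/-- The boundary of the polygon spanned by the neighbours of `i` consists of the link of `i` and of
the edge between the two neighbours of `i` on the polygon. -/
lemma IsTriang.bd_nbrs (hp : IsCcw p) (hn : 3 ≤ n) {T : Finset (Finset (Fin n))}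
    (h : IsTriang Finset.univ T) {i j k : Fin n} (hj : j ≠ i) (hk : k ≠ i) (hjk : j ≠ k) :
    bd (nbrs T i) j k = (if {i, j, k} ∈ T then bd {i, j, k} j k else 0) +
      (bd (Finset.univ.erase i) j k - bd Finset.univ j k) := by
  classical
  have e1 : ∀ {j k : Fin n}, j ≠ i → k ≠ i → j ≠ k →
      ¬ (({i, j, k} ∈ T ∧ CyclicLT i j k) ∧
        (IsSucc Finset.univ j i ∧ IsSucc Finset.univ i k)) := by
    rintro j k hj hk hjk ⟨⟨-, h1⟩, h2, -⟩
    exact h2.2.2.2 k (Finset.mem_univ _) h1.rotate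
  have e2 : ∀ {j k : Fin n}, j ≠ i → k ≠ i → j ≠ k →
      ¬ (IsSucc Finset.univ j k ∧ (IsSucc Finset.univ j i ∧ IsSucc Finset.univ i k)) := by
    rintro j k hj hk hjk ⟨h1, h2, -⟩
    exact hk (h1.unique h2)
  have e3 : (if {i, j, k} ∈ T then bd {i, j, k} j k else 0) =
      (if {i, j, k} ∈ T ∧ CyclicLT i j k then (1 : ℤ) else 0) -
        (if {i, k, j} ∈ T ∧ CyclicLT i k j then 1 else 0) := by
    rw [show ({i, k, j} : Finset (Fin n)) = {i, j, k} by rw [Finset.pair_comm]]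
    by_cases hT : {i, j, k} ∈ T
    · have hrot : ({i, j, k} : Finset (Fin n)) = {j, k, i} := by ext; simp; tauto
      rcases CyclicLT.total hj.symm hjk hk.symm with hc | hc
      · simp only [hT, hc, hc.asymm, if_true, and_true, and_false, if_false, sub_zero]
        rw [hrot, bd_triple hc.rotate]
      · simp only [hT, hc, hc.asymm, if_true, and_true, and_false, if_false]
        rw [hrot, bd_triple_neg hc.rotate.rotate]
        norm_num
    · simp [hT]
  rw [e3, bd, bd, bd, if_congr (h.isSucc_nbrs_iff hp hn hj hk hjk) rfl rfl,
    if_congr (h.isSucc_nbrs_iff hp hn hk hj hjk.symm) rfl rfl,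
    if_congr (isSucc_erase_iff hj hk hjk) rfl rfl,
    if_congr (isSucc_erase_iff hk hj hjk.symm) rfl rfl,
    ite_or_eq_add (e1 hj hk hjk), ite_or_eq_add (e1 hk hj hjk.symm),
    ite_or_eq_add (e2 hj hk hjk), ite_or_eq_add (e2 hk hj hjk.symm)]
  ring

lemma isSucc_univ_iff (hn : 2 ≤ n) {i j : Fin n} :
    IsSucc Finset.univ i j ↔ (i.val + 1) % n = j.val := by
  have hlt : (i.val + 1) % n < n := Nat.mod_lt _ (by lia)
  have key : IsSucc Finset.univ i ⟨(i.val + 1) % n, hlt⟩ := by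
    have hi := i.2
    rcases Nat.lt_or_ge (i.val + 1) n with h | h
    · have e : (i.val + 1) % n = i.val + 1 := Nat.mod_eq_of_lt h
      refine ⟨Finset.mem_univ _, Finset.mem_univ _, ?_, fun c _ => ?_⟩
      · rw [ne_eq, Fin.ext_iff]; simp only [e]; lia
      · simp only [CyclicLT, Fin.lt_def, e]
        lia
    · have e : (i.val + 1) % n = 0 := by
        rw [show i.val + 1 = n by lia, Nat.mod_self]
      refine ⟨Finset.mem_univ _, Finset.mem_univ _, ?_, fun c _ => ?_⟩
      · rw [ne_eq, Fin.ext_iff]; simp only [e]; lia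
      · have := c.2
        simp only [CyclicLT, Fin.lt_def, e]
        lia
  constructor
  · intro h
    exact (Fin.ext_iff.1 (h.unique key)).symm
  · intro h
    have : j = ⟨(i.val + 1) % n, hlt⟩ := Fin.ext h.symm
    rwa [this]

lemma isSide_iff (hn : 2 ≤ n) {i j : Fin n} :
    IsSide i j ↔ IsSucc Finset.univ i j ∨ IsSucc Finset.univ j i := by
  rw [isSucc_univ_iff hn, isSucc_univ_iff hn, IsSide]

open Classical in
/-- A vertex has two neighbours on the polygon, and the other neighbours give diagonals. -/
lemma IsTriang.card_nbrs (hn : 3 ≤ n) {T : Finset (Finset (Fin n))}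
    (h : IsTriang Finset.univ T) (i : Fin n) :
    (nbrs T i).card = ((nbrs T i).filter fun j => ¬ IsSide i j).card + 2 := by
  classical
  have hU : 3 ≤ (Finset.univ : Finset (Fin n)).card := by simpa using hn
  have hex : ∃ b ∈ (Finset.univ : Finset (Fin n)), b ≠ i := Finset.exists_mem_ne (by lia) i
  obtain ⟨s, hs⟩ := exists_isSucc (Finset.mem_univ i) hex
  obtain ⟨r, hr⟩ := exists_isSucc_left (Finset.mem_univ i) hex
  have hsr : s ≠ r := by
    rintro rfl
    exact hs.not_swap hU hr
  have : (nbrs T i).filter (fun j => IsSide i j) = {s, r} := by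
    ext j
    rw [Finset.mem_filter, isSide_iff (by lia : 2 ≤ n), Finset.mem_insert, Finset.mem_singleton]
    constructor
    · rintro ⟨-, hj | hj⟩
      · exact Or.inl (hj.unique hs)
      · exact Or.inr (hj.unique_left hr)
    · rintro (rfl | rfl)
      · exact ⟨h.succ_mem_nbrs hs (hs.not_swap hU), Or.inl hs⟩
      · exact ⟨h.pred_mem_nbrs hr (hr.not_swap hU), Or.inr hr⟩
  rw [← Finset.card_filter_add_card_filter_not (s := nbrs T i) (fun j => IsSide i j), this,
    Finset.card_pair hsr, add_comm]

end

/-! ### Faces of dimension at most two of the first two hypersimplices -/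

section Faces

variable {n : ℕ}

lemma point_eq_sum {E : Type*} [AddCommGroup E] [Module ℝ E] (p : Fin n → E)
    (B : Finset (Fin n)) : point p B = ∑ i ∈ B, p i := by
  simp [point, proj, cubeVertex, Fintype.linearCombination_apply, ite_smul]

lemma cubeVertex_insert {x : Fin n} {R : Finset (Fin n)} (h : x ∉ R) :
    cubeVertex (insert x R) = cubeVertex {x} + cubeVertex R := by
  ext i
  by_cases hi : i = x
  · subst hi; simp [cubeVertex, h]
  · simp [cubeVertex, hi]

lemma cubeVertex_eq_sum (B : Finset (Fin n)) : cubeVertex B = ∑ i ∈ B, cubeVertex {i} := by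
  induction B using Finset.induction_on with
  | empty => ext; simp [cubeVertex]
  | insert x R h ih => rw [cubeVertex_insert h, Finset.sum_insert h, ih]

lemma isFace_cubeVertex_iff {C L : Finset (Finset (Fin n))} :
    IsFace cubeVertex C L ↔ C.Nonempty ∧ ∃ w : Fin n → ℝ, ∀ B, B ∈ C ↔
      B ∈ L ∧ ∀ B' ∈ L, ∑ i ∈ B, w i ≤ ∑ i ∈ B', w i := by
  refine and_congr_right fun _ => ⟨?_, ?_⟩
  · rintro ⟨f, hf⟩
    have e : ∀ B, f (cubeVertex B) = ∑ i ∈ B, f (cubeVertex {i}) := fun B => by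
      rw [cubeVertex_eq_sum, map_sum]
    refine ⟨fun i => f (cubeVertex {i}), fun B => (hf B).trans ?_⟩
    exact and_congr_right fun _ => forall_congr' fun B' => forall_congr' fun _ => by rw [e B, e B']
  · rintro ⟨w, hw⟩
    refine ⟨proj w, ?_⟩
    have e : ∀ B, proj w (cubeVertex B) = ∑ i ∈ B, w i := point_eq_sum w
    simpa only [e] using hw

/-- On a simplex the values of a functional at the vertices are free up to a constant, so one can
prescribe a lower value on `D` than elsewhere. -/
lemma isFace_of_affineIndependent {V : Type*} [AddCommGroup V] [Module ℝ V]
    {v : Finset (Fin n) → V} {C D : Finset (Finset (Fin n))}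
    (h : AffineIndependent ℝ fun a : C => v a) (hD : D ⊆ C) (hne : D.Nonempty) :
    IsFace v D C := by
  classical
  obtain ⟨d, hd⟩ := hne
  refine ⟨⟨d, hd⟩, ?_⟩
  rw [affineIndependent_iff_linearIndependent_vsub ℝ _ (⟨d, hD hd⟩ : C)] at h
  let g := (Module.Basis.span h).constr ℝ
    (fun x : {x : C // x ≠ ⟨d, hD hd⟩} => if (x : Finset (Fin n)) ∈ D then (0 : ℝ) else 1)
  obtain ⟨f, hf⟩ := LinearMap.exists_extend g
  have hfx : ∀ B ∈ C, f (v B) = f (v d) + if B ∈ D then 0 else 1 := by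
    intro B hB
    by_cases hBd : B = d
    · subst hBd; simp [hd]
    · let x : {x : C // x ≠ ⟨d, hD hd⟩} := ⟨⟨B, hB⟩, fun h => hBd (congrArg Subtype.val h)⟩
      have h1 : g (Module.Basis.span h x) = if B ∈ D then 0 else 1 :=
        Module.Basis.constr_basis _ _ _ _
      rw [← hf, LinearMap.comp_apply, Submodule.subtype_apply, Module.Basis.span_apply] at h1
      have h2 : f (v B - v d) = if B ∈ D then 0 else 1 := h1
      rw [map_sub] at h2
      linarith
  refine ⟨f, fun B => ⟨fun hB => ⟨hD hB, fun B' hB' => ?_⟩, fun ⟨hB, hle⟩ => ?_⟩⟩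
  · rw [hfx B (hD hB), hfx B' hB', if_pos hB]
    split_ifs <;> linarith
  · by_contra hn
    have := hle d (hD hd)
    rw [hfx B hB, if_neg hn] at this
    linarith

lemma dim_eq_of_affineIndependent {V : Type*} [AddCommGroup V] [Module ℝ V]
    {v : Finset (Fin n) → V} {C : Finset (Finset (Fin n))} (hne : C.Nonempty)
    (h : AffineIndependent ℝ fun a : C => v a) : dim v C = C.card - 1 := by
  have := h.finrank_vectorSpan (n := C.card - 1)
    (by rw [Fintype.card_coe]; have := hne.card_pos; lia)
  rw [dim, Set.image_eq_range]
  exact this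

lemma affineIndependent_cubeVertex {V : Type*} [AddCommGroup V] [Module ℝ V] {p : Fin n → V}
    {C : Finset (Finset (Fin n))} (h : AffineIndependent ℝ fun a : C => point p a) :
    AffineIndependent ℝ fun a : C => cubeVertex (a : Finset (Fin n)) :=
  AffineIndependent.of_comp (proj p).toAffineMap h

lemma dim_point_le (p : Fin n → ℰ) (C : Finset (Finset (Fin n))) : dim (point p) C ≤ 2 := by
  have := Submodule.finrank_le (vectorSpan ℝ (point p '' (C : Set (Finset (Fin n)))))
  rwa [finrank_euclideanSpace_fin] at this

/-- Hypertriangulations are the triangulations whose cells are faces of admissible triangles. -/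
lemma isHypertriangulation_iff {p : Fin n → ℰ} {k : ℕ} {Adm : Finset (Finset (Fin n)) → Prop}
    (h1 : ∀ τ, Adm τ → IsTriangle (point p) τ)
    (h2 : ∀ τ, Adm τ → ∀ C ⊆ τ, C.Nonempty → IsFace cubeVertex C (labels n k))
    (h3 : ∀ C, IsFace cubeVertex C (labels n k) → dim cubeVertex C ≤ 2 → ∃ τ, Adm τ ∧ C ⊆ τ)
    {S : Finset (Finset (Finset (Fin n)))} :
    IsHypertriangulation p k S ↔ IsTriComplex (point p) (labels n k) S ∧
      ∀ C ∈ S, ∃ τ, Adm τ ∧ C ⊆ τ := by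
  constructor
  · intro h
    -- Fineness is used here: a cell has the dimension of its image in the plane, which is at most
    -- two.
    have hadm : ∀ C ∈ S, ∃ τ, Adm τ ∧ C ⊆ τ := fun C hC =>
      h3 C (h.induced C hC) (by rw [h.fine C hC]; exact dim_point_le p C)
    have hind : ∀ C ∈ S, AffineIndependent ℝ fun a : C => point p a := by
      intro C hC
      obtain ⟨τ, hτ, hCτ⟩ := hadm C hC
      exact AffineIndependent.of_subset (h1 τ hτ).affineIndependent hCτ
    refine ⟨⟨?_, ?_, hind, ?_, h.covers, ?_⟩, hadm⟩
    · intro C hC B hB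
      obtain ⟨-, f, hf⟩ := h.induced C hC
      exact ((hf B).1 hB).1
    · exact fun C hC => (h.induced C hC).1
    · exact fun C hC D hD hne => h.closed C hC D (isFace_of_affineIndependent (hind C hC) hD hne)
    · intro C hC D hD hne
      rw [relInt_eq_intrinsicInterior (hind C hC), relInt_eq_intrinsicInterior (hind D hD)]
      exact h.disjoint C hC D hD hne
  · rintro ⟨h, hadm⟩
    refine ⟨⟨?_, ?_, h.covers, ?_⟩, ?_⟩
    · intro C hC
      obtain ⟨τ, hτ, hCτ⟩ := hadm C hC
      exact h2 τ hτ C hCτ (h.nonempty C hC)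
    · rintro C hC D ⟨hne, f, hf⟩
      exact h.down C hC D (fun B hB => ((hf B).1 hB).1) hne
    · intro C hC D hD hne
      have := h.disjoint C hC D hD hne
      rwa [relInt_eq_intrinsicInterior (h.indep C hC),
        relInt_eq_intrinsicInterior (h.indep D hD)] at this
    · intro C hC
      rw [dim_eq_of_affineIndependent (h.nonempty C hC) (h.indep C hC),
        dim_eq_of_affineIndependent (h.nonempty C hC)
          (affineIndependent_cubeVertex (h.indep C hC))]

/-- The labels of the vertices of a triangle `t` at level one. -/
def singles (t : Finset (Fin n)) : Finset (Finset (Fin n)) := t.image fun j => {j}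

/-- The translate of the triangle `t` by the vertex `i`, at level two. -/
def white (i : Fin n) (t : Finset (Fin n)) : Finset (Finset (Fin n)) := t.image fun j => {i, j}

/-- The triangle formed by the sums of two vertices of `t`. -/
def black (t : Finset (Fin n)) : Finset (Finset (Fin n)) := t.image fun j => t.erase j

lemma mem_black {t : Finset (Fin n)} (ht : t.card = 3) {B : Finset (Fin n)} :
    B ∈ black t ↔ B.card = 2 ∧ B ⊆ t := by
  simp only [black, Finset.mem_image]
  constructor
  · rintro ⟨j, hj, rfl⟩
    exact ⟨by rw [Finset.card_erase_of_mem hj, ht], Finset.erase_subset _ _⟩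
  · rintro ⟨hB, hBt⟩
    have : (t \ B).card = 1 := by rw [Finset.card_sdiff_of_subset hBt, ht, hB]
    obtain ⟨j, hj⟩ := Finset.card_eq_one.1 this
    have hjt : j ∈ t \ B := by rw [hj]; simp
    refine ⟨j, (Finset.mem_sdiff.1 hjt).1, ?_⟩
    rw [Finset.erase_eq, ← hj, Finset.sdiff_sdiff_eq_self hBt]

/-- This bounds supports: a face whose directions include all differences of four basis vectors has
dimension at least three and cannot be a cell of a fine subdivision. -/
lemma three_le_finrank {W : Submodule ℝ (Fin n → ℝ)} {a b c d : Fin n} (hab : a ≠ b) (hac : a ≠ c)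
    (had : a ≠ d) (hbc : b ≠ c) (hbd : b ≠ d) (hcd : c ≠ d)
    (ha : cubeVertex {a} - cubeVertex {d} ∈ W) (hb : cubeVertex {b} - cubeVertex {d} ∈ W)
    (hc : cubeVertex {c} - cubeVertex {d} ∈ W) : 3 ≤ Module.finrank ℝ W := by
  let f : Fin 3 → (Fin n → ℝ) := ![cubeVertex {a} - cubeVertex {d},
    cubeVertex {b} - cubeVertex {d}, cubeVertex {c} - cubeVertex {d}]
  have hf : LinearIndependent ℝ f := by
    rw [Fintype.linearIndependent_iff]
    intro g hg
    rw [Fin.sum_univ_three] at hg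
    have ea := congrFun hg a
    have eb := congrFun hg b
    have ec := congrFun hg c
    simp only [f, cubeVertex, Pi.add_apply, Pi.smul_apply, Pi.sub_apply, Finset.mem_singleton,
      Matrix.cons_val_zero, Matrix.cons_val_one, Matrix.cons_val, hab, hac, had, hbc, hbd, hcd,
      hab.symm, hac.symm, hbc.symm, if_true, if_false, smul_eq_mul, Pi.zero_apply] at ea eb ec
    intro i
    fin_cases i
    · simpa using ea
    · simpa using eb
    · simpa using ec
  have hle : Submodule.span ℝ (Set.range f) ≤ W := by
    rw [Submodule.span_le]
    rintro _ ⟨i, rfl⟩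
    fin_cases i
    · exact ha
    · exact hb
    · exact hc
  have := Submodule.finrank_mono hle
  rwa [finrank_span_eq_card hf, Fintype.card_fin] at this

lemma sub_mem_vectorSpan_cubeVertex {C : Finset (Finset (Fin n))} {x y z : Fin n} (hzx : z ≠ x)
    (hzy : z ≠ y) (hx : {z, x} ∈ C) (hy : {z, y} ∈ C) :
    cubeVertex {x} - cubeVertex {y} ∈
      vectorSpan ℝ (cubeVertex '' (C : Set (Finset (Fin n)))) := by
  have := vsub_mem_vectorSpan ℝ (Set.mem_image_of_mem cubeVertex (Finset.mem_coe.2 hx))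
    (Set.mem_image_of_mem cubeVertex (Finset.mem_coe.2 hy))
  rw [cubeVertex_insert (by simpa using hzx), cubeVertex_insert (by simpa using hzy), vsub_eq_sub,
    add_sub_add_left_eq_sub] at this
  exact this

lemma exists_four_of_lt_card {M : Finset (Fin n)} (h : 3 < M.card) :
    ∃ a ∈ M, ∃ b ∈ M, ∃ c ∈ M, ∃ d ∈ M, a ≠ b ∧ a ≠ c ∧ a ≠ d ∧ b ≠ c ∧ b ≠ d ∧ c ≠ d := by
  obtain ⟨M', hM', hc⟩ := Finset.exists_subset_card_eq h
  obtain ⟨d, R, hd, rfl, hR⟩ := Finset.card_eq_succ.1 hc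
  obtain ⟨a, b, c, hab, hac, hbc, rfl⟩ := Finset.card_eq_three.1 hR
  simp only [Finset.mem_insert, Finset.mem_singleton, not_or] at hd
  refine ⟨a, hM' (by simp), b, hM' (by simp), c, hM' (by simp), d, hM' (by simp), hab, hac,
    Ne.symm hd.1, hbc, Ne.symm hd.2.1, Ne.symm hd.2.2⟩

lemma exists_superset_card_three (hn : 3 ≤ n) {M : Finset (Fin n)} (hM : M.card ≤ 3) :
    ∃ t : Finset (Fin n), t.card = 3 ∧ M ⊆ t := by
  obtain ⟨t, h1, -, h2⟩ := Finset.exists_subsuperset_card_eq (Finset.subset_univ M) hM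
    (by simpa using hn)
  exact ⟨t, h2, h1⟩

lemma mem_labels {k : ℕ} {B : Finset (Fin n)} : B ∈ labels n k ↔ B.card = k := by
  simp [labels, Finset.mem_powersetCard]

/-- The faces of the simplex. -/
lemma isFace_singles {t : Finset (Fin n)} {C : Finset (Finset (Fin n))} (hC : C ⊆ singles t)
    (hne : C.Nonempty) : IsFace cubeVertex C (labels n 1) := by
  classical
  rw [isFace_cubeVertex_iff]
  refine ⟨hne, fun i => if {i} ∈ C then 0 else 1, fun B => ⟨fun hB => ?_, ?_⟩⟩
  · obtain ⟨j, -, rfl⟩ := Finset.mem_image.1 (hC hB)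
    refine ⟨mem_labels.2 (by simp), fun B' _ => ?_⟩
    rw [Finset.sum_singleton, if_pos hB]
    exact Finset.sum_nonneg fun i _ => by split_ifs <;> norm_num
  · rintro ⟨hB, hle⟩
    obtain ⟨j, rfl⟩ := Finset.card_eq_one.1 (mem_labels.1 hB)
    obtain ⟨B', hB'⟩ := hne
    obtain ⟨j', -, rfl⟩ := Finset.mem_image.1 (hC hB')
    have := hle {j'} (mem_labels.2 (by simp))
    rw [Finset.sum_singleton, Finset.sum_singleton, if_pos hB'] at this
    by_contra hn
    rw [if_neg hn] at this
    norm_num at this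

lemma subset_singles_of_isFace (hn : 3 ≤ n) {C : Finset (Finset (Fin n))}
    (h : IsFace cubeVertex C (labels n 1)) (hd : dim cubeVertex C ≤ 2) :
    ∃ t : Finset (Fin n), t.card = 3 ∧ C ⊆ singles t := by
  classical
  let M : Finset (Fin n) := Finset.univ.filter fun i => {i} ∈ C
  have hM : M.card ≤ 3 := by
    by_contra hlt
    obtain ⟨a, ha, b, hb, c, hc, d, hd', h1, h2, h3, h4, h5, h6⟩ :=
      exists_four_of_lt_card (not_le.1 hlt)
    have key : ∀ x ∈ M, cubeVertex {x} - cubeVertex {d} ∈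
        vectorSpan ℝ (cubeVertex '' (C : Set (Finset (Fin n)))) := by
      intro x hx
      have hxC : {x} ∈ C := by simpa [M] using hx
      have hdC : {d} ∈ C := by simpa [M] using hd'
      exact vsub_mem_vectorSpan ℝ (Set.mem_image_of_mem cubeVertex (Finset.mem_coe.2 hxC))
        (Set.mem_image_of_mem cubeVertex (Finset.mem_coe.2 hdC))
    have := three_le_finrank h1 h2 h3 h4 h5 h6 (key a ha) (key b hb) (key c hc)
    rw [dim] at hd
    lia
  obtain ⟨t, ht, hMt⟩ := exists_superset_card_three hn hM
  refine ⟨t, ht, fun B hB => ?_⟩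
  obtain ⟨-, f, hf⟩ := h
  obtain ⟨j, rfl⟩ := Finset.card_eq_one.1 (mem_labels.1 ((hf B).1 hB).1)
  exact Finset.mem_image.2 ⟨j, hMt (by simpa [M] using hB), rfl⟩

/-- Faces of the second hypersimplex with a common element in all labels. -/
lemma isFace_star {i : Fin n} {C : Finset (Finset (Fin n))}
    (hC : ∀ B ∈ C, ∃ j, j ≠ i ∧ B = {i, j}) (hne : C.Nonempty) :
    IsFace cubeVertex C (labels n 2) := by
  classical
  rw [isFace_cubeVertex_iff]
  -- Weight `-1` forces `i` into every minimizer, and the weights `0` and `1` select its partners;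
  -- the minimum is `-1`.
  set w : Fin n → ℝ := fun j => if j = i then -1 else if {i, j} ∈ C then 0 else 1 with hw
  have hwi : w i = -1 := by simp [hw]
  have hw0 : ∀ j, j ≠ i → {i, j} ∈ C → w j = 0 := fun j h1 h2 => by simp [hw, h1, h2]
  have hw1 : ∀ j, j ≠ i → {i, j} ∉ C → w j = 1 := fun j h1 h2 => by simp [hw, h1, h2]
  have hwnn : ∀ j, j ≠ i → 0 ≤ w j := fun j h1 => by
    by_cases h2 : {i, j} ∈ C
    · rw [hw0 j h1 h2]
    · rw [hw1 j h1 h2]; norm_num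
  refine ⟨hne, w, fun B => ⟨fun hB => ?_, ?_⟩⟩
  · obtain ⟨j, hj, rfl⟩ := hC B hB
    refine ⟨mem_labels.2 (Finset.card_pair hj.symm), fun B' hB' => ?_⟩
    obtain ⟨x, y, hxy, rfl⟩ := Finset.card_eq_two.1 (mem_labels.1 hB')
    rw [Finset.sum_pair hj.symm, Finset.sum_pair hxy, hwi, hw0 j hj hB]
    by_cases hx : x = i
    · subst hx
      have := hwnn y hxy.symm
      linarith
    · have h1 := hwnn x hx
      by_cases hy : y = i
      · subst hy; linarith
      · have := hwnn y hy
        linarith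
  · rintro ⟨hB, hle⟩
    obtain ⟨B₀, hB₀⟩ := hne
    obtain ⟨j, hj, rfl⟩ := hC B₀ hB₀
    have := hle {i, j} (mem_labels.2 (Finset.card_pair hj.symm))
    rw [Finset.sum_pair hj.symm, hwi, hw0 j hj hB₀] at this
    obtain ⟨x, y, hxy, rfl⟩ := Finset.card_eq_two.1 (mem_labels.1 hB)
    rw [Finset.sum_pair hxy] at this
    by_contra hn
    by_cases hx : x = i
    · subst hx
      rw [hwi, hw1 y hxy.symm hn] at this
      linarith
    · have h1 := hwnn x hx
      by_cases hy : y = i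
      · subst hy
        rw [Finset.pair_comm] at hn
        rw [hwi, hw1 x hx hn] at this
        linarith
      · have := hwnn y hy
        linarith

lemma isFace_white {i : Fin n} {t : Finset (Fin n)} (hi : i ∉ t) {C : Finset (Finset (Fin n))}
    (hC : C ⊆ white i t) (hne : C.Nonempty) : IsFace cubeVertex C (labels n 2) := by
  refine isFace_star (i := i) (fun B hB => ?_) hne
  obtain ⟨j, hj, rfl⟩ := Finset.mem_image.1 (hC hB)
  exact ⟨j, fun h => hi (h ▸ hj), rfl⟩

/-- The whole triangle is cut out by the indicator of the complement of `t`. If `C` omits `t.erase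
x`, all remaining pairs contain `x`, and `isFace_star` applies. -/
lemma isFace_black {t : Finset (Fin n)} (ht : t.card = 3) {C : Finset (Finset (Fin n))}
    (hC : C ⊆ black t) (hne : C.Nonempty) : IsFace cubeVertex C (labels n 2) := by
  classical
  by_cases hCt : black t ⊆ C
  · obtain rfl := hC.antisymm hCt
    rw [isFace_cubeVertex_iff]
    refine ⟨hne, fun j => if j ∈ t then 0 else 1, fun B => ?_⟩
    have h0 : ∀ B : Finset (Fin n), 0 ≤ ∑ i ∈ B, (if i ∈ t then (0 : ℝ) else 1) := fun B =>
      Finset.sum_nonneg fun i _ => by split_ifs <;> norm_num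
    have h1 : ∀ B ⊆ t, ∑ i ∈ B, (if i ∈ t then (0 : ℝ) else 1) = 0 := fun B hB =>
      Finset.sum_eq_zero fun i hi => if_pos (hB hi)
    rw [mem_black ht, mem_labels]
    refine and_congr_right fun hB => ⟨fun hBt B' _ => by rw [h1 B hBt]; exact h0 B', fun hle => ?_⟩
    obtain ⟨B', hB'⟩ := hne
    rw [mem_black ht] at hB'
    have := hle B' (mem_labels.2 hB'.1)
    rw [h1 B' hB'.2] at this
    have h2 := (Finset.sum_eq_zero_iff_of_nonneg (fun i _ => by split_ifs <;> norm_num)).1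
      (le_antisymm this (h0 B))
    intro i hi
    by_contra hn
    have := h2 i hi
    rw [if_neg hn] at this
    norm_num at this
  · obtain ⟨B₀, hB₀, hn⟩ := Finset.not_subset.1 hCt
    obtain ⟨x, hx, rfl⟩ := Finset.mem_image.1 hB₀
    refine isFace_star (i := x) (fun B hB => ?_) hne
    obtain ⟨y, hy, rfl⟩ := Finset.mem_image.1 (hC hB)
    have hxy : x ≠ y := by
      rintro rfl
      exact hn hB
    obtain ⟨z, hzx, hzy, rfl⟩ := exists_third ht hx hy hxy
    refine ⟨z, hzx, ?_⟩
    ext i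
    simp only [Finset.mem_erase, Finset.mem_insert, Finset.mem_singleton]
    grind

/-- Take a minimizing pair `{a, b}` with `w a ≤ w b`. If `w a < w b`, every minimizer contains `a`,
and the face is a simplex with apex `a`. If the weights are equal, the face consists of all pairs
from the set of indices of minimal weight. The dimension bound leaves at most three indices in
either case. -/
lemma subset_black_or_white_of_isFace (hn : 3 ≤ n) {C : Finset (Finset (Fin n))}
    (h : IsFace cubeVertex C (labels n 2)) (hd : dim cubeVertex C ≤ 2) :
    ∃ t : Finset (Fin n), t.card = 3 ∧ (C ⊆ black t ∨ ∃ i ∉ t, C ⊆ white i t) := by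
  classical
  rw [isFace_cubeVertex_iff] at h
  obtain ⟨⟨B₀, hB₀⟩, w, hw⟩ := h
  obtain ⟨a, b, hab, hBab, hwab⟩ : ∃ a b, a ≠ b ∧ B₀ = {a, b} ∧ w a ≤ w b := by
    obtain ⟨a, b, hab, rfl⟩ := Finset.card_eq_two.1 (mem_labels.1 ((hw B₀).1 hB₀).1)
    rcases le_total (w a) (w b) with h | h
    · exact ⟨a, b, hab, rfl, h⟩
    · exact ⟨b, a, hab.symm, Finset.pair_comm _ _, h⟩
  subst hBab
  have hmin : ∀ x y, x ≠ y → w a + w b ≤ w x + w y := by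
    intro x y hxy
    have := ((hw _).1 hB₀).2 {x, y} (mem_labels.2 (Finset.card_pair hxy))
    rwa [Finset.sum_pair hab, Finset.sum_pair hxy] at this
  have hpair : ∀ x y, x ≠ y → ({x, y} ∈ C ↔ w x + w y = w a + w b) := by
    intro x y hxy
    rw [hw, mem_labels, Finset.card_pair hxy]
    constructor
    · rintro ⟨-, hle⟩
      have := hle {a, b} (mem_labels.2 (Finset.card_pair hab))
      rw [Finset.sum_pair hab, Finset.sum_pair hxy] at this
      exact le_antisymm this (hmin x y hxy)
    · intro he
      refine ⟨rfl, fun B' hB' => ?_⟩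
      obtain ⟨u, z, huz, rfl⟩ := Finset.card_eq_two.1 (mem_labels.1 hB')
      rw [Finset.sum_pair hxy, Finset.sum_pair huz, he]
      exact hmin u z huz
  have hge : ∀ x, x ≠ a → w b ≤ w x := fun x hx => by
    have := hmin a x hx.symm
    linarith
  have hCpair : ∀ B ∈ C, ∃ x y, x ≠ y ∧ B = {x, y} := fun B hB =>
    Finset.card_eq_two.1 (mem_labels.1 ((hw B).1 hB).1)
  rcases hwab.lt_or_eq with hlt | heq
  · let M : Finset (Fin n) := Finset.univ.filter fun x => x ≠ a ∧ w x = w b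
    have hmemM : ∀ x, x ∈ M ↔ x ≠ a ∧ w x = w b := fun x => by simp [M]
    have hCM : ∀ B ∈ C, ∃ x ∈ M, B = {a, x} := by
      intro B hB
      obtain ⟨x, y, hxy, rfl⟩ := hCpair B hB
      have he := (hpair x y hxy).1 hB
      by_cases hx : x = a
      · subst hx
        exact ⟨y, (hmemM y).2 ⟨hxy.symm, by linarith⟩, rfl⟩
      · by_cases hy : y = a
        · subst hy
          exact ⟨x, (hmemM x).2 ⟨hx, by linarith⟩, Finset.pair_comm _ _⟩
        · have := hge x hx
          have := hge y hy
          linarith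
    have hM : M.card ≤ 3 := by
      by_contra hlt
      obtain ⟨x, hx, y, hy, z, hz, d, hd', h1, h2, h3, h4, h5, h6⟩ :=
        exists_four_of_lt_card (not_le.1 hlt)
      have key : ∀ x ∈ M, cubeVertex {x} - cubeVertex {d} ∈
          vectorSpan ℝ (cubeVertex '' (C : Set (Finset (Fin n)))) := by
        intro x hx
        rw [hmemM] at hx hd'
        exact sub_mem_vectorSpan_cubeVertex hx.1.symm hd'.1.symm
          ((hpair a x hx.1.symm).2 (by rw [hx.2])) ((hpair a d hd'.1.symm).2 (by rw [hd'.2]))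
      have := three_le_finrank h1 h2 h3 h4 h5 h6 (key x hx) (key y hy) (key z hz)
      rw [dim] at hd
      lia
    have haM : a ∉ M := fun h => ((hmemM a).1 h).1 rfl
    -- With three partners the face is a white triangle. With fewer, the pairs fit into a triple
    -- that contains `a`, and the face lies in a black one.
    by_cases hM3 : M.card = 3
    · refine ⟨M, hM3, Or.inr ⟨a, haM, fun B hB => ?_⟩⟩
      obtain ⟨x, hx, rfl⟩ := hCM B hB
      exact Finset.mem_image.2 ⟨x, hx, rfl⟩
    · obtain ⟨t, ht, hMt⟩ := exists_superset_card_three hn (M := insert a M)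
        (by rw [Finset.card_insert_of_notMem haM]; lia)
      refine ⟨t, ht, Or.inl fun B hB => ?_⟩
      obtain ⟨x, hx, rfl⟩ := hCM B hB
      rw [mem_black ht]
      refine ⟨Finset.card_pair ((hmemM x).1 hx).1.symm, ?_⟩
      rw [Finset.insert_subset_iff, Finset.singleton_subset_iff]
      exact ⟨hMt (by simp), hMt (by simp [hx])⟩
  · let M : Finset (Fin n) := Finset.univ.filter fun x => w x = w b
    have hmemM : ∀ x, x ∈ M ↔ w x = w b := fun x => by simp [M]
    have hge' : ∀ x, w b ≤ w x := fun x => by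
      by_cases hx : x = a
      · rw [hx, heq]
      · exact hge x hx
    have hM : M.card ≤ 3 := by
      by_contra hlt
      obtain ⟨x, hx, y, hy, z, hz, d, hd', h1, h2, h3, h4, h5, h6⟩ :=
        exists_four_of_lt_card (not_le.1 hlt)
      have hC : ∀ x ∈ M, ∀ y ∈ M, x ≠ y → {x, y} ∈ C := fun x hx y hy hxy =>
        (hpair x y hxy).2 (by rw [(hmemM x).1 hx, (hmemM y).1 hy, heq])
      have := three_le_finrank h1 h2 h3 h4 h5 h6
        (sub_mem_vectorSpan_cubeVertex h1.symm h5 (hC y hy x hx h1.symm) (hC y hy d hd' h5))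
        (sub_mem_vectorSpan_cubeVertex h1 h3 (hC x hx y hy h1) (hC x hx d hd' h3))
        (sub_mem_vectorSpan_cubeVertex h2 h3 (hC x hx z hz h2) (hC x hx d hd' h3))
      rw [dim] at hd
      lia
    obtain ⟨t, ht, hMt⟩ := exists_superset_card_three hn hM
    refine ⟨t, ht, Or.inl fun B hB => ?_⟩
    obtain ⟨x, y, hxy, rfl⟩ := hCpair B hB
    have he := (hpair x y hxy).1 hB
    have h1 := hge' x
    have h2 := hge' y
    rw [mem_black ht, Finset.insert_subset_iff, Finset.singleton_subset_iff]
    exact ⟨Finset.card_pair hxy, hMt ((hmemM x).2 (by linarith)), hMt ((hmemM y).2 (by linarith))⟩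

end Faces

/-! ### Hypertriangulations as chains of admissible triangles; level one -/

section

variable {ι : Type*} [DecidableEq ι] {v : ι → ℰ}

lemma faces_injective_of_card {X Y : Finset (Finset ι)} (hX : ∀ t ∈ X, t.card = 3)
    (hY : ∀ t ∈ Y, t.card = 3) (h : faces X = faces Y) : X = Y := by
  have key : ∀ {X Y : Finset (Finset ι)}, (∀ t ∈ X, t.card = 3) → (∀ t ∈ Y, t.card = 3) →
      faces X = faces Y → X ⊆ Y := by
    intro X Y hX hY h t ht
    have h1 : t ∈ faces X :=
      mem_faces.2 ⟨Finset.card_pos.1 (by rw [hX t ht]; norm_num), t, ht, subset_rfl⟩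
    rw [h] at h1
    obtain ⟨-, s, hs, hts⟩ := mem_faces.1 h1
    rwa [Finset.eq_of_subset_of_card_le hts (by rw [hX t ht, hY s hs])]
  exact (key hX hY h).antisymm (key hY hX h.symm)

variable {n : ℕ} {p : Fin n → ℰ} {g : Fin n → ι} {t : Finset (Fin n)}

lemma IsTriangle.image (ht : IsTriangle p t)
    (hg : ∀ a ∈ t, ∀ b ∈ t, ∀ c ∈ t, cross (v (g a)) (v (g b)) (v (g c)) =
      cross (p a) (p b) (p c)) : IsTriangle v (t.image g) := by
  obtain ⟨a, b, c, rfl, h⟩ := ht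
  refine ⟨g a, g b, g c, ?_, ?_⟩
  · simp [Finset.image_insert]
  · rwa [hg a (by simp) b (by simp) c (by simp)]

lemma edgeSign_image (hinj : Set.InjOn g t)
    (hg : ∀ a ∈ t, ∀ b ∈ t, ∀ c ∈ t, cross (v (g a)) (v (g b)) (v (g c)) =
      cross (p a) (p b) (p c)) {a b : Fin n} (ha : a ∈ t) (hb : b ∈ t) :
    edgeSign v (t.image g) (g a) (g b) = edgeSign p t a b := by
  rw [edgeSign, edgeSign, if_pos ⟨Finset.mem_image_of_mem g ha, Finset.mem_image_of_mem g hb⟩,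
    if_pos ⟨ha, hb⟩, Finset.sum_image hinj]
  exact Finset.sum_congr rfl fun c hc => by rw [hg a ha b hb c hc]

end

section

variable {n : ℕ} {p : Fin n → ℰ}

/-- Hypertriangulations correspond to sets of admissible triangles whose boundary chain is the
boundary of the convex hull. -/
lemma isHypertriangulation_iff_exists {k : ℕ} {Adm : Finset (Finset (Fin n)) → Prop}
    (h1 : ∀ τ, Adm τ → IsTriangle (point p) τ)
    (h2 : ∀ τ, Adm τ → ∀ C ⊆ τ, C.Nonempty → IsFace cubeVertex C (labels n k))
    (h3 : ∀ C, IsFace cubeVertex C (labels n k) → dim cubeVertex C ≤ 2 → ∃ τ, Adm τ ∧ C ⊆ τ)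
    (h4 : ∀ τ, Adm τ → ∀ A ∈ τ, ∀ B ∈ τ, A ≠ B →
      (∀ C ∈ labels n k, 0 ≤ cross (point p A) (point p B) (point p C)) →
        IsHullEdge (point p) (labels n k) A B)
    (h5 : ∃ τ, Adm τ) (h6 : ∃ A B, IsHullEdge (point p) (labels n k) A B)
    {S : Finset (Finset (Finset (Fin n)))} :
    IsHypertriangulation p k S ↔ ∃ X : Finset (Finset (Finset (Fin n))), (∀ τ ∈ X, Adm τ) ∧
      (∀ A B, ∑ τ ∈ X, edgeSign (point p) τ A B = hullSign (point p) (labels n k) A B) ∧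
      S = faces X := by
  classical
  have hsub : ∀ τ, Adm τ → τ ⊆ labels n k := by
    intro τ hτ B hB
    obtain ⟨-, f, hf⟩ := h2 τ hτ {B} (by simpa using hB) (by simp)
    exact ((hf B).1 (by simp)).1
  obtain ⟨τ₀, hτ₀⟩ := h5
  have hcard : 3 ≤ (labels n k).card := by
    rw [← (h1 τ₀ hτ₀).card]
    exact Finset.card_le_card (hsub τ₀ hτ₀)
  rw [isHypertriangulation_iff h1 h2 h3]
  constructor
  · rintro ⟨h, hadm⟩
    have ht : ∃ t ⊆ labels n k, IsTriangle (point p) t := ⟨τ₀, hsub τ₀ hτ₀, h1 τ₀ hτ₀⟩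
    refine ⟨S.filter (IsTriangle (point p)), fun τ hτ => ?_,
      h.sum_edgeSign ht (exists_mem_ne_ne hcard) ?_, h.eq_faces ht⟩
    -- A nondegenerate triangle in the subdivision is contained in an admissible one, and both have
    -- three labels.
    · rw [Finset.mem_filter] at hτ
      obtain ⟨σ, hσ, hτσ⟩ := hadm τ hτ.1
      rwa [Finset.eq_of_subset_of_card_le hτσ (by rw [hτ.2.card, (h1 σ hσ).card])]
    · intro A B hAB hS hw
      obtain ⟨σ, hσ, hs⟩ := hadm _ hS
      exact h4 σ hσ A (hs (by simp)) B (hs (by simp)) hAB hw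
  · rintro ⟨X, hX, hchain, rfl⟩
    refine ⟨isTriComplex_faces (fun t ht => h1 t (hX t ht)) (fun t ht => hsub t (hX t ht)) hchain
      (exists_mem_ne_ne hcard) h6, fun C hC => ?_⟩
    obtain ⟨-, τ, hτ, hs⟩ := mem_faces.1 hC
    exact ⟨τ, hX τ hτ, hs⟩

lemma point_singleton (i : Fin n) : point p {i} = p i := by
  rw [point_eq_sum, Finset.sum_singleton]

lemma cross_point_pair {i a b c : Fin n} (ha : a ≠ i) (hb : b ≠ i) (hc : c ≠ i) :
    cross (point p {i, a}) (point p {i, b}) (point p {i, c}) = cross (p a) (p b) (p c) := by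
  simp only [point_eq_sum, Finset.sum_pair ha.symm, Finset.sum_pair hb.symm,
    Finset.sum_pair hc.symm, cross, PiLp.add_apply]
  ring

/-- The map from `p x` to the point of `t.erase x` is a point reflection, and point reflections of
the plane preserve orientation. -/
lemma cross_point_erase {t : Finset (Fin n)} {a b c : Fin n} (ha : a ∈ t) (hb : b ∈ t)
    (hc : c ∈ t) :
    cross (point p (t.erase a)) (point p (t.erase b)) (point p (t.erase c)) =
      cross (p a) (p b) (p c) := by
  have h : ∀ x ∈ t, point p (t.erase x) = point p t - p x := fun x hx => by
    rw [point_eq_sum, point_eq_sum, Finset.sum_erase_eq_sub hx]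
  rw [h a ha, h b hb, h c hc]
  simp only [cross, PiLp.sub_apply]
  ring

lemma cross_point_singleton (a b c : Fin n) :
    cross (point p {a}) (point p {b}) (point p {c}) = cross (p a) (p b) (p c) := by
  simp only [point_singleton]

lemma singleton_mem_singles {t : Finset (Fin n)} {a : Fin n} : {a} ∈ singles t ↔ a ∈ t := by
  simp [singles]

lemma singles_injective : Function.Injective (singles (n := n)) :=
  Finset.image_injective (Finset.singleton_injective)

lemma IsCcw.isTriangle_singles (hp : IsCcw p) {t : Finset (Fin n)} (ht : t.card = 3) :
    IsTriangle (point p) (singles t) :=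
  (hp.isTriangle ht).image fun _ _ _ _ _ _ => cross_point_singleton _ _ _

lemma IsCcw.edgeSign_singles (hp : IsCcw p) {t : Finset (Fin n)} (ht : t.card = 3) (a b : Fin n) :
    edgeSign (point p) (singles t) {a} {b} = bd t a b := by
  by_cases h : a ∈ t ∧ b ∈ t
  · rw [← hp.edgeSign_eq ht]
    exact edgeSign_image (Finset.singleton_injective.injOn)
      (fun _ _ _ _ _ _ => cross_point_singleton _ _ _) h.1 h.2
  · rw [edgeSign, if_neg (by rwa [singleton_mem_singles, singleton_mem_singles])]
    rcases not_and_or.1 h with h | h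
    · rw [bd_of_notMem_left h]
    · rw [bd_of_notMem_right h]

lemma IsCcw.isHullEdge_singleton (hp : IsCcw p) {a b : Fin n} :
    IsHullEdge (point p) (labels n 1) {a} {b} ↔ IsSucc Finset.univ a b := by
  rw [← hp.isHullEdge_iff]
  unfold IsHullEdge
  simp only [mem_labels, Finset.card_singleton, Finset.mem_univ, true_and, true_imp_iff, ne_eq,
    Finset.singleton_inj]
  refine and_congr_right fun _ => ⟨fun h c hca hcb => ?_, fun h C hC hca hcb => ?_⟩
  · rw [← cross_point_singleton]
    exact h {c} (by simp) (by simpa using hca) (by simpa using hcb)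
  · obtain ⟨c, rfl⟩ := Finset.card_eq_one.1 hC
    rw [cross_point_singleton]
    exact h c (by simpa using hca) (by simpa using hcb)

lemma IsCcw.hullSign_singleton (hp : IsCcw p) (a b : Fin n) :
    hullSign (point p) (labels n 1) {a} {b} = bd Finset.univ a b := by
  classical
  unfold hullSign bd
  rw [if_congr hp.isHullEdge_singleton rfl rfl, if_congr hp.isHullEdge_singleton rfl rfl]

lemma hullSign_of_notMem_left {ι : Type*} {v : ι → ℰ} {V : Finset ι} {a : ι} (h : a ∉ V) (b : ι) :
    hullSign v V a b = 0 := by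
  simp [hullSign, IsHullEdge, h]

lemma hullSign_of_notMem_right {ι : Type*} {v : ι → ℰ} {V : Finset ι} {b : ι} (h : b ∉ V) (a : ι) :
    hullSign v V a b = 0 := by
  simp [hullSign, IsHullEdge, h]

lemma edgeSign_of_notMem_left {ι : Type*} {v : ι → ℰ} {t : Finset ι} {a : ι} (h : a ∉ t) (b : ι) :
    edgeSign v t a b = 0 := if_neg fun hh => h hh.1

lemma edgeSign_of_notMem_right {ι : Type*} {v : ι → ℰ} {t : Finset ι} {b : ι} (h : b ∉ t) (a : ι) :
    edgeSign v t a b = 0 := if_neg fun hh => h hh.2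

lemma sum_edgeSign_eq_hullSign_iff {k : ℕ} {X : Finset (Finset (Finset (Fin n)))}
    (hX : ∀ τ ∈ X, τ ⊆ labels n k) :
    (∀ A B, ∑ τ ∈ X, edgeSign (point p) τ A B = hullSign (point p) (labels n k) A B) ↔
    ∀ A B, A.card = k → B.card = k →
      ∑ τ ∈ X, edgeSign (point p) τ A B = hullSign (point p) (labels n k) A B := by
  refine ⟨fun h A B _ _ => h A B, fun h A B => ?_⟩
  by_cases hA : A.card = k
  · by_cases hB : B.card = k
    · exact h A B hA hB
    · rw [hullSign_of_notMem_right (fun h => hB (mem_labels.1 h)), Finset.sum_eq_zero]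
      exact fun τ hτ => edgeSign_of_notMem_right (fun h => hB (mem_labels.1 (hX τ hτ h))) _
  · rw [hullSign_of_notMem_left (fun h => hA (mem_labels.1 h)), Finset.sum_eq_zero]
    exact fun τ hτ => edgeSign_of_notMem_left (fun h => hA (mem_labels.1 (hX τ hτ h))) _

lemma singles_subset_labels (t : Finset (Fin n)) : singles t ⊆ labels n 1 := by
  intro B hB
  obtain ⟨j, -, rfl⟩ := Finset.mem_image.1 hB
  exact mem_labels.2 (by simp)

/-- The chain description of the triangulations of a polygon. -/
lemma IsCcw.isHypertriangulation_one_iff (hp : IsCcw p) (hn : 3 ≤ n)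
    {S : Finset (Finset (Finset (Fin n)))} :
    IsHypertriangulation p 1 S ↔
      ∃ T, IsTriang Finset.univ T ∧ faces (T.image singles) = S := by
  classical
  obtain ⟨t₀, ht₀, -⟩ := exists_superset_card_three hn (M := ∅) (by simp)
  have hsum : ∀ T : Finset (Finset (Fin n)), (∀ t ∈ T, t.card = 3) → ∀ a b,
      ∑ τ ∈ T.image singles, edgeSign (point p) τ {a} {b} = ∑ t ∈ T, bd t a b := by
    intro T hT a b
    rw [Finset.sum_image singles_injective.injOn]
    exact Finset.sum_congr rfl fun t ht => hp.edgeSign_singles (hT t ht) a b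
  have hex : ∃ b ∈ (Finset.univ : Finset (Fin n)), b ≠ ⟨0, by lia⟩ :=
    ⟨⟨1, by lia⟩, Finset.mem_univ _, by simp⟩
  obtain ⟨b₀, hb₀⟩ := exists_isSucc (Finset.mem_univ _) hex
  rw [isHypertriangulation_iff_exists (Adm := fun τ => ∃ t : Finset (Fin n), t.card = 3 ∧
    τ = singles t)]
  · constructor
    · rintro ⟨X, hX, hchain, rfl⟩
      have hXT : X = (Finset.univ.filter fun t : Finset (Fin n) =>
          singles t ∈ X).image singles := by
        ext τ
        simp only [Finset.mem_image, Finset.mem_filter, Finset.mem_univ, true_and]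
        constructor
        · intro hτ
          obtain ⟨t, ht, rfl⟩ := hX τ hτ
          exact ⟨t, hτ, rfl⟩
        · rintro ⟨t, ht, rfl⟩
          exact ht
      have h3 : ∀ t ∈ Finset.univ.filter fun t : Finset (Fin n) => singles t ∈ X,
          t.card = 3 := by
        intro t ht
        rw [Finset.mem_filter] at ht
        obtain ⟨s, hs, hst⟩ := hX _ ht.2
        rwa [singles_injective hst]
      refine ⟨_, ⟨h3, fun a b => ?_⟩, by rw [← hXT]⟩
      rw [← hsum _ h3, ← hXT, hchain, hp.hullSign_singleton]
    · rintro ⟨T, hT, rfl⟩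
      refine ⟨T.image singles, fun τ hτ => ?_, ?_, rfl⟩
      · obtain ⟨t, ht, rfl⟩ := Finset.mem_image.1 hτ
        exact ⟨t, hT.1 t ht, rfl⟩
      · rw [sum_edgeSign_eq_hullSign_iff]
        · intro A B hA hB
          obtain ⟨a, rfl⟩ := Finset.card_eq_one.1 hA
          obtain ⟨b, rfl⟩ := Finset.card_eq_one.1 hB
          rw [hsum T hT.1, hT.2, hp.hullSign_singleton]
        · intro τ hτ
          obtain ⟨t, ht, rfl⟩ := Finset.mem_image.1 hτ
          exact singles_subset_labels t
  · rintro _ ⟨t, ht, rfl⟩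
    exact hp.isTriangle_singles ht
  · rintro _ ⟨t, ht, rfl⟩ C hC hne
    exact isFace_singles hC hne
  · intro C hC hd
    obtain ⟨t, ht, h⟩ := subset_singles_of_isFace hn hC hd
    exact ⟨_, ⟨t, ht, rfl⟩, h⟩
  · rintro _ ⟨t, ht, rfl⟩ A hA B hB hAB hw
    obtain ⟨a, -, rfl⟩ := Finset.mem_image.1 hA
    obtain ⟨b, -, rfl⟩ := Finset.mem_image.1 hB
    have hab : a ≠ b := fun h => hAB (by rw [h])
    rw [hp.isHullEdge_singleton]
    refine ⟨Finset.mem_univ a, Finset.mem_univ b, hab, fun c _ hc => ?_⟩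
    have h1 := hw {c} (mem_labels.2 (by simp))
    have h2 := hp.cross_pos hc
    rw [cross_point_singleton, cross_swap_right] at h1
    linarith
  · exact ⟨_, t₀, ht₀, rfl⟩
  · exact ⟨_, _, hp.isHullEdge_singleton.2 hb₀⟩

lemma mem_triangulations {S : Finset (Finset (Finset (Fin n)))} :
    S ∈ triangulations p ↔ IsHypertriangulation p 1 S := by
  simp [triangulations, hypertriangulations]

lemma pair_mem_faces_iff {T : Finset (Finset (Fin n))} {i j : Fin n} (hij : j ≠ i) :
    {{i}, {j}} ∈ faces (T.image singles) ↔ j ∈ nbrs T i := by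
  rw [mem_faces, mem_nbrs, and_iff_right (Finset.insert_nonempty _ _), and_iff_right hij]
  simp only [Finset.mem_image, exists_exists_and_eq_and, Finset.insert_subset_iff,
    Finset.singleton_subset_iff, singleton_mem_singles]

open Classical in
lemma degree_faces (T : Finset (Finset (Fin n))) (i : Fin n) :
    degree (faces (T.image singles)) i = ((nbrs T i).filter fun j => ¬ IsSide i j).card := by
  unfold degree
  congr 1
  ext j
  simp only [Finset.mem_filter, Finset.mem_univ, true_and]
  by_cases hij : j = i
  · subst hij
    simp [mem_nbrs]
  · rw [pair_mem_faces_iff hij]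
    tauto

lemma IsCcw.card_triangs_nbrs (hp : IsCcw p) (hn : 3 ≤ n) {T : Finset (Finset (Fin n))}
    (hT : IsTriang Finset.univ T) (i : Fin n) :
    (triangs (nbrs T i)).card = catalan (degree (faces (T.image singles)) i) := by
  classical
  rw [degree_faces]
  refine card_triangs hp _ _ ?_
  convert hT.card_nbrs hn i

/-- The right hand side of the formula as a sum over chain triangulations. -/
lemma IsCcw.sum_triangulations (hp : IsCcw p) (hn : 3 ≤ n) :
    ∑ T ∈ triangulations p, ∏ i : Fin n, catalan (degree T i) =
      ∑ T ∈ triangs Finset.univ, ∏ i : Fin n, (triangs (nbrs T i)).card := by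
  symm
  refine Finset.sum_bij (fun T _ => faces (T.image singles)) ?_ ?_ ?_ ?_
  · intro T hT
    exact mem_triangulations.2 ((hp.isHypertriangulation_one_iff hn).2
      ⟨T, mem_triangs.1 hT, rfl⟩)
  · intro T hT T' hT' h
    refine Finset.image_injective singles_injective (faces_injective_of_card ?_ ?_ h)
    · intro τ hτ
      obtain ⟨t, ht, rfl⟩ := Finset.mem_image.1 hτ
      exact (hp.isTriangle_singles ((mem_triangs.1 hT).1 t ht)).card
    · intro τ hτ
      obtain ⟨t, ht, rfl⟩ := Finset.mem_image.1 hτ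
      exact (hp.isTriangle_singles ((mem_triangs.1 hT').1 t ht)).card
  · intro S hS
    obtain ⟨T, hT, h⟩ := (hp.isHypertriangulation_one_iff hn).1 (mem_triangulations.1 hS)
    exact ⟨T, mem_triangs.2 hT, h⟩
  · intro T hT
    exact Finset.prod_congr rfl fun i _ => hp.card_triangs_nbrs hn (mem_triangs.1 hT) i

end

/-! ### Edges and the hull boundary at level two -/

section

variable {n : ℕ} {p : Fin n → ℰ}

lemma pair_mem_white {i j : Fin n} {t : Finset (Fin n)} (hij : j ≠ i) :
    {i, j} ∈ white i t ↔ j ∈ t := by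
  simp only [white, Finset.mem_image]
  constructor
  · rintro ⟨x, hx, h⟩
    have hj : j ∈ ({i, x} : Finset (Fin n)) := h ▸ (by simp)
    simp only [Finset.mem_insert, Finset.mem_singleton] at hj
    rwa [hj.resolve_left hij]
  · intro h
    exact ⟨j, h, rfl⟩

lemma mem_of_mem_white {i : Fin n} {t B : Finset (Fin n)} (h : B ∈ white i t) : i ∈ B := by
  obtain ⟨x, -, rfl⟩ := Finset.mem_image.1 h
  simp

lemma white_injective {i : Fin n} {s t : Finset (Fin n)} (hs : i ∉ s) (ht : i ∉ t)
    (h : white i s = white i t) : s = t := by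
  ext x
  by_cases hx : x = i
  · subst hx; tauto
  · rw [← pair_mem_white hx, h, pair_mem_white hx]

lemma white_apex {i i' : Fin n} {s t : Finset (Fin n)} (hs : s.card = 3)
    (h : white i s = white i' t) : i = i' := by
  obtain ⟨a, ha, b, hb, hab⟩ := Finset.one_lt_card.1 (show 1 < s.card by lia)
  by_contra hne
  have key : ∀ x ∈ s, i' = x := by
    intro x hx
    have h1 : i' ∈ ({i, x} : Finset (Fin n)) :=
      mem_of_mem_white (h.subset (Finset.mem_image_of_mem _ hx))
    simp only [Finset.mem_insert, Finset.mem_singleton] at h1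
    exact h1.resolve_left (Ne.symm hne)
  exact hab ((key a ha).symm.trans (key b hb))

lemma black_ne_white {i : Fin n} {s t : Finset (Fin n)} (hs : s.card = 3) :
    black s ≠ white i t := by
  intro h
  obtain ⟨x, hx⟩ := Finset.card_pos.1 (show 0 < s.card by lia)
  by_cases hi : i ∈ s
  · have := mem_of_mem_white (h.subset (Finset.mem_image_of_mem (fun j => s.erase j) hi))
    simp at this
  · have := mem_of_mem_white (h.subset (Finset.mem_image_of_mem (fun j => s.erase j) hx))
    exact hi (Finset.mem_of_mem_erase this)

lemma black_injective {s t : Finset (Fin n)} (hs : s.card = 3) (ht : t.card = 3)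
    (h : black s = black t) : s = t := by
  have key : ∀ {s t : Finset (Fin n)}, s.card = 3 → t.card = 3 → black s = black t → s ⊆ t := by
    intro s t hs ht h x hx
    obtain ⟨y, hy, hyx⟩ := Finset.exists_mem_ne (show 1 < s.card by lia) x
    have : s.erase y ∈ black t := h ▸ Finset.mem_image_of_mem _ hy
    exact ((mem_black ht).1 this).2 (Finset.mem_erase.2 ⟨hyx.symm, hx⟩)
  exact (key hs ht h).antisymm (key ht hs h.symm)

lemma erase_triple {i j k : Fin n} (hik : i ≠ k) (hjk : j ≠ k) :
    ({i, j, k} : Finset (Fin n)).erase k = {i, j} := by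
  ext x
  simp only [Finset.mem_erase, Finset.mem_insert, Finset.mem_singleton]
  grind

lemma IsCcw.isTriangle_white (hp : IsCcw p) {i : Fin n} {t : Finset (Fin n)} (ht : t.card = 3)
    (hi : i ∉ t) : IsTriangle (point p) (white i t) :=
  (hp.isTriangle ht).image fun _ ha _ hb _ hc =>
    cross_point_pair (ne_of_mem_of_not_mem ha hi) (ne_of_mem_of_not_mem hb hi) (ne_of_mem_of_not_mem hc hi)

lemma IsCcw.isTriangle_black (hp : IsCcw p) {t : Finset (Fin n)} (ht : t.card = 3) :
    IsTriangle (point p) (black t) :=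
  (hp.isTriangle ht).image fun _ ha _ hb _ hc => cross_point_erase ha hb hc

lemma IsCcw.edgeSign_white (hp : IsCcw p) {i j k : Fin n} {t : Finset (Fin n)} (ht : t.card = 3)
    (hi : i ∉ t) (hj : j ≠ i) (hk : k ≠ i) :
    edgeSign (point p) (white i t) {i, j} {i, k} = bd t j k := by
  by_cases h : j ∈ t ∧ k ∈ t
  · rw [← hp.edgeSign_eq ht]
    refine edgeSign_image (fun a ha b hb hab => ?_) (fun a ha b hb c hc => cross_point_pair
      (ne_of_mem_of_not_mem ha hi) (ne_of_mem_of_not_mem hb hi) (ne_of_mem_of_not_mem hc hi)) h.1 h.2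
    have hai : a ≠ i := fun h => hi (h ▸ ha)
    have : a ∈ ({i, b} : Finset (Fin n)) := hab ▸ (by simp)
    simp only [Finset.mem_insert, Finset.mem_singleton] at this
    exact this.resolve_left hai
  · rw [edgeSign, if_neg (by rwa [pair_mem_white hj, pair_mem_white hk])]
    rcases not_and_or.1 h with h | h
    · rw [bd_of_notMem_left h]
    · rw [bd_of_notMem_right h]

/-- All labels of a white triangle contain its apex, and `i` is the only common element of the two
ends. -/
lemma edgeSign_white_of_ne {i i' j k : Fin n} {t : Finset (Fin n)} (hjk : j ≠ k) (hi : i ≠ i') :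
    edgeSign (point p) (white i' t) {i, j} {i, k} = 0 := by
  refine if_neg fun h => hjk ?_
  have h1 := mem_of_mem_white h.1
  have h2 := mem_of_mem_white h.2
  simp only [Finset.mem_insert, Finset.mem_singleton] at h1 h2
  exact (h1.resolve_left hi.symm).symm.trans (h2.resolve_left hi.symm)

/-- As labels of the black triangle, `{i, j}` and `{i, k}` are `t.erase k` and `t.erase j`. They
correspond to the vertices `k` and `j` of `t`, so the edge is traversed backwards. -/
lemma IsCcw.edgeSign_black (hp : IsCcw p) {i j k : Fin n} {t : Finset (Fin n)} (ht : t.card = 3)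
    (hj : j ≠ i) (hk : k ≠ i) (hjk : j ≠ k) :
    edgeSign (point p) (black t) {i, j} {i, k} = -(if i ∈ t then bd t j k else 0) := by
  by_cases h : i ∈ t ∧ j ∈ t ∧ k ∈ t
  · obtain ⟨hi, hj', hk'⟩ := h
    have htt : t = {i, j, k} := by
      symm
      refine Finset.eq_of_subset_of_card_le ?_ ?_
      · simp [Finset.insert_subset_iff, hi, hj', hk']
      · rw [ht, Finset.card_eq_three.2 ⟨i, j, k, hj.symm, hk.symm, hjk, rfl⟩]
    have e1 : {i, j} = t.erase k := by rw [htt, erase_triple hk.symm hjk]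
    have e2 : {i, k} = t.erase j := by rw [htt, Finset.pair_comm j k, erase_triple hj.symm hjk.symm]
    rw [if_pos hi, e1, e2, ← bd_swap, ← hp.edgeSign_eq ht]
    refine edgeSign_image (fun a ha b hb hab => ?_)
      (fun a ha b hb c hc => cross_point_erase ha hb hc) hk' hj'
    by_contra hne
    have : b ∈ t.erase b := hab ▸ Finset.mem_erase.2 ⟨Ne.symm hne, hb⟩
    simp at this
  · rw [edgeSign, if_neg]
    · by_cases hi : i ∈ t
      · rw [if_pos hi]
        by_cases hj' : j ∈ t
        · rw [bd_of_notMem_right fun hk' => h ⟨hi, hj', hk'⟩, neg_zero]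
        · rw [bd_of_notMem_left hj', neg_zero]
      · rw [if_neg hi, neg_zero]
    · rw [mem_black ht, mem_black ht]
      rintro ⟨⟨-, h1⟩, ⟨-, h2⟩⟩
      exact h ⟨h1 (by simp), h1 (by simp), h2 (by simp)⟩

lemma cross_point_two {i j k x y : Fin n} (hj : j ≠ i) (hk : k ≠ i) (hxy : x ≠ y) :
    cross (point p {i, j}) (point p {i, k}) (point p {x, y}) =
      cross (p j) (p k) (p x) + cross (p j) (p k) (p y) - cross (p j) (p k) (p i) := by
  simp only [point_eq_sum, Finset.sum_pair hj.symm, Finset.sum_pair hk.symm,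
    Finset.sum_pair hxy, cross, PiLp.add_apply]
  ring

/-- Testing the inequality at `{j, k}` puts `i` on the right of `j k`, and testing it at `{i, l}`
puts every other `l` on the left. Hence `i` is the only vertex between `j` and `k`. -/
lemma IsCcw.isSucc_of_weak (hp : IsCcw p) {i j k : Fin n} (hj : j ≠ i) (hk : k ≠ i) (hjk : j ≠ k)
    (h : ∀ C ∈ labels n 2, 0 ≤ cross (point p {i, j}) (point p {i, k}) (point p C)) :
    IsSucc Finset.univ j i ∧ IsSucc Finset.univ i k := by
  have h1 : CyclicLT j i k := by
    refine (CyclicLT.total hj hk.symm hjk).resolve_right fun hc => ?_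
    have h1 := h {j, k} (mem_labels.2 (Finset.card_pair hjk))
    have h2 := hp.cross_pos hc
    rw [cross_point_two hj hk hjk, cross_self_outer, cross_self_right] at h1
    linarith
  have h2 : ∀ l, l ≠ i → l ≠ j → l ≠ k → CyclicLT j k l := by
    intro l hli hlj hlk
    refine (CyclicLT.total hjk hlk.symm hlj.symm).resolve_right fun hc => ?_
    have h1 := h {i, l} (mem_labels.2 (Finset.card_pair hli.symm))
    have h2 := hp.cross_pos hc
    rw [cross_swap_right] at h2
    rw [cross_point_two hj hk hli.symm] at h1
    linarith
  refine ⟨⟨Finset.mem_univ _, Finset.mem_univ _, hj, fun l _ hl => ?_⟩,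
    ⟨Finset.mem_univ _, Finset.mem_univ _, hk.symm, fun l _ hl => ?_⟩⟩
  · have := hl.ne
    have h3 := h2 l this.2.1 this.1.symm (by rintro rfl; exact hl.asymm h1)
    unfold CyclicLT at *
    lia
  · have := hl.ne
    have h3 := h2 l this.1.symm (by rintro rfl; exact hl.asymm h1.rotate) this.2.1
    unfold CyclicLT at *
    lia

lemma IsCcw.isHullEdge_pair (hp : IsCcw p) {i j k : Fin n} (hj : j ≠ i) (hk : k ≠ i)
    (hjk : j ≠ k) : IsHullEdge (point p) (labels n 2) {i, j} {i, k} ↔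
      IsSucc Finset.univ j i ∧ IsSucc Finset.univ i k := by
  constructor
  · intro h
    refine hp.isSucc_of_weak hj hk hjk fun C hC => ?_
    by_cases h1 : C = {i, j}
    · rw [h1, cross_self_outer]
    by_cases h2 : C = {i, k}
    · rw [h2, cross_self_right]
    exact (h.2.2.2 C hC h1 h2).le
  · rintro ⟨h1, h2⟩
    have hcyc : CyclicLT j i k := by
      refine (CyclicLT.total hj hk.symm hjk).resolve_right fun hc => h1.2.2.2 k (by simp) hc
    have hneg : cross (p j) (p k) (p i) < 0 := by
      have := hp.cross_pos hcyc
      rw [cross_swap_right] at this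
      linarith
    have hpos : ∀ x, x ≠ i → x ≠ j → x ≠ k → 0 < cross (p j) (p k) (p x) := by
      intro x hxi hxj hxk
      refine hp.cross_pos ?_
      have h3 := h1.2.2.2 x (by simp)
      have h4 := h2.2.2.2 x (by simp)
      unfold CyclicLT at *
      lia
    have hnn : ∀ x, x ≠ i → 0 ≤ cross (p j) (p k) (p x) := by
      intro x hxi
      by_cases hxj : x = j
      · rw [hxj, cross_self_outer]
      by_cases hxk : x = k
      · rw [hxk, cross_self_right]
      exact (hpos x hxi hxj hxk).le
    refine ⟨mem_labels.2 (Finset.card_pair hj.symm), mem_labels.2 (Finset.card_pair hk.symm), ?_, ?_⟩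
    · intro h
      have : j ∈ ({i, k} : Finset (Fin n)) := h ▸ (by simp)
      simp [hj, hjk] at this
    · intro C hC hCj hCk
      obtain ⟨x, y, hxy, rfl⟩ := Finset.card_eq_two.1 (mem_labels.1 hC)
      rw [cross_point_two hj hk hxy]
      by_cases hx : x = i
      · subst hx
        have := hpos y hxy.symm (by rintro rfl; exact hCj rfl) (by rintro rfl; exact hCk rfl)
        linarith
      by_cases hy : y = i
      · subst hy
        have := hpos x hx (by rintro rfl; exact hCj (Finset.pair_comm _ _))
          (by rintro rfl; exact hCk (Finset.pair_comm _ _))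
        linarith
      have := hnn x hx
      have := hnn y hy
      linarith

/-- A hull edge from `{i, j}` to `{i, k}` is the side created by deleting the corner `i` from the
polygon, and the difference of the two boundaries isolates it. -/
lemma IsCcw.hullSign_pair (hp : IsCcw p) {i j k : Fin n} (hj : j ≠ i) (hk : k ≠ i)
    (hjk : j ≠ k) : hullSign (point p) (labels n 2) {i, j} {i, k} =
      bd (Finset.univ.erase i) j k - bd Finset.univ j k := by
  classical
  unfold hullSign bd
  rw [if_congr (hp.isHullEdge_pair hj hk hjk) rfl rfl,
    if_congr (hp.isHullEdge_pair hk hj hjk.symm) rfl rfl,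
    if_congr (isSucc_erase_iff hj hk hjk) rfl rfl,
    if_congr (isSucc_erase_iff hk hj hjk.symm) rfl rfl]
  have h1 : IsSucc Finset.univ j k → ¬ IsSucc Finset.univ j i := fun h1 h2 => hk (h1.unique h2)
  have h2 : IsSucc Finset.univ k j → ¬ IsSucc Finset.univ k i := fun h1 h2 => hj (h1.unique h2)
  by_cases a1 : IsSucc Finset.univ j k <;> by_cases a2 : IsSucc Finset.univ k j <;>
    simp [a1, a2, h1, h2]

lemma cross_point_add {A B C D : Finset (Fin n)} (h : point p C + point p D = point p A + point p B) :
    cross (point p A) (point p B) (point p C) + cross (point p A) (point p B) (point p D) = 0 := by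
  have h0 := congrArg (fun x : ℰ => x 0) h
  have h1 := congrArg (fun x : ℰ => x 1) h
  simp only [PiLp.add_apply] at h0 h1
  unfold cross
  rw [show point p D 0 = point p A 0 + point p B 0 - point p C 0 by linarith,
    show point p D 1 = point p A 1 + point p B 1 - point p C 1 by linarith]
  ring

/-- For disjoint pairs, exchanging one element gives two further labels whose points are symmetric
about the midpoint of the segment, so they cannot both lie strictly on its left. -/
lemma not_isHullEdge_of_disjoint {A B : Finset (Fin n)} (h : Disjoint A B) :
    ¬ IsHullEdge (point p) (labels n 2) A B := by
  rintro ⟨hA, hB, -, hlt⟩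
  obtain ⟨i, j, hij, rfl⟩ := Finset.card_eq_two.1 (mem_labels.1 hA)
  obtain ⟨k, l, hkl, rfl⟩ := Finset.card_eq_two.1 (mem_labels.1 hB)
  simp only [Finset.disjoint_insert_left, Finset.disjoint_singleton_left, Finset.mem_insert,
    Finset.mem_singleton, not_or] at h
  obtain ⟨⟨hik, hil⟩, hjk, hjl⟩ := h
  have hsum := cross_point_add (p := p) (A := {i, j}) (B := {k, l}) (C := {i, k}) (D := {j, l}) (by
    simp only [point_eq_sum, Finset.sum_pair hij, Finset.sum_pair hkl, Finset.sum_pair hik,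
      Finset.sum_pair hjl]
    abel)
  have h1 := hlt {i, k} (mem_labels.2 (Finset.card_pair hik))
    (fun h => by
      have : k ∈ ({i, j} : Finset (Fin n)) := h ▸ (by simp)
      simp [Ne.symm hik, Ne.symm hjk] at this)
    (fun h => by
      have : i ∈ ({k, l} : Finset (Fin n)) := h ▸ (by simp)
      simp [hik, hil] at this)
  have h2 := hlt {j, l} (mem_labels.2 (Finset.card_pair hjl))
    (fun h => by
      have : l ∈ ({i, j} : Finset (Fin n)) := h ▸ (by simp)
      simp [Ne.symm hil, Ne.symm hjl] at this)
    (fun h => by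
      have : j ∈ ({k, l} : Finset (Fin n)) := h ▸ (by simp)
      simp [hjk, hjl] at this)
  linarith

/-- The triangles admissible at level two. -/
def IsBlackOrWhite (τ : Finset (Finset (Fin n))) : Prop :=
  ∃ t : Finset (Fin n), t.card = 3 ∧ (τ = black t ∨ ∃ i ∉ t, τ = white i t)

lemma exists_common {A B : Finset (Fin n)} (hA : A.card = 2) (hB : B.card = 2) (hAB : A ≠ B)
    (h : ¬ Disjoint A B) : ∃ i j k, j ≠ i ∧ k ≠ i ∧ j ≠ k ∧ A = {i, j} ∧ B = {i, k} := by
  obtain ⟨i, hiA, hiB⟩ := Finset.not_disjoint_iff.1 h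
  have key : ∀ {A : Finset (Fin n)}, A.card = 2 → i ∈ A → ∃ j, j ≠ i ∧ A = {i, j} := by
    intro A hA hi
    obtain ⟨x, y, hxy, rfl⟩ := Finset.card_eq_two.1 hA
    simp only [Finset.mem_insert, Finset.mem_singleton] at hi
    rcases hi with rfl | rfl
    · exact ⟨y, hxy.symm, rfl⟩
    · exact ⟨x, hxy, Finset.pair_comm _ _⟩
  obtain ⟨j, hj, rfl⟩ := key hA hiA
  obtain ⟨k, hk, rfl⟩ := key hB hiB
  exact ⟨i, j, k, hj, hk, fun h => hAB (by rw [h]), rfl, rfl⟩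

lemma IsBlackOrWhite.subset_labels {τ : Finset (Finset (Fin n))} (h : IsBlackOrWhite τ) :
    τ ⊆ labels n 2 := by
  intro B hB
  rw [mem_labels]
  obtain ⟨t, ht, rfl | ⟨i, hi, rfl⟩⟩ := h
  · exact ((mem_black ht).1 hB).1
  · obtain ⟨j, hj, rfl⟩ := Finset.mem_image.1 hB
    exact Finset.card_pair fun h => hi (h ▸ hj)

lemma IsBlackOrWhite.not_disjoint {τ : Finset (Finset (Fin n))} (h : IsBlackOrWhite τ)
    {A B : Finset (Fin n)} (hA : A ∈ τ) (hB : B ∈ τ) : ¬ Disjoint A B := by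
  obtain ⟨t, ht, rfl | ⟨i, hi, rfl⟩⟩ := h
  · intro hd
    rw [mem_black ht] at hA hB
    have := Finset.card_le_card (Finset.union_subset hA.2 hB.2)
    rw [Finset.card_union_of_disjoint hd, hA.1, hB.1, ht] at this
    lia
  · exact Finset.not_disjoint_iff.2 ⟨i, mem_of_mem_white hA, mem_of_mem_white hB⟩

end

/-! ### Splitting the level-two boundary equation into polygons -/

section

variable {n : ℕ} {p : Fin n → ℰ}

open Classical in
/-- The black triangles over `T`, together with the white triangles over `W i` with apex `i`. -/
noncomputable def blackWhite (T : Finset (Finset (Fin n))) (W : Fin n → Finset (Finset (Fin n))) :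
    Finset (Finset (Finset (Fin n))) :=
  T.image black ∪ Finset.univ.biUnion fun i => (W i).image (white i)

/-- The requirements on the triangles underlying `blackWhite`. -/
def IsProper (T : Finset (Finset (Fin n))) (W : Fin n → Finset (Finset (Fin n))) : Prop :=
  (∀ t ∈ T, t.card = 3) ∧ ∀ i, ∀ t ∈ W i, t.card = 3 ∧ i ∉ t

variable {T T' : Finset (Finset (Fin n))} {W W' : Fin n → Finset (Finset (Fin n))}

lemma mem_blackWhite {τ : Finset (Finset (Fin n))} : τ ∈ blackWhite T W ↔
    (∃ t ∈ T, black t = τ) ∨ ∃ i, ∃ t ∈ W i, white i t = τ := by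
  simp [blackWhite]

lemma IsProper.black_mem_iff (h : IsProper T W) {t : Finset (Fin n)} (ht : t.card = 3) :
    black t ∈ blackWhite T W ↔ t ∈ T := by
  rw [mem_blackWhite]
  constructor
  · rintro (⟨s, hs, hst⟩ | ⟨i, s, hs, hst⟩)
    · rwa [← black_injective (h.1 s hs) ht hst]
    · exact (black_ne_white ht hst.symm).elim
  · exact fun h => Or.inl ⟨t, h, rfl⟩

lemma IsProper.white_mem_iff (h : IsProper T W) {i : Fin n} {t : Finset (Fin n)} (ht : t.card = 3)
    (hi : i ∉ t) : white i t ∈ blackWhite T W ↔ t ∈ W i := by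
  rw [mem_blackWhite]
  constructor
  · rintro (⟨s, hs, hst⟩ | ⟨i', s, hs, hst⟩)
    · exact (black_ne_white (h.1 s hs) hst).elim
    · obtain rfl := white_apex ht hst.symm
      rwa [← white_injective (h.2 i s hs).2 hi hst]
  · exact fun h => Or.inr ⟨i, t, h, rfl⟩

lemma IsProper.isBlackOrWhite (h : IsProper T W) {τ : Finset (Finset (Fin n))}
    (hτ : τ ∈ blackWhite T W) : IsBlackOrWhite τ := by
  rcases mem_blackWhite.1 hτ with ⟨t, ht, rfl⟩ | ⟨i, t, ht, rfl⟩
  · exact ⟨t, h.1 t ht, Or.inl rfl⟩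
  · exact ⟨t, (h.2 i t ht).1, Or.inr ⟨i, (h.2 i t ht).2, rfl⟩⟩

lemma IsProper.blackWhite_injective (h : IsProper T W) (h' : IsProper T' W')
    (he : blackWhite T W = blackWhite T' W') : T = T' ∧ W = W' := by
  constructor
  · ext t
    by_cases ht : t.card = 3
    · rw [← h.black_mem_iff ht, he, h'.black_mem_iff ht]
    · exact ⟨fun hh => (ht (h.1 t hh)).elim, fun hh => (ht (h'.1 t hh)).elim⟩
  · ext i t
    by_cases ht : t.card = 3 ∧ i ∉ t
    · rw [← h.white_mem_iff ht.1 ht.2, he, h'.white_mem_iff ht.1 ht.2]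
    · exact ⟨fun hh => (ht (h.2 i t hh)).elim, fun hh => (ht (h'.2 i t hh)).elim⟩

lemma exists_eq_blackWhite {X : Finset (Finset (Finset (Fin n)))}
    (hX : ∀ τ ∈ X, IsBlackOrWhite τ) : ∃ T W, IsProper T W ∧ X = blackWhite T W := by
  classical
  refine ⟨Finset.univ.filter fun t => t.card = 3 ∧ black t ∈ X,
    fun i => Finset.univ.filter fun t => (t.card = 3 ∧ i ∉ t) ∧ white i t ∈ X, ⟨?_, ?_⟩, ?_⟩
  · intro t ht
    exact (Finset.mem_filter.1 ht).2.1
  · intro i t ht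
    exact (Finset.mem_filter.1 ht).2.1
  · ext τ
    rw [mem_blackWhite]
    constructor
    · intro hτ
      obtain ⟨t, ht, rfl | ⟨i, hi, rfl⟩⟩ := hX τ hτ
      · exact Or.inl ⟨t, Finset.mem_filter.2 ⟨Finset.mem_univ _, ht, hτ⟩, rfl⟩
      · exact Or.inr ⟨i, t, Finset.mem_filter.2 ⟨Finset.mem_univ _, ⟨ht, hi⟩, hτ⟩, rfl⟩
    · rintro (⟨t, ht, rfl⟩ | ⟨i, t, ht, rfl⟩)
      · exact (Finset.mem_filter.1 ht).2.2
      · exact (Finset.mem_filter.1 ht).2.2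

lemma IsProper.sum_blackWhite (h : IsProper T W) (f : Finset (Finset (Fin n)) → ℤ) :
    ∑ τ ∈ blackWhite T W, f τ = ∑ t ∈ T, f (black t) + ∑ i, ∑ t ∈ W i, f (white i t) := by
  classical
  rw [blackWhite, Finset.sum_union, Finset.sum_image, Finset.sum_biUnion]
  · congr 1
    refine Finset.sum_congr rfl fun i _ => Finset.sum_image ?_
    exact fun s hs t ht => white_injective (h.2 i s hs).2 (h.2 i t ht).2
  · intro i _ i' _ hne
    rw [Function.onFun, Finset.disjoint_left]
    rintro _ h1 h2
    obtain ⟨s, hs, rfl⟩ := Finset.mem_image.1 h1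
    obtain ⟨t, ht, he⟩ := Finset.mem_image.1 h2
    exact hne (white_apex (h.2 i s hs).1 he.symm)
  · exact fun s hs t ht => black_injective (h.1 s hs) (h.1 t ht)
  · rw [Finset.disjoint_left]
    rintro _ h1 h2
    obtain ⟨s, hs, rfl⟩ := Finset.mem_image.1 h1
    obtain ⟨i, -, h2⟩ := Finset.mem_biUnion.1 h2
    obtain ⟨t, ht, he⟩ := Finset.mem_image.1 h2
    exact black_ne_white (h.1 s hs) he.symm

lemma IsProper.sum_edgeSign (h : IsProper T W) (hp : IsCcw p) {i j k : Fin n} (hj : j ≠ i)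
    (hk : k ≠ i) (hjk : j ≠ k) :
    ∑ τ ∈ blackWhite T W, edgeSign (point p) τ {i, j} {i, k} =
      ∑ t ∈ W i, bd t j k - ∑ t ∈ T, if i ∈ t then bd t j k else 0 := by
  rw [h.sum_blackWhite, Finset.sum_congr rfl fun t ht => hp.edgeSign_black (h.1 t ht) hj hk hjk,
    Finset.sum_neg_distrib, Finset.sum_eq_single_of_mem i (Finset.mem_univ i),
    Finset.sum_congr rfl fun t ht => hp.edgeSign_white (h.2 i t ht).1 (h.2 i t ht).2 hj hk]
  · ring
  · exact fun i' _ hi => Finset.sum_eq_zero fun t _ => edgeSign_white_of_ne hjk hi.symm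

/-- The full sum over `k` is zero, so leaving out `k = i` leaves the negative of the coefficient of
`j i`. -/
lemma sum_erase_bd (N : Finset (Fin n)) (i j : Fin n) :
    ∑ k ∈ Finset.univ.erase i, bd N j k = bd N i j := by
  rw [Finset.sum_erase_eq_sub (Finset.mem_univ i), sum_bd, bd_swap N i j]
  ring

/-- The boundary condition at level two means that the black triangles form a triangulation of the
polygon and that the white ones form triangulations of the polygons of neighbours. -/
lemma IsProper.chain_iff (h : IsProper T W) (hp : IsCcw p) (hn : 3 ≤ n) :
    (∀ A B, ∑ τ ∈ blackWhite T W, edgeSign (point p) τ A B =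
      hullSign (point p) (labels n 2) A B) ↔
    IsTriang Finset.univ T ∧ ∀ i, IsTriang (nbrs T i) (W i) := by
  classical
  -- Edges between disjoint labels occur neither in black or white triangles nor in the hull
  -- boundary, so only edges with a common element `i` give conditions.
  have hstep : (∀ A B, ∑ τ ∈ blackWhite T W, edgeSign (point p) τ A B =
      hullSign (point p) (labels n 2) A B) ↔ ∀ i j k, j ≠ i → k ≠ i →
        ∑ t ∈ W i, bd t j k = (∑ t ∈ T, if i ∈ t then bd t j k else 0) +
          (bd (Finset.univ.erase i) j k - bd Finset.univ j k) := by
    constructor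
    · intro hc i j k hj hk
      by_cases hjk : j = k
      · subst hjk
        simp [bd_self]
      · have := hc {i, j} {i, k}
        rw [h.sum_edgeSign hp hj hk hjk, hp.hullSign_pair hj hk hjk] at this
        rw [← this]
        ring
    · intro hc
      rw [sum_edgeSign_eq_hullSign_iff fun τ hτ => (h.isBlackOrWhite hτ).subset_labels]
      intro A B hA hB
      by_cases hAB : A = B
      · subst hAB
        simp [edgeSign_self, hullSign]
      by_cases hd : Disjoint A B
      · rw [hullSign, if_neg (not_isHullEdge_of_disjoint hd),
          if_neg (not_isHullEdge_of_disjoint hd.symm), sub_zero]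
        exact Finset.sum_eq_zero fun τ hτ =>
          if_neg fun hh => (h.isBlackOrWhite hτ).not_disjoint hh.1 hh.2 hd
      · obtain ⟨i, j, k, hj, hk, hjk, rfl, rfl⟩ := exists_common hA hB hAB hd
        rw [h.sum_edgeSign hp hj hk hjk, hp.hullSign_pair hj hk hjk, hc i j k hj hk]
        ring
  rw [hstep]
  -- Once `T` is a triangulation, the right-hand side is the boundary of the polygon of neighbours;
  -- the sum over `T` has at most one nonzero term, that of `{i, j, k}`.
  have hlink : IsTriang Finset.univ T → ∀ i j k, j ≠ i → k ≠ i →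
      bd (nbrs T i) j k = (∑ t ∈ T, if i ∈ t then bd t j k else 0) +
          (bd (Finset.univ.erase i) j k - bd Finset.univ j k) := by
    intro hT i j k hj hk
    by_cases hjk : j = k
    · subst hjk
      simp [bd_self]
    rw [hT.bd_nbrs hp hn hj hk hjk]
    congr 1
    have hz : ∀ t ∈ T, t ≠ {i, j, k} → (if i ∈ t then bd t j k else 0) = 0 := by
      intro t ht hne
      by_cases hi : i ∈ t
      · rw [if_pos hi]
        by_cases hj' : j ∈ t
        · refine bd_of_notMem_right (fun hk' => hne ?_) j
          symm
          refine Finset.eq_of_subset_of_card_le ?_ ?_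
          · simp [Finset.insert_subset_iff, hi, hj', hk']
          · rw [h.1 t ht, Finset.card_eq_three.2 ⟨i, j, k, hj.symm, hk.symm, hjk, rfl⟩]
        · exact bd_of_notMem_left hj' k
      · rw [if_neg hi]
    by_cases hm : {i, j, k} ∈ T
    · rw [if_pos hm, Finset.sum_eq_single_of_mem _ hm hz, if_pos (by simp)]
    · rw [if_neg hm, Finset.sum_eq_zero fun t ht => hz t ht fun he => hm (he ▸ ht)]
  constructor
  · intro hc
    have hT : IsTriang Finset.univ T := by
      refine ⟨h.1, fun i j => ?_⟩
      by_cases hij : j = i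
      · subst hij
        simp [bd_self]
      -- Summing over `k` turns every boundary coefficient at `j k` into one at `i j`. The triangles
      -- of `W i` and the polygon without `i` do not contain `i`, so what remains is the chain
      -- equation for `T` at `i j`.
      have hsum := Finset.sum_congr (rfl : Finset.univ.erase i = Finset.univ.erase i)
        fun k hk => hc i j k hij (Finset.ne_of_mem_erase hk)
      rw [Finset.sum_add_distrib, Finset.sum_sub_distrib, sum_erase_bd, sum_erase_bd,
        bd_of_notMem_left (Finset.notMem_erase i _), Finset.sum_comm,
        Finset.sum_comm (s := Finset.univ.erase i) (t := T),
        Finset.sum_congr rfl fun t ht => sum_erase_bd t i j,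
        Finset.sum_eq_zero fun t ht => bd_of_notMem_left (h.2 i t ht).2 j] at hsum
      have : ∀ t ∈ T, (∑ k ∈ Finset.univ.erase i, if i ∈ t then bd t j k else 0) = bd t i j := by
        intro t _
        by_cases hi : i ∈ t
        · simp only [if_pos hi]
          exact sum_erase_bd t i j
        · simp only [if_neg hi, Finset.sum_const_zero]
          rw [bd_of_notMem_left hi]
      rw [Finset.sum_congr rfl this] at hsum
      linarith
    refine ⟨hT, fun i => ⟨fun t ht => (h.2 i t ht).1, fun j k => ?_⟩⟩
    have hi : i ∉ nbrs T i := fun hi => (mem_nbrs.1 hi).1 rfl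
    by_cases hj : j = i
    · subst hj
      rw [bd_of_notMem_left hi]
      exact Finset.sum_eq_zero fun t ht => bd_of_notMem_left (h.2 j t ht).2 k
    by_cases hk : k = i
    · subst hk
      rw [bd_of_notMem_right hi]
      exact Finset.sum_eq_zero fun t ht => bd_of_notMem_right (h.2 k t ht).2 j
    rw [hc i j k hj hk, hlink hT i j k hj hk]
  · rintro ⟨hT, hW⟩ i j k hj hk
    rw [(hW i).2, hlink hT i j k hj hk]

lemma isProper_of_isTriang (hT : IsTriang Finset.univ T)
    (hW : ∀ i, IsTriang (nbrs T i) (W i)) : IsProper T W :=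
  ⟨hT.1, fun i t ht => ⟨(hW i).1 t ht, fun hi => (mem_nbrs.1 ((hW i).subset ht hi)).1 rfl⟩⟩

/-- The chain description of the hypertriangulations of level two of a polygon. -/
lemma IsCcw.isHypertriangulation_two_iff (hp : IsCcw p) (hn : 3 ≤ n)
    {S : Finset (Finset (Finset (Fin n)))} :
    IsHypertriangulation p 2 S ↔ ∃ T W, (IsTriang Finset.univ T ∧
      ∀ i, IsTriang (nbrs T i) (W i)) ∧ faces (blackWhite T W) = S := by
  classical
  obtain ⟨t₀, ht₀, -⟩ := exists_superset_card_three hn (M := ∅) (by simp)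
  rw [isHypertriangulation_iff_exists (Adm := IsBlackOrWhite)]
  · constructor
    · rintro ⟨X, hX, hchain, rfl⟩
      obtain ⟨T, W, h, rfl⟩ := exists_eq_blackWhite hX
      exact ⟨T, W, (h.chain_iff hp hn).1 hchain, rfl⟩
    · rintro ⟨T, W, h, rfl⟩
      have hTW := isProper_of_isTriang h.1 h.2
      exact ⟨_, fun τ hτ => hTW.isBlackOrWhite hτ, (hTW.chain_iff hp hn).2 h, rfl⟩
  · rintro _ ⟨t, ht, rfl | ⟨i, hi, rfl⟩⟩
    · exact hp.isTriangle_black ht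
    · exact hp.isTriangle_white ht hi
  · rintro _ ⟨t, ht, rfl | ⟨i, hi, rfl⟩⟩ C hC hne
    · exact isFace_black ht hC hne
    · exact isFace_white hi hC hne
  · intro C hC hd
    obtain ⟨t, ht, h | ⟨i, hi, h⟩⟩ := subset_black_or_white_of_isFace hn hC hd
    · exact ⟨_, ⟨t, ht, Or.inl rfl⟩, h⟩
    · exact ⟨_, ⟨t, ht, Or.inr ⟨i, hi, rfl⟩⟩, h⟩
  · intro τ hτ A hA B hB hAB hw
    obtain ⟨i, j, k, hj, hk, hjk, rfl, rfl⟩ := exists_common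
      (mem_labels.1 (hτ.subset_labels hA)) (mem_labels.1 (hτ.subset_labels hB)) hAB
      (hτ.not_disjoint hA hB)
    exact (hp.isHullEdge_pair hj hk hjk).2 (hp.isSucc_of_weak hj hk hjk hw)
  · exact ⟨_, t₀, ht₀, Or.inl rfl⟩
  · have hU : 3 ≤ (Finset.univ : Finset (Fin n)).card := by simpa using hn
    let i : Fin n := ⟨0, by lia⟩
    have hex : ∃ b ∈ (Finset.univ : Finset (Fin n)), b ≠ i := Finset.exists_mem_ne (by lia) i
    obtain ⟨k, hk⟩ := exists_isSucc (Finset.mem_univ i) hex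
    obtain ⟨j, hj⟩ := exists_isSucc_left (Finset.mem_univ i) hex
    have hjk : j ≠ k := by
      rintro rfl
      exact hj.not_swap hU hk
    exact ⟨_, _, (hp.isHullEdge_pair hj.2.2.1 hk.2.2.1.symm hjk).2 ⟨hj, hk⟩⟩

lemma IsCcw.card_hypertriangulations_two (hp : IsCcw p) (hn : 3 ≤ n) :
    (hypertriangulations p 2).card =
      ∑ T ∈ triangs Finset.univ, ∏ i : Fin n, (triangs (nbrs T i)).card := by
  classical
  -- The product counts the independent choices of all `W i`, so the right-hand side is the number
  -- of pairs `(T, W)`.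
  simp only [← Fintype.card_piFinset]
  rw [← Finset.card_sigma]
  symm
  have hTW : ∀ x ∈ (triangs Finset.univ).sigma fun T : Finset (Finset (Fin n)) =>
      Fintype.piFinset fun i => triangs (nbrs T i),
      IsTriang Finset.univ x.1 ∧ ∀ i, IsTriang (nbrs x.1 i) (x.2 i) := by
    intro x hx
    rw [Finset.mem_sigma, Fintype.mem_piFinset] at hx
    exact ⟨mem_triangs.1 hx.1, fun i => mem_triangs.1 (hx.2 i)⟩
  refine Finset.card_bij (fun x _ => faces (blackWhite x.1 x.2)) ?_ ?_ ?_
  · intro x hx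
    rw [hypertriangulations, Finset.mem_filter]
    exact ⟨Finset.mem_univ _, (hp.isHypertriangulation_two_iff hn).2 ⟨_, _, hTW x hx, rfl⟩⟩
  · intro x hx y hy h
    have hx' := isProper_of_isTriang (hTW x hx).1 (hTW x hx).2
    have hy' := isProper_of_isTriang (hTW y hy).1 (hTW y hy).2
    have hcard : ∀ {T : Finset (Finset (Fin n))} {W : Fin n → Finset (Finset (Fin n))},
        IsProper T W → ∀ τ ∈ blackWhite T W, τ.card = 3 := by
      intro T W hTW τ hτ
      rcases mem_blackWhite.1 hτ with ⟨t, ht, rfl⟩ | ⟨i, t, ht, rfl⟩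
      · exact (hp.isTriangle_black (hTW.1 t ht)).card
      · exact (hp.isTriangle_white (hTW.2 i t ht).1 (hTW.2 i t ht).2).card
    obtain ⟨h1, h2⟩ := hx'.blackWhite_injective hy'
      (faces_injective_of_card (hcard hx') (hcard hy') h)
    exact Sigma.ext h1 (heq_of_eq h2)
  · intro S hS
    rw [hypertriangulations, Finset.mem_filter] at hS
    obtain ⟨T, W, ⟨hT, hW⟩, h⟩ := (hp.isHypertriangulation_two_iff hn).1 hS.2
    refine ⟨⟨T, W⟩, ?_, h⟩
    rw [Finset.mem_sigma, Fintype.mem_piFinset]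
    exact ⟨mem_triangs.2 hT, fun i => mem_triangs.2 (hW i)⟩

end

/-! ### Invariance under isometries and the clockwise case -/

section

variable {n : ℕ} {E F : Type*} [NormedAddCommGroup E] [NormedSpace ℝ E] [NormedAddCommGroup F]
  [NormedSpace ℝ F]

lemma point_comp (ρ : E ≃ₗᵢ[ℝ] F) (p : Fin n → E) : point (ρ ∘ p) = ρ ∘ point p := by
  funext B
  simp [point_eq_sum]

lemma hull_comp (ρ : E ≃ₗᵢ[ℝ] F) (p : Fin n → E) (C : Finset (Finset (Fin n))) :
    hull (ρ ∘ p) C = ρ '' hull p C := by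
  rw [hull, hull, point_comp, Set.image_comp]
  exact (ρ.toLinearEquiv.toLinearMap.image_convexHull _).symm

lemma IsHypertriangulation.comp {p : Fin n → E} {k : ℕ} {S : Finset (Finset (Finset (Fin n)))}
    (h : IsHypertriangulation p k S) (ρ : E ≃ₗᵢ[ℝ] F) : IsHypertriangulation (ρ ∘ p) k S := by
  refine ⟨⟨h.induced, ?_, ?_, ?_⟩, ?_⟩
  · rintro C hC D ⟨hne, f, hf⟩
    refine h.closed C hC D ⟨hne, f ∘ₗ ρ.toLinearEquiv.toLinearMap, fun B => (hf B).trans ?_⟩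
    rw [point_comp]
    rfl
  · simp only [hull_comp, ← Set.image_iUnion, h.covers]
  · intro C hC D hD hne
    have hint : ∀ s : Set E, intrinsicInterior ℝ (ρ '' s) = ρ '' intrinsicInterior ℝ s :=
      ρ.toLinearIsometry.toAffineIsometry.intrinsicInterior_image
    rw [hull_comp, hull_comp, hint, hint, Set.disjoint_image_iff ρ.injective]
    exact h.disjoint C hC D hD hne
  · intro C hC
    rw [h.fine C hC, dim, dim, point_comp, Set.image_comp]
    have := ρ.toLinearEquiv.toLinearMap.toAffineMap.map_vectorSpan
      (s := point p '' (C : Set (Finset (Fin n))))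
    rw [← (ρ.toLinearEquiv).finrank_map_eq]
    exact congrArg (fun V : Submodule ℝ F => Module.finrank ℝ V) this

lemma hypertriangulations_comp (p : Fin n → E) (k : ℕ) (ρ : E ≃ₗᵢ[ℝ] F) :
    hypertriangulations (ρ ∘ p) k = hypertriangulations p k := by
  ext S
  simp only [hypertriangulations, Finset.mem_filter, Finset.mem_univ, true_and]
  refine ⟨fun h => ?_, fun h => h.comp ρ⟩
  have := h.comp ρ.symm
  rwa [← Function.comp_assoc, ρ.symm_comp_self, Function.id_comp] at this

end

/-- Exchanging the coordinates is an isometry that reverses orientation; it reduces clockwise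
polygons to counterclockwise ones. -/
lemma exists_reflection : ∃ ρ : EuclideanSpace ℝ (Fin 2) ≃ₗᵢ[ℝ] EuclideanSpace ℝ (Fin 2),
    ∀ a b c, cross (ρ a) (ρ b) (ρ c) = -cross a b c := by
  refine ⟨LinearIsometryEquiv.piLpCongrLeft 2 ℝ ℝ (Equiv.swap 0 1), fun a b c => ?_⟩
  simp only [cross, LinearIsometryEquiv.piLpCongrLeft_apply, Equiv.piCongrLeft'_apply,
    Equiv.symm_swap, Equiv.swap_apply_left, Equiv.swap_apply_right]
  ring

end Hypertri

theorem mainTheorem9 (n : ℕ) (p : Fin n → EuclideanSpace ℝ (Fin 2))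
    (hp : Hypertri.IsConvexPolygon p) :
    (Hypertri.hypertriangulations p 2).card =
      ∑ T ∈ Hypertri.triangulations p, ∏ i : Fin n, catalan (Hypertri.degree T i) := by
  obtain ⟨hn, hp | hp⟩ := hp
  · have hp : Hypertri.IsCcw p := hp
    rw [hp.card_hypertriangulations_two hn, hp.sum_triangulations hn]
  · obtain ⟨ρ, hρ⟩ := Hypertri.exists_reflection
    have hq : Hypertri.IsCcw (ρ ∘ p) := fun i j k hij hjk => by
      rw [Function.comp_apply, Function.comp_apply, Function.comp_apply, hρ]
      exact neg_pos.2 (hp i j k hij hjk)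
    rw [Hypertri.triangulations, ← Hypertri.hypertriangulations_comp p 2 ρ,
      ← Hypertri.hypertriangulations_comp p 1 ρ, hq.card_hypertriangulations_two hn]
    exact (hq.sum_triangulations hn).symm
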